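/- **Setting.** Let $G=(V,E)$ be an undirected graph with $V=\{1,\dots,n\}$, unweighted except that a vertex may carry any number of self-loops; each self-loop adds $1$ to the degree $d(u)$. Assume that every degree is positive. For $S\subseteq V$ let $\mathrm{vol}(S)=\sum_{u\in S}d(u)$, let $E(S,V-S)$ be the set of edges between $S$ and $V-S$, and let $$\Phi(S)=\frac{|E(S,V-S)|}{\min(\mathrm{vol}(S),\mathrm{vol}(V-S))},\qquad \Phi(\emptyset)=1.$$ Write $m=\mathrm{vol}(V)/2$ and assume $m\ge 1$. Let $A$ be the adjacency matrix (with the number of self-loops on the diagonal), $D$ the diagonal matrix of degrees, and $M=(AD^{-1}+I)/2$. For a vector $p$, let $S_j(p)$ be the set of the first $j$ vertices in decreasing order of $p(u)/d(u)$, ties broken by the order of the vertices; let $\lambda_j(p)=\mathrm{vol}(S_j(p))$, $$I(p,x)=\max\Big\{\sum_u w(u)p(u)\;:\; w\in[0,1]^V,\ \sum_u w(u)d(u)=x\Big\},$$ and let $I_x(p,x)$ be the derivative of $I(p,\cdot)$ at $x$ taken from the left. For $0<\phi<1$ and an integer $b\ge 0$ put $$\ell=\lceil\log_2 m\rceil,\quad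 t_1=\Big\lceil \tfrac{2}{\phi^2}\ln\big(200(\ell+2)\sqrt{m}\big)\Big\rceil,\quad t_{last}=(\ell+1)t_1,$$ $$f_1(\phi)=\frac1{280(\ell+2)t_{last}},\qquad \epsilon=\frac1{1800(\ell+2)t_{last}2^b}.$$ **The algorithm** $\mathrm{Nibble}(G,v,\phi,b)$. For a vector $p$ let $[p]_\epsilon(u)=p(u)$ if $p(u)\ge d(u)\epsilon$ and $[p]_\epsilon(u)=0$ otherwise. Let $q_0=\chi_v$, $r_0=[q_0]_\epsilon$. For $t=1,\dots,t_{last}$: set $q_t=Mr_{t-1}$, $r_t=[q_t]_\epsilon$; if there is a $j\ge1$ in the search range of round $t$ with * (C.1) $\Phi(S_j(q_t))\le\phi$, * (C.2) $\lambda_j(q_t)\le\frac56\mathrm{vol}(V)$, * (C.3) $2^b\le\lambda_j(q_t)$, * (C.4) $I_x(q_t,2^b)\ge 1/(140(\ell+2)2^b)$, then return $C=S_j(q_t)$ for such a $j$ and stop. If this never happens, return $C=\emptyset$. The search range of round $t$ is $\{1,\dots,k_t\}$, where $|\{u: r_t(u)\ne0\}|\le k_t\le n$; the choice $k_t=n$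 examines all $j$, and the choice $k_t=|\{u:r_t(u)\ne 0\}|$ examines only the vertices that survive the truncation. **Theorem (Nibble).** The algorithm with $k_t=|\{u:r_t(u)\neq 0\}|$ can be implemented by a single program on a real RAM, which on every input $(G,v,\phi,b)$ as above halts with an output of $\mathrm{Nibble}(G,v,\phi,b)$, listed vertex by vertex, and whose running time is $$O\!\left(\frac{2^b\log^6 m}{\phi^4}\right)$$ whenever $m>1$, with an absolute implied constant. (Here $G$ is given by adjacency lists in any order; the numbers $n$ and $\mathrm{vol}(V)$ are part of the input; memory is zero at the start; addition, truncated subtraction, halving with rounding down and comparison of natural numbers, field operations, comparison and the natural logarithm on reals, conversion of natural numbers to reals, reading a degree or an entry of an adjacency list, and memory accesses cost one unit each.) Moreover $f_1(\phi)=\Omega(\phi^2/\log^3 m)$ for $m>1$, with an absolute implied constant, and the following hold for all $0<\phi<1$ and for the outputs of $\mathrm{Nibble}$ with every admissible choice of the search ranges $k_t$. * (N.1) If $C=\mathrm{Nibble}(G,v,\phi,b)$ is non-empty, then $\Phi(C)\le\phi$ and $\mathrm{vol}(C)\le\frac56\mathrm{vol}(V)$. * (N.2) Each set $S\subseteq V$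 with $\mathrm{vol}(S)\le\frac23\mathrm{vol}(V)$ and $\Phi(S)\le f_1(\phi)$ has a subset $S^g$ such that (a) $\mathrm{vol}(S^g)\ge\mathrm{vol}(S)/2$, and (b) for every $b\ge0$, if $v\in S^g$ and $C=\mathrm{Nibble}(G,v,\phi,b)\ne\emptyset$, then $\mathrm{vol}(C\cap S)\ge2^{b-1}$. * (N.3) This set $S^g$ may be partitioned into (possibly empty) subsets $S^g_0,\dots,S^g_\ell$ such that if $v\in S^g_b$, then the set output by $\mathrm{Nibble}(G,v,\phi,b)$ is not empty. -/

import Mathlib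

/-! ### A real RAM

A program is a finite structured program over natural-number registers, real registers,
natural-number arrays and real arrays. All memory cells that are not part of the input are `0`
at the start. Every elementary operation costs one unit of time. The input graph is given by
adjacency lists, which the program reads one entry at a time. -/

namespace RealRAM

/-- Read access to a graph that is stored as adjacency lists: `deg u` is the length of the list of
vertex `u` and `nbr u i` is its `i`-th entry (counted from `0`). -/
structure Oracle where
  deg : ℕ → ℕ
  nbr : ℕ → ℕ → ℕ

/-- The memory: registers and arrays of natural numbers and of reals (arrays are unbounded). -/
structure Store where
  nreg : ℕ → ℕ
  rreg : ℕ → ℝ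
  narr : ℕ → ℕ → ℕ
  rarr : ℕ → ℕ → ℝ

/-- Expressions of natural-number type. There is deliberately no unit-cost multiplication;
`half` is the shift `k ↦ ⌊k / 2⌋` and `sub` is truncated subtraction. -/
inductive NExp where
  | lit (k : ℕ)
  | reg (i : ℕ)
  | arr (a : ℕ) (e : NExp)
  | add (e f : NExp)
  | sub (e f : NExp)
  | half (e : NExp)
  | deg (u : NExp)
  | nbr (u i : NExp)

/-- Expressions of real type: field operations and the natural logarithm. There is no rounding of
reals to integers. -/
inductive RExp where
  | ofNat (e : NExp)
  | reg (i : ℕ)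
  | arr (a : ℕ) (e : NExp)
  | add (e f : RExp)
  | sub (e f : RExp)
  | mul (e f : RExp)
  | div (e f : RExp)
  | log (e : RExp)

/-- Tests. -/
inductive BExp where
  | leN (e f : NExp)
  | leR (e f : RExp)
  | not (c : BExp)
  | and (c d : BExp)

def NExp.eval (O : Oracle) (s : Store) : NExp → ℕ
  | .lit k => k
  | .reg i => s.nreg i
  | .arr a e => s.narr a (e.eval O s)
  | .add e f => e.eval O s + f.eval O s
  | .sub e f => e.eval O s - f.eval O s
  | .half e => e.eval O s / 2
  | .deg u => O.deg (u.eval O s)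
  | .nbr u i => O.nbr (u.eval O s) (i.eval O s)

/-- The time to evaluate an expression is the number of its operations. -/
def NExp.cost : NExp → ℕ
  | .lit _ => 1
  | .reg _ => 1
  | .arr _ e => e.cost + 1
  | .add e f => e.cost + f.cost + 1
  | .sub e f => e.cost + f.cost + 1
  | .half e => e.cost + 1
  | .deg u => u.cost + 1
  | .nbr u i => u.cost + i.cost + 1

noncomputable def RExp.eval (O : Oracle) (s : Store) : RExp → ℝ
  | .ofNat e => (e.eval O s : ℝ)
  | .reg i => s.rreg i
  | .arr a e => s.rarr a (e.eval O s)
  | .add e f => e.eval O s + f.eval O s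
  | .sub e f => e.eval O s - f.eval O s
  | .mul e f => e.eval O s * f.eval O s
  | .div e f => e.eval O s / f.eval O s
  | .log e => Real.log (e.eval O s)

def RExp.cost : RExp → ℕ
  | .ofNat e => e.cost + 1
  | .reg _ => 1
  | .arr _ e => e.cost + 1
  | .add e f => e.cost + f.cost + 1
  | .sub e f => e.cost + f.cost + 1
  | .mul e f => e.cost + f.cost + 1
  | .div e f => e.cost + f.cost + 1
  | .log e => e.cost + 1

def BExp.Holds (O : Oracle) (s : Store) : BExp → Prop
  | .leN e f => e.eval O s ≤ f.eval O s
  | .leR e f => e.eval O s ≤ f.eval O s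
  | .not c => ¬ c.Holds O s
  | .and c d => c.Holds O s ∧ d.Holds O s

def BExp.cost : BExp → ℕ
  | .leN e f => e.cost + f.cost + 1
  | .leR e f => e.cost + f.cost + 1
  | .not c => c.cost + 1
  | .and c d => c.cost + d.cost + 1

/-- Programs. -/
inductive Cmd where
  | skip
  | setN (i : ℕ) (e : NExp)
  | setR (i : ℕ) (e : RExp)
  | storeN (a : ℕ) (idx val : NExp)
  | storeR (a : ℕ) (idx : NExp) (val : RExp)
  | seq (c d : Cmd)
  | cond (g : BExp) (c d : Cmd)
  | loop (g : BExp) (c : Cmd)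

/-- `Exec O c s s' T`: with the graph `O`, the program `c` started in memory `s` halts in memory
`s'` after exactly `T` units of time. `loop g c` repeats `c` as long as `g` holds. -/
inductive Exec (O : Oracle) : Cmd → Store → Store → ℕ → Prop where
  | skip (s : Store) : Exec O .skip s s 1
  | setN (i : ℕ) (e : NExp) (s : Store) :
      Exec O (.setN i e) s { s with nreg := Function.update s.nreg i (e.eval O s) } (e.cost + 1)
  | setR (i : ℕ) (e : RExp) (s : Store) :
      Exec O (.setR i e) s { s with rreg := Function.update s.rreg i (e.eval O s) } (e.cost + 1)
  | storeN (a : ℕ) (idx val : NExp) (s : Store) :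
      Exec O (.storeN a idx val) s
        { s with
          narr := Function.update s.narr a
            (Function.update (s.narr a) (idx.eval O s) (val.eval O s)) }
        (idx.cost + val.cost + 1)
  | storeR (a : ℕ) (idx : NExp) (val : RExp) (s : Store) :
      Exec O (.storeR a idx val) s
        { s with
          rarr := Function.update s.rarr a
            (Function.update (s.rarr a) (idx.eval O s) (val.eval O s)) }
        (idx.cost + val.cost + 1)
  | seq {c d : Cmd} {s s' s'' : Store} {T T' : ℕ} :
      Exec O c s s' T → Exec O d s' s'' T' → Exec O (.seq c d) s s'' (T + T')
  | condTrue {g : BExp} {c d : Cmd} {s s' : Store} {T : ℕ} :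
      g.Holds O s → Exec O c s s' T → Exec O (.cond g c d) s s' (g.cost + T + 1)
  | condFalse {g : BExp} {c d : Cmd} {s s' : Store} {T : ℕ} :
      ¬ g.Holds O s → Exec O d s s' T → Exec O (.cond g c d) s s' (g.cost + T + 1)
  | loopStop {g : BExp} {c : Cmd} {s : Store} :
      ¬ g.Holds O s → Exec O (.loop g c) s s (g.cost + 1)
  | loopStep {g : BExp} {c : Cmd} {s s' s'' : Store} {T T' : ℕ} :
      g.Holds O s → Exec O c s s' T → Exec O (.loop g c) s' s'' T' →
      Exec O (.loop g c) s s'' (g.cost + T + T' + 1)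

/-- The memory at the start: natural-number registers `0, 1, 2, 3` hold the start vertex, the
parameter `b`, the number of vertices and the total volume of the graph, real register `0` holds
`φ`, and everything else is `0`. -/
noncomputable def start (v b n vol : ℕ) (φ : ℝ) : Store where
  nreg i := if i = 0 then v else if i = 1 then b else if i = 2 then n else if i = 3 then vol else 0
  rreg i := if i = 0 then φ else 0
  narr _ _ := 0
  rarr _ _ := 0

/-- The memory `s` holds the vertex set `C` as output: register `0` contains a number `k`, and the
first `k` entries of array `0` list the elements of `C`. -/
def Store.Outputs (s : Store) {n : ℕ} (C : Finset (Fin n)) : Prop :=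
  (∀ i < s.nreg 0, ∃ u ∈ C, s.narr 0 i = (u : ℕ)) ∧
  (∀ u ∈ C, ∃ i < s.nreg 0, s.narr 0 i = (u : ℕ))

end RealRAM

/-- An undirected graph on the vertices `0, …, n - 1`, unweighted except that every vertex `u`
carries `loops u` self-loops. -/
structure LoopGraph (n : ℕ) where
  graph : SimpleGraph (Fin n)
  loops : Fin n → ℕ

namespace LoopGraph

variable {n : ℕ}

open Classical in
/-- The degree; each self-loop adds `1`. -/
noncomputable def deg (G : LoopGraph n) (u : Fin n) : ℕ :=
  G.graph.degree u + G.loops u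

noncomputable def vol (G : LoopGraph n) (S : Finset (Fin n)) : ℕ :=
  ∑ u ∈ S, G.deg u

/-- The number `m` of edges, in the normalization `vol V = 2 m` (so a self-loop counts `1 / 2`). -/
noncomputable def m (G : LoopGraph n) : ℝ :=
  (G.vol Finset.univ : ℝ) / 2

open Classical in
/-- The number of edges between `S` and its complement. -/
noncomputable def cut (G : LoopGraph n) (S : Finset (Fin n)) : ℕ :=
  (G.graph.interedges S Sᶜ).card

noncomputable def conductance (G : LoopGraph n) (S : Finset (Fin n)) : ℝ :=
  if S = ∅ then 1 else (G.cut S : ℝ) / min (G.vol S : ℝ) (G.vol Sᶜ : ℝ)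

open Classical in
/-- Entries of the adjacency matrix. -/
noncomputable def mult (G : LoopGraph n) (u w : Fin n) : ℕ :=
  if u = w then G.loops u else if G.graph.Adj u w then 1 else 0

noncomputable def adjMatrix (G : LoopGraph n) : Matrix (Fin n) (Fin n) ℝ :=
  Matrix.of fun u w => (G.mult u w : ℝ)

/-- The matrix `M = (A D⁻¹ + I) / 2` of the lazy random walk. -/
noncomputable def walkMatrix (G : LoopGraph n) : Matrix (Fin n) (Fin n) ℝ :=
  (1 / 2 : ℝ) • (G.adjMatrix * Matrix.diagonal (fun u => ((G.deg u : ℝ))⁻¹) + 1)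

/-- `adj u` lists the endpoints of the edges at `u`, in any order, with each self-loop at `u`
contributing one entry `u`. -/
def IsAdjList (G : LoopGraph n) (adj : Fin n → List (Fin n)) : Prop :=
  ∀ u w, (adj u).count w = G.mult u w

/-- The adjacency lists as seen by a program; requests outside the lists are answered by `0`. -/
def oracle (adj : Fin n → List (Fin n)) : RealRAM.Oracle where
  deg u := if h : u < n then (adj ⟨u, h⟩).length else 0
  nbr u i := if h : u < n then (((adj ⟨u, h⟩)[i]?).map Fin.val).getD 0 else 0

/-! ### The sweep sets and the Lovász–Simonovits curve -/

/-- `u` comes before `w` when vertices are sorted by decreasing `p u / d u`, ties broken by the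
order of the vertices. -/
def Before (G : LoopGraph n) (p : Fin n → ℝ) (u w : Fin n) : Prop :=
  p w / G.deg w < p u / G.deg u ∨ (p u / G.deg u = p w / G.deg w ∧ u < w)

open Classical in
/-- `S_j(p)`, the first `j` vertices in that order. -/
noncomputable def sweep (G : LoopGraph n) (p : Fin n → ℝ) (j : ℕ) : Finset (Fin n) :=
  Finset.univ.filter fun u => (Finset.univ.filter fun w => G.Before p w u).card < j

/-- `I(p, x)`, the maximum of `∑ w(u) p(u)` over `w ∈ [0,1]^V` with `∑ w(u) d(u) = x`
(meaningful for `0 ≤ x ≤ vol V`). -/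
noncomputable def lsCurve (G : LoopGraph n) (p : Fin n → ℝ) (x : ℝ) : ℝ :=
  sSup {y : ℝ | ∃ w : Fin n → ℝ, (∀ u, 0 ≤ w u ∧ w u ≤ 1) ∧
    ∑ u, w u * (G.deg u : ℝ) = x ∧ y = ∑ u, w u * p u}

/-- `I_x(p, x)`, the derivative of `I(p, ·)` at `x`, taken from the left. -/
noncomputable def lsSlope (G : LoopGraph n) (p : Fin n → ℝ) (x : ℝ) : ℝ :=
  derivWithin (G.lsCurve p) (Set.Iic x) x

/-! ### The algorithm `Nibble` -/

noncomputable def ell (G : LoopGraph n) : ℕ :=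
  ⌈Real.logb 2 ((G.vol Finset.univ : ℝ) / 2)⌉₊

noncomputable def tOne (G : LoopGraph n) (φ : ℝ) : ℕ :=
  ⌈2 / φ ^ 2 *
    Real.log (200 * ((G.ell : ℝ) + 2) * Real.sqrt ((G.vol Finset.univ : ℝ) / 2))⌉₊

noncomputable def tLast (G : LoopGraph n) (φ : ℝ) : ℕ :=
  (G.ell + 1) * G.tOne φ

noncomputable def fOne (G : LoopGraph n) (φ : ℝ) : ℝ :=
  1 / (280 * ((G.ell : ℝ) + 2) * (G.tLast φ : ℝ))

/-- The truncation threshold `ε`. -/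
noncomputable def eps (G : LoopGraph n) (φ : ℝ) (b : ℕ) : ℝ :=
  1 / (1800 * ((G.ell : ℝ) + 2) * (G.tLast φ : ℝ) * 2 ^ b)

open Classical in
/-- Entries of `p` with `p u < d(u) ε` are replaced by `0`. -/
noncomputable def trunc (G : LoopGraph n) (ε : ℝ) (p : Fin n → ℝ) : Fin n → ℝ :=
  fun u => if (G.deg u : ℝ) * ε ≤ p u then p u else 0

/-- The vectors `r_t` of the truncated walk from `v`. -/
noncomputable def rVec (G : LoopGraph n) (φ : ℝ) (b : ℕ) (v : Fin n) : ℕ → Fin n → ℝ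
  | 0 => G.trunc (G.eps φ b) (Pi.single v 1)
  | t + 1 => G.trunc (G.eps φ b) (G.walkMatrix.mulVec (rVec G φ b v t))

/-- The vectors `q_t`: `q_0 = χ_v` and `q_{t+1} = M r_t`. -/
noncomputable def qVec (G : LoopGraph n) (φ : ℝ) (b : ℕ) (v : Fin n) : ℕ → Fin n → ℝ
  | 0 => Pi.single v 1
  | t + 1 => G.walkMatrix.mulVec (G.rVec φ b v t)

/-- Conditions (C.1), (C.2), (C.3), (C.4) for the sweep set `S_j(q_t)`. -/
def StopCond (G : LoopGraph n) (φ : ℝ) (b : ℕ) (v : Fin n) (t j : ℕ) : Prop :=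
  G.conductance (G.sweep (G.qVec φ b v t) j) ≤ φ ∧
  (G.vol (G.sweep (G.qVec φ b v t) j) : ℝ) ≤ 5 / 6 * (G.vol Finset.univ : ℝ) ∧
  (2 : ℝ) ^ b ≤ (G.vol (G.sweep (G.qVec φ b v t) j) : ℝ) ∧
  1 / (140 * ((G.ell : ℝ) + 2) * 2 ^ b) ≤ G.lsSlope (G.qVec φ b v t) (2 ^ b)

/-- `C` is a possible output of `Nibble(G, v, φ, b)` when in round `t` the sweep sets
`S_1(q_t), …, S_{k t}(q_t)` are examined: the algorithm stops in the first round `1 ≤ t ≤ t_last`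
in which one of them satisfies (C.1)-(C.4) and returns such a set, and it returns `∅` if there is
no such round. -/
def NibbleOutput (G : LoopGraph n) (φ : ℝ) (b : ℕ) (v : Fin n) (k : ℕ → ℕ)
    (C : Finset (Fin n)) : Prop :=
  (∃ t, 1 ≤ t ∧ t ≤ G.tLast φ ∧
    (∀ s, 1 ≤ s → s < t → ¬ ∃ j, 1 ≤ j ∧ j ≤ k s ∧ G.StopCond φ b v s j) ∧
    ∃ j, 1 ≤ j ∧ j ≤ k t ∧ G.StopCond φ b v t j ∧ C = G.sweep (G.qVec φ b v t) j) ∨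
  ((∀ t, 1 ≤ t → t ≤ G.tLast φ → ¬ ∃ j, 1 ≤ j ∧ j ≤ k t ∧ G.StopCond φ b v t j) ∧ C = ∅)

open Classical in
/-- The number of vertices that survive the truncation in round `t`. -/
noncomputable def survivors (G : LoopGraph n) (φ : ℝ) (b : ℕ) (v : Fin n) (t : ℕ) : ℕ :=
  (Finset.univ.filter fun u => G.rVec φ b v t u ≠ 0).card

/-- The search ranges in step (C) that are allowed: in every round at least the sweep sets made of
vertices that survive the truncation, at most all sweep sets. -/
def Admissible (G : LoopGraph n) (φ : ℝ) (b : ℕ) (v : Fin n) (k : ℕ → ℕ) : Prop :=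
  ∀ t, G.survivors φ b v t ≤ k t ∧ k t ≤ n

end LoopGraph

/-! ### Volumes, cuts and arc counts -/

namespace LoopGraph

variable {n : ℕ}

/-! Progress of the walk is measured by the curve `lsCurve`. It is concave and piecewise linear with
breakpoints at the volumes of the sweep sets, and for a nonnegative vector its value at `x` bounds
the mass of every set of volume at most `x`. A step of the walk never raises it. By `sum_walk_le`,
the new mass of a set `T` is at most the average of the old curve at `vol T - cut T` and `vol T +
cut T`; hence the curve flattens when all sweep sets expand.

Suppose that at scale `b` no sweep set of surviving vertices is ever accepted (`Fails`). Then
`lsCurve_phase_le` gives a dichotomy. If the left slope at `2 ^ b` falls below its threshold in some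
round, the supporting line there keeps the curve low beyond `2 ^ b`, and it stays low because the
curve of the untruncated walk only decreases. Otherwise every sweep set of survivors with volume
between `2 ^ b` and `5/6 vol V` must violate the conductance bound, and the curve stays below an
`envelope` whose square-root term shrinks by the factor `1 - φ² / 8` in every round
(`lsCurve_trunc_walk_le`). Truncation removes at most `ε d(u)` from vertex `u` per round, and the
walk fixes the vector `d`, so the losses merely add up (`pVec_le_rVec_add`).

If all scales `b ≤ ℓ` failed, phases at the scales `4 ^ k` could be chained, each adding only a
constant over `ℓ + 2` (`lsCurve_chain_le`), and a last phase would push the curve at `2/3 vol V`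
below `1 - 1 / (280 (ℓ + 2))` at time `t_last`. But from a vertex of `goodSet` the walk stays in `S`
for `t_last` steps with probability at least `1 - t_last Φ(S)`, and this is at least that number,
while `vol S ≤ 2/3 vol V`. So every good vertex has a scale at which something is accepted
(`exists_not_fails`), and choosing one such scale per vertex gives the partition. The good set has
half of the volume by Markov's inequality, since the walk that starts with the degree vector on `S`
loses at most `cut S / 2` per step.

For the overlap with `S` (`half_le_vol_inter`), the slope condition says that the vertices filling
the volume up to `2 ^ b` have density at least `1 / (140 (ℓ + 2) 2 ^ b)`. The mass that has left `S`
is at most `1 / (280 (ℓ + 2))`, so it can account for a volume of at most `2 ^ b / 2` among them.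

For the running time, every survivor carries at least `ε d(u)` of a total mass at most `1`, so
survivors have volume at most `1 / ε` (`suppVol_rVec_le`). A round spreads mass only along their
arcs, stamps array cells with the round number instead of clearing them, and sorts the survivors by
a tournament tree in logarithmic time per vertex, updating volume, inner arcs and slope as it
sweeps. Over `t_last` rounds this costs `O((ℓ + 2)² t_last² 2 ^ b)`, which `param_bounds` converts
into the stated bound. -/

theorem mult_symm (G : LoopGraph n) (u w : Fin n) : G.mult u w = G.mult w u := by
  unfold mult
  by_cases h : u = w
  · subst h; rfl
  · rw [if_neg h, if_neg (Ne.symm h)]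
    by_cases h2 : G.graph.Adj u w
    · simp [h2, h2.symm]
    · have h3 : ¬ G.graph.Adj w u := fun h => h2 h.symm
      simp [h2, h3]

theorem deg_eq_sum_mult (G : LoopGraph n) (u : Fin n) : G.deg u = ∑ w, G.mult u w := by
  classical
  have h : ∀ w, G.mult u w = (if G.graph.Adj u w then 1 else 0) + if u = w then G.loops u else 0 := by
    intro w
    unfold mult
    by_cases h : u = w
    · subst h; simp
    · simp [h]
  simp only [h, Finset.sum_add_distrib, Finset.sum_ite_eq, Finset.mem_univ, if_true, deg]
  congr 1
  rw [← SimpleGraph.card_neighborFinset_eq_degree, Finset.sum_boole, SimpleGraph.neighborFinset_eq_filter]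
  simp only [Nat.cast_id]

theorem cut_eq_sum_mult (G : LoopGraph n) (S : Finset (Fin n)) :
    G.cut S = ∑ u ∈ S, ∑ w ∈ Sᶜ, G.mult u w := by
  classical
  have h : ∀ u ∈ S, ∀ w ∈ Sᶜ, G.mult u w = if G.graph.Adj u w then 1 else 0 := by
    intro u hu w hw
    have : u ≠ w := by rintro rfl; exact (Finset.mem_compl.1 hw) hu
    simp [mult, this]
  rw [Finset.sum_congr rfl fun u hu => Finset.sum_congr rfl (h u hu), ← Finset.sum_product']
  rw [Finset.sum_boole, cut, SimpleGraph.interedges, Rel.interedges]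
  simp only [Nat.cast_id]

theorem vol_mono (G : LoopGraph n) {S T : Finset (Fin n)} (h : S ⊆ T) : G.vol S ≤ G.vol T :=
  Finset.sum_le_sum_of_subset h

theorem vol_add_vol_compl (G : LoopGraph n) (S : Finset (Fin n)) :
    G.vol S + G.vol Sᶜ = G.vol Finset.univ := by
  classical
  exact Finset.sum_add_sum_compl S _

theorem vol_pos (G : LoopGraph n) (hd : ∀ u, 0 < G.deg u) {S : Finset (Fin n)}
    (hS : S.Nonempty) : 0 < G.vol S :=
  Finset.sum_pos (fun u _ => hd u) hS

/-- The arcs at the vertices of `S` are sorted by their other end. This gives the volume `vol S -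
cut S` in `sum_walk_le`, and the program obtains the cut as a difference in this way. -/
theorem cut_add_inner (G : LoopGraph n) (S : Finset (Fin n)) :
    G.cut S + ∑ u ∈ S, ∑ w ∈ S, G.mult u w = G.vol S := by
  classical
  rw [cut_eq_sum_mult, ← Finset.sum_add_distrib]
  refine Finset.sum_congr rfl fun u _ => ?_
  rw [deg_eq_sum_mult, add_comm]
  exact Finset.sum_add_sum_compl S _

theorem cut_compl (G : LoopGraph n) (S : Finset (Fin n)) : G.cut Sᶜ = G.cut S := by
  classical
  rw [cut_eq_sum_mult, cut_eq_sum_mult, compl_compl, Finset.sum_comm]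
  exact Finset.sum_congr rfl fun u _ => Finset.sum_congr rfl fun w _ => G.mult_symm w u

theorem cut_le_vol (G : LoopGraph n) (S : Finset (Fin n)) : G.cut S ≤ G.vol S :=
  (Nat.le_add_right _ _).trans (G.cut_add_inner S).le

theorem cut_le_vol_compl (G : LoopGraph n) (S : Finset (Fin n)) : G.cut S ≤ G.vol Sᶜ :=
  G.cut_compl S ▸ G.cut_le_vol Sᶜ

theorem sum_mult_div_deg (G : LoopGraph n) (hd : ∀ u, 0 < G.deg u) (u : Fin n) :
    (∑ w, (G.mult u w : ℝ)) / G.deg u = 1 := by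
  have : (0 : ℝ) < G.deg u := by exact_mod_cast hd u
  rw [← Nat.cast_sum, ← deg_eq_sum_mult, div_self this.ne']

/-! ### The lazy random walk -/

theorem walk_apply (G : LoopGraph n) (p : Fin n → ℝ) (u : Fin n) :
    G.walkMatrix.mulVec p u = (∑ w, (G.mult u w : ℝ) * (p w / G.deg w) + p u) / 2 := by
  classical
  simp only [walkMatrix, Matrix.smul_mulVec, Matrix.add_mulVec, Matrix.one_mulVec, Pi.smul_apply,
    Pi.add_apply, ← Matrix.mulVec_mulVec, smul_eq_mul, adjMatrix]
  rw [Matrix.mulVec, dotProduct]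
  simp only [Matrix.of_apply, Matrix.mulVec_diagonal]
  rw [one_div_mul_eq_div]
  congr 2
  exact Finset.sum_congr rfl fun w _ => by ring

theorem walk_mono (G : LoopGraph n) {p q : Fin n → ℝ} (h : ∀ u, p u ≤ q u) (u : Fin n) :
    G.walkMatrix.mulVec p u ≤ G.walkMatrix.mulVec q u := by
  rw [walk_apply, walk_apply]
  have : ∀ w, (G.mult u w : ℝ) * (p w / G.deg w) ≤ (G.mult u w : ℝ) * (q w / G.deg w) := by
    intro w
    have := h w
    gcongr
  have h1 := Finset.sum_le_sum fun w (_ : w ∈ Finset.univ) => this w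
  linarith [h u]

theorem walk_nonneg (G : LoopGraph n) {p : Fin n → ℝ} (h : ∀ u, 0 ≤ p u) (u : Fin n) :
    0 ≤ G.walkMatrix.mulVec p u := by
  have := G.walk_mono (p := 0) h u
  simpa using this

theorem walk_deg (G : LoopGraph n) (hd : ∀ u, 0 < G.deg u) :
    G.walkMatrix.mulVec (fun u => (G.deg u : ℝ)) = fun u => (G.deg u : ℝ) := by
  funext u
  rw [walk_apply]
  have : ∀ w, (G.mult u w : ℝ) * ((G.deg w : ℝ) / G.deg w) = G.mult u w := by
    intro w
    have : (0 : ℝ) < G.deg w := by exact_mod_cast hd w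
    rw [div_self this.ne', mul_one]
  simp only [this]
  rw [← Nat.cast_sum, ← deg_eq_sum_mult]
  ring

/-- The adjoint of the walk, acting on test functions. -/
noncomputable def coWalk (G : LoopGraph n) (w : Fin n → ℝ) (u : Fin n) : ℝ :=
  ((∑ x, (G.mult u x : ℝ) * w x) / G.deg u + w u) / 2

/-- By the symmetry of `mult`, a step of the walk can be moved from the vector to the test function.
The bounds on the curve and on the staying probabilities all rest on this duality. -/
theorem sum_mul_walk (G : LoopGraph n) (w p : Fin n → ℝ) :
    ∑ u, w u * G.walkMatrix.mulVec p u = ∑ u, G.coWalk w u * p u := by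
  simp only [walk_apply, coWalk]
  have : ∑ u, w u * ∑ x, (G.mult u x : ℝ) * (p x / G.deg x) =
      ∑ u, (∑ x, (G.mult u x : ℝ) * w x) / G.deg u * p u := by
    simp only [Finset.mul_sum, Finset.sum_div, Finset.sum_mul]
    rw [Finset.sum_comm]
    refine Finset.sum_congr rfl fun u _ => Finset.sum_congr rfl fun x _ => ?_
    rw [G.mult_symm x u]; ring
  calc _ = (∑ u, w u * ∑ x, (G.mult u x : ℝ) * (p x / G.deg x) + ∑ u, w u * p u) / 2 := by
        rw [← Finset.sum_add_distrib, Finset.sum_div]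
        exact Finset.sum_congr rfl fun u _ => by ring
    _ = _ := by
        rw [this, ← Finset.sum_add_distrib, Finset.sum_div]
        exact Finset.sum_congr rfl fun u _ => by ring

theorem coWalk_mem (G : LoopGraph n) (hd : ∀ u, 0 < G.deg u) {w : Fin n → ℝ}
    (hw : ∀ u, 0 ≤ w u ∧ w u ≤ 1) (u : Fin n) : 0 ≤ G.coWalk w u ∧ G.coWalk w u ≤ 1 := by
  have hdu : (0 : ℝ) < G.deg u := by exact_mod_cast hd u
  have h0 : 0 ≤ (∑ x, (G.mult u x : ℝ) * w x) :=
    Finset.sum_nonneg fun x _ => mul_nonneg (Nat.cast_nonneg _) (hw x).1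
  have h1 : (∑ x, (G.mult u x : ℝ) * w x) / G.deg u ≤ 1 := by
    rw [← G.sum_mult_div_deg hd u]
    gcongr with x
    exact mul_le_of_le_one_right (Nat.cast_nonneg _) (hw x).2
  have h2 := div_nonneg h0 hdu.le
  unfold coWalk
  constructor <;> linarith [(hw u).1, (hw u).2]

theorem sum_walk (G : LoopGraph n) (hd : ∀ u, 0 < G.deg u) (p : Fin n → ℝ) :
    ∑ u, G.walkMatrix.mulVec p u = ∑ u, p u := by
  have := G.sum_mul_walk (fun _ => 1) p
  simp only [one_mul, coWalk, mul_one, G.sum_mult_div_deg hd] at this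
  rw [this]
  exact Finset.sum_congr rfl fun u _ => by ring

/-! ### The Lovász–Simonovits curve -/

/-- The fractional vertex sets of volume `x`. -/
def Fractional (G : LoopGraph n) (x : ℝ) (w : Fin n → ℝ) : Prop :=
  (∀ u, 0 ≤ w u ∧ w u ≤ 1) ∧ ∑ u, w u * (G.deg u : ℝ) = x

theorem le_lsCurve (G : LoopGraph n) (p : Fin n → ℝ) {x : ℝ} {w : Fin n → ℝ}
    (h : G.Fractional x w) : ∑ u, w u * p u ≤ G.lsCurve p x := by
  refine le_csSup ⟨∑ u, |p u|, ?_⟩ ⟨w, h.1, h.2, rfl⟩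
  rintro y ⟨w, hw, -, rfl⟩
  refine Finset.sum_le_sum fun u _ => ?_
  calc w u * p u ≤ w u * |p u| := mul_le_mul_of_nonneg_left (le_abs_self _) (hw u).1
    _ ≤ 1 * |p u| := mul_le_mul_of_nonneg_right (hw u).2 (abs_nonneg _)
    _ = |p u| := one_mul _

theorem exists_fractional (G : LoopGraph n) {x : ℝ} (h0 : 0 ≤ x) (h1 : x ≤ G.vol Finset.univ) :
    ∃ w, G.Fractional x w := by
  rcases eq_or_lt_of_le (h0.trans h1) with h | h
  · refine ⟨0, fun u => by simp, ?_⟩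
    have : x = 0 := by linarith
    simp [this]
  · refine ⟨fun _ => x / G.vol Finset.univ, fun u => ⟨by positivity, div_le_one_of_le₀ h1 h.le⟩, ?_⟩
    rw [← Finset.mul_sum, ← Nat.cast_sum]
    exact div_mul_cancel₀ _ h.ne'

theorem lsCurve_le (G : LoopGraph n) (p : Fin n → ℝ) {x B : ℝ} (h0 : 0 ≤ x)
    (h1 : x ≤ G.vol Finset.univ) (h : ∀ w, G.Fractional x w → ∑ u, w u * p u ≤ B) :
    G.lsCurve p x ≤ B := by
  obtain ⟨w, hw⟩ := G.exists_fractional h0 h1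
  refine csSup_le ⟨_, w, hw.1, hw.2, rfl⟩ ?_
  rintro y ⟨w, hw, hx, rfl⟩
  exact h w ⟨hw, hx⟩

theorem lsCurve_mono (G : LoopGraph n) {p q : Fin n → ℝ} (h : ∀ u, p u ≤ q u) {x : ℝ} (h0 : 0 ≤ x)
    (h1 : x ≤ G.vol Finset.univ) : G.lsCurve p x ≤ G.lsCurve q x :=
  G.lsCurve_le p h0 h1 fun _ hw =>
    (Finset.sum_le_sum fun u _ => mul_le_mul_of_nonneg_left (h u) (hw.1 u).1).trans
      (G.le_lsCurve q hw)

/-- An error proportional to the degrees contributes `c` times the volume of the fractional set,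
whichever set it is. The truncation loss enters in this form. -/
theorem lsCurve_le_add (G : LoopGraph n) {p q : Fin n → ℝ} {c : ℝ}
    (h : ∀ u, p u ≤ q u + c * G.deg u) {x : ℝ} (h0 : 0 ≤ x) (h1 : x ≤ G.vol Finset.univ) :
    G.lsCurve p x ≤ G.lsCurve q x + c * x := by
  refine G.lsCurve_le p h0 h1 fun w hw => ?_
  have h2 := G.le_lsCurve q hw
  have : ∑ u, w u * p u ≤ ∑ u, (w u * q u + c * (w u * G.deg u)) :=
    Finset.sum_le_sum fun u _ => by
      have := mul_le_mul_of_nonneg_left (h u) (hw.1 u).1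
      linarith
  rw [Finset.sum_add_distrib, ← Finset.mul_sum, hw.2] at this
  linarith

/-- The curve of a vector with nonnegative entries is nondecreasing. -/
theorem lsCurve_monotone (G : LoopGraph n) {p : Fin n → ℝ} (hp : ∀ u, 0 ≤ p u) {x y : ℝ}
    (h0 : 0 ≤ x) (hxy : x ≤ y) (h1 : y ≤ G.vol Finset.univ) : G.lsCurve p x ≤ G.lsCurve p y := by
  refine G.lsCurve_le p h0 (hxy.trans h1) fun w hw => ?_
  rcases eq_or_lt_of_le (hxy.trans h1) with h | h
  · have : x = y := le_antisymm hxy (by linarith)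
    exact this ▸ G.le_lsCurve p hw
  set V : ℝ := (G.vol Finset.univ : ℝ) with hV
  -- The same fraction `θ` of the unused capacity of every vertex is filled, which raises the volume
  -- from `x` to exactly `y`.
  set θ : ℝ := (y - x) / (V - x) with hθ
  have hpos : 0 < V - x := by linarith
  have hθ0 : 0 ≤ θ := div_nonneg (by linarith) hpos.le
  have hθ1 : θ ≤ 1 := div_le_one_of_le₀ (by linarith) hpos.le
  have hf : G.Fractional y (fun u => w u + θ * (1 - w u)) := by
    refine ⟨fun u => ⟨?_, ?_⟩, ?_⟩
    · nlinarith [hw.1 u]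
    · nlinarith [hw.1 u]
    · have : ∀ u, (w u + θ * (1 - w u)) * (G.deg u : ℝ) =
          w u * G.deg u + θ * (G.deg u - w u * G.deg u) := fun u => by ring
      simp only [this]
      rw [Finset.sum_add_distrib, ← Finset.mul_sum, Finset.sum_sub_distrib, hw.2, ← Nat.cast_sum]
      change x + θ * (V - x) = y
      rw [hθ]; field_simp; ring
  refine le_trans (Finset.sum_le_sum fun u _ => ?_) (G.le_lsCurve p hf)
  refine mul_le_mul_of_nonneg_right ?_ (hp u)
  nlinarith [hw.1 u]

/-- `coWalk` maps fractional sets to fractional sets, and it keeps their volume because the walk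
fixes the degree vector. So every competitor for the new vector is matched by one for the old
vector. -/
theorem lsCurve_walk_le (G : LoopGraph n) (hd : ∀ u, 0 < G.deg u) (p : Fin n → ℝ) {x : ℝ}
    (h0 : 0 ≤ x) (h1 : x ≤ G.vol Finset.univ) :
    G.lsCurve (G.walkMatrix.mulVec p) x ≤ G.lsCurve p x := by
  refine G.lsCurve_le _ h0 h1 fun w hw => ?_
  rw [sum_mul_walk]
  refine G.le_lsCurve p ⟨G.coWalk_mem hd hw.1, ?_⟩
  rw [← sum_mul_walk, G.walk_deg hd, hw.2]

/-- The inequality of Lovász and Simonovits for one step of the walk. -/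
theorem sum_walk_le (G : LoopGraph n) (hd : ∀ u, 0 < G.deg u) (p : Fin n → ℝ)
    (S : Finset (Fin n)) :
    ∑ u ∈ S, G.walkMatrix.mulVec p u ≤
      (G.lsCurve p (G.vol S - G.cut S) + G.lsCurve p (G.vol S + G.cut S)) / 2 := by
  classical
  -- `e u` is the fraction of the arcs at `u` that end in `S`. The dual image of the indicator of
  -- `S` is the average of two fractional sets: `e` restricted to `S`, of volume `vol S - cut S`,
  -- and `1` on `S` with `e` outside, of volume `vol S + cut S`.
  set e : Fin n → ℝ := fun u => (∑ x ∈ S, (G.mult u x : ℝ)) / G.deg u with he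
  have he0 : ∀ u, 0 ≤ e u := fun u => by positivity
  have he1 : ∀ u, e u ≤ 1 := fun u => by
    rw [← G.sum_mult_div_deg hd u]
    simp only [he]
    gcongr
    exact Finset.subset_univ _
  have hed : ∀ u, e u * G.deg u = ∑ x ∈ S, (G.mult u x : ℝ) := fun u => by
    have : (0 : ℝ) < G.deg u := by exact_mod_cast hd u
    exact div_mul_cancel₀ _ this.ne'
  have hinner : ∑ u ∈ S, ∑ x ∈ S, (G.mult u x : ℝ) = G.vol S - G.cut S := by
    have := G.cut_add_inner S
    rw [eq_sub_iff_add_eq']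
    exact_mod_cast this
  have hcut : ∑ u ∈ Sᶜ, ∑ x ∈ S, (G.mult u x : ℝ) = G.cut S := by
    have := G.cut_eq_sum_mult Sᶜ
    rw [cut_compl, compl_compl] at this
    exact_mod_cast this.symm
  have h1 : G.Fractional (G.vol S - G.cut S) (fun u => if u ∈ S then e u else 0) := by
    refine ⟨fun u => ?_, ?_⟩
    · dsimp only
      split_ifs
      · exact ⟨he0 u, he1 u⟩
      · simp
    · simp only [ite_mul, zero_mul, hed, Finset.sum_ite_mem, Finset.univ_inter]
      exact hinner
  have h2 : G.Fractional (G.vol S + G.cut S) (fun u => if u ∈ S then 1 else e u) := by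
    refine ⟨fun u => ?_, ?_⟩
    · dsimp only
      split_ifs
      · simp
      · exact ⟨he0 u, he1 u⟩
    · simp only [ite_mul, one_mul, hed]
      rw [← Finset.sum_add_sum_compl S, ← hcut]
      congr 1
      · rw [Finset.sum_congr rfl fun u hu => if_pos hu, vol, Nat.cast_sum]
      · exact Finset.sum_congr rfl fun u hu => if_neg (Finset.mem_compl.1 hu)
  have h3 : ∑ u ∈ S, G.walkMatrix.mulVec p u =
      ∑ u, G.coWalk (fun u => if u ∈ S then 1 else 0) u * p u := by
    rw [← sum_mul_walk]
    simp
  have h4 : ∀ u, G.coWalk (fun u => if u ∈ S then 1 else 0) u * p u =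
      ((if u ∈ S then e u else 0) * p u + (if u ∈ S then 1 else e u) * p u) / 2 := by
    intro u
    simp only [coWalk, mul_ite, mul_one, mul_zero, Finset.sum_ite_mem, Finset.univ_inter]
    change (e u + _) / 2 * p u = _
    split_ifs <;> ring
  rw [h3, Finset.sum_congr rfl fun u _ => h4 u, ← Finset.sum_div, Finset.sum_add_distrib]
  linarith [G.le_lsCurve p h1, G.le_lsCurve p h2]

end LoopGraph

namespace LoopGraph

variable {n : ℕ}

/-! ### The sweep order -/

theorem before_irrefl (G : LoopGraph n) (p : Fin n → ℝ) (u : Fin n) : ¬ G.Before p u u := by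
  simp [Before]

theorem Before.trans {G : LoopGraph n} {p : Fin n → ℝ} {u v w : Fin n} (h1 : G.Before p u v)
    (h2 : G.Before p v w) : G.Before p u w := by
  unfold Before at *
  rcases h1 with h1 | ⟨h1, h1'⟩ <;> rcases h2 with h2 | ⟨h2, h2'⟩
  · exact Or.inl (h2.trans h1)
  · exact Or.inl (h2 ▸ h1)
  · exact Or.inl (h1 ▸ h2)
  · exact Or.inr ⟨h1.trans h2, h1'.trans h2'⟩

theorem before_total (G : LoopGraph n) (p : Fin n → ℝ) {u w : Fin n} (h : u ≠ w) :
    G.Before p u w ∨ G.Before p w u := by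
  unfold Before
  rcases lt_trichotomy (p u / G.deg u) (p w / G.deg w) with h1 | h1 | h1
  · exact Or.inr (Or.inl h1)
  · rcases lt_or_gt_of_ne h with h2 | h2
    · exact Or.inl (Or.inr ⟨h1, h2⟩)
    · exact Or.inr (Or.inr ⟨h1.symm, h2⟩)
  · exact Or.inl (Or.inl h1)

theorem Before.asymm {G : LoopGraph n} {p : Fin n → ℝ} {u w : Fin n} (h : G.Before p u w) :
    ¬ G.Before p w u := fun h' => G.before_irrefl p u (h.trans h')

theorem Before.ratio_le {G : LoopGraph n} {p : Fin n → ℝ} {u w : Fin n} (h : G.Before p u w) :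
    p w / G.deg w ≤ p u / G.deg u := by
  rcases h with h | ⟨h, -⟩
  · exact h.le
  · exact h.ge

open Classical in
/-- The position of a vertex in the sweep order. -/
noncomputable def rank (G : LoopGraph n) (p : Fin n → ℝ) (u : Fin n) : ℕ :=
  (Finset.univ.filter fun w => G.Before p w u).card

theorem mem_sweep {G : LoopGraph n} {p : Fin n → ℝ} {j : ℕ} {u : Fin n} :
    u ∈ G.sweep p j ↔ G.rank p u < j := by
  simp [sweep, rank]

theorem Before.rank_lt {G : LoopGraph n} {p : Fin n → ℝ} {u w : Fin n} (h : G.Before p u w) :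
    G.rank p u < G.rank p w := by
  classical
  refine Finset.card_lt_card (Finset.ssubset_iff_of_subset ?_ |>.2 ⟨u, ?_, ?_⟩)
  · intro x hx
    simp only [Finset.mem_filter, Finset.mem_univ, true_and] at hx ⊢
    exact hx.trans h
  · simpa using h
  · simpa using G.before_irrefl p u

theorem before_iff_rank_lt {G : LoopGraph n} {p : Fin n → ℝ} {u w : Fin n} :
    G.Before p u w ↔ G.rank p u < G.rank p w := by
  refine ⟨Before.rank_lt, fun h => ?_⟩
  have hne : u ≠ w := by rintro rfl; exact lt_irrefl _ h
  exact (G.before_total p hne).resolve_right fun h' => lt_asymm h h'.rank_lt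

theorem rank_injective (G : LoopGraph n) (p : Fin n → ℝ) : Function.Injective (G.rank p) := by
  intro u w h
  by_contra hne
  rcases G.before_total p hne with h' | h'
  · exact h'.rank_lt.ne h
  · exact h'.rank_lt.ne h.symm

theorem rank_lt (G : LoopGraph n) (p : Fin n → ℝ) (u : Fin n) : G.rank p u < n := by
  classical
  have : (Finset.univ.filter fun w => G.Before p w u) ⊂ Finset.univ :=
    (Finset.ssubset_iff_of_subset (Finset.subset_univ _)).2
      ⟨u, Finset.mem_univ _, by simpa using G.before_irrefl p u⟩
  simpa [rank] using Finset.card_lt_card this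

theorem exists_rank_eq (G : LoopGraph n) (p : Fin n → ℝ) {j : ℕ} (hj : j < n) :
    ∃ u, G.rank p u = j := by
  let f : Fin n → Fin n := fun u => ⟨G.rank p u, G.rank_lt p u⟩
  have hf : Function.Injective f := fun u w h => G.rank_injective p (Fin.mk.inj_iff.1 h)
  obtain ⟨u, hu⟩ := (Finite.injective_iff_surjective.1 hf) ⟨j, hj⟩
  exact ⟨u, Fin.mk.inj_iff.1 hu⟩

theorem sweep_zero (G : LoopGraph n) (p : Fin n → ℝ) : G.sweep p 0 = ∅ := by
  ext u; simp [mem_sweep]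

theorem sweep_of_le (G : LoopGraph n) (p : Fin n → ℝ) {j : ℕ} (h : n ≤ j) :
    G.sweep p j = Finset.univ := by
  ext u; simpa [mem_sweep] using (G.rank_lt p u).trans_le h

theorem sweep_mono (G : LoopGraph n) (p : Fin n → ℝ) {i j : ℕ} (h : i ≤ j) :
    G.sweep p i ⊆ G.sweep p j := fun _ hu => mem_sweep.2 ((mem_sweep.1 hu).trans_le h)

theorem sweep_succ {G : LoopGraph n} {p : Fin n → ℝ} {j : ℕ} {u : Fin n} (hu : G.rank p u = j) :
    G.sweep p (j + 1) = insert u (G.sweep p j) := by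
  ext w
  rw [Finset.mem_insert, mem_sweep, mem_sweep, Nat.lt_succ_iff_lt_or_eq, or_comm]
  refine or_congr ⟨fun h => G.rank_injective p (h.trans hu.symm), fun h => h ▸ hu⟩ Iff.rfl

theorem notMem_sweep_rank {G : LoopGraph n} {p : Fin n → ℝ} {j : ℕ} {u : Fin n}
    (hu : G.rank p u = j) : u ∉ G.sweep p j := fun h => (mem_sweep.1 h).ne hu

theorem card_sweep (G : LoopGraph n) (p : Fin n → ℝ) {j : ℕ} (h : j ≤ n) :
    (G.sweep p j).card = j := by
  induction j with
  | zero => simp [sweep_zero]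
  | succ j ih =>
    obtain ⟨u, hu⟩ := G.exists_rank_eq p h
    rw [sweep_succ hu, Finset.card_insert_of_notMem (notMem_sweep_rank hu), ih (by omega)]

theorem vol_sweep_succ {G : LoopGraph n} {p : Fin n → ℝ} {j : ℕ} {u : Fin n}
    (hu : G.rank p u = j) : G.vol (G.sweep p (j + 1)) = G.vol (G.sweep p j) + G.deg u := by
  rw [sweep_succ hu, vol, Finset.sum_insert (notMem_sweep_rank hu), add_comm]; rfl

theorem vol_sweep_mono (G : LoopGraph n) (p : Fin n → ℝ) {i j : ℕ} (h : i ≤ j) :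
    G.vol (G.sweep p i) ≤ G.vol (G.sweep p j) := G.vol_mono (G.sweep_mono p h)

/-- A set all of whose elements come before all other vertices is a sweep set. -/
theorem eq_sweep_card {G : LoopGraph n} {p : Fin n → ℝ} {S : Finset (Fin n)}
    (h : ∀ u ∈ S, ∀ w, w ∉ S → G.Before p u w) : S = G.sweep p S.card := by
  classical
  have hsub : S ⊆ G.sweep p S.card := by
    intro u hu
    refine mem_sweep.2 (Finset.card_lt_card ((Finset.ssubset_iff_of_subset ?_).2 ⟨u, hu, ?_⟩))
    · intro w hw
      by_contra hwS
      exact (h u hu w hwS).asymm (by simpa using hw)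
    · simpa using G.before_irrefl p u
  have hc : S.card ≤ n := by simpa using Finset.card_le_univ S
  exact Finset.eq_of_subset_of_card_le hsub (G.card_sweep p hc).le

/-! ### The curve is piecewise linear -/

/-- The density `p / d` does not increase along the sweep order of `q`. -/
def Compatible (G : LoopGraph n) (q p : Fin n → ℝ) : Prop :=
  ∀ u w, G.Before q u w → p w / G.deg w ≤ p u / G.deg u

theorem compatible_self (G : LoopGraph n) (p : Fin n → ℝ) : G.Compatible p p :=
  fun _ _ h => h.ratio_le

/-- With `ρ` the density of `u`, the excess `p - ρ d` is nonnegative before `u` and nonpositive from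
`u` on, so no weight does better than the full prefix. The order may come from another vector `q`,
so that the curve of a truncated vector can be read off the sweep sets of the vector before
truncation. -/
theorem lsCurve_le_line (G : LoopGraph n) (hd : ∀ u, 0 < G.deg u) {q p : Fin n → ℝ}
    (h : G.Compatible q p) {j : ℕ} {u : Fin n} (hu : G.rank q u = j) {x : ℝ} (h0 : 0 ≤ x)
    (h1 : x ≤ G.vol Finset.univ) :
    G.lsCurve p x ≤ ∑ y ∈ G.sweep q j, p y + p u / G.deg u * (x - G.vol (G.sweep q j)) := by
  classical
  refine G.lsCurve_le p h0 h1 fun w hw => ?_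
  set ρ := p u / G.deg u with hρ
  have key : ∀ y, w y * p y ≤ (if y ∈ G.sweep q j then p y - ρ * G.deg y else 0)
      + ρ * (w y * G.deg y) := by
    intro y
    have hy : (0 : ℝ) < G.deg y := by exact_mod_cast hd y
    have hpy : p y = p y / G.deg y * G.deg y := (div_mul_cancel₀ _ hy.ne').symm
    split_ifs with hm
    · have hlt : G.Before q y u := before_iff_rank_lt.2 ((mem_sweep.1 hm).trans_eq hu.symm)
      have h2 : 0 ≤ p y - ρ * G.deg y := by
        have := mul_le_mul_of_nonneg_right (h y u hlt) hy.le
        linarith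
      nlinarith [(hw.1 y).2]
    · have h2 : p y - ρ * G.deg y ≤ 0 := by
        by_cases hyu : y = u
        · subst hyu; linarith
        · have hlt : G.Before q u y := by
            refine before_iff_rank_lt.2 (lt_of_le_of_ne ?_ ?_)
            · rw [hu]; exact not_lt.1 fun h => hm (mem_sweep.2 h)
            · exact fun h => hyu (G.rank_injective q h.symm)
          have := mul_le_mul_of_nonneg_right (h u y hlt) hy.le
          linarith
      nlinarith [(hw.1 y).1]
  refine (Finset.sum_le_sum fun y _ => key y).trans (le_of_eq ?_)
  rw [Finset.sum_add_distrib, ← Finset.mul_sum, hw.2, Finset.sum_ite_mem, Finset.univ_inter,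
    Finset.sum_sub_distrib, ← Finset.mul_sum, vol, Nat.cast_sum]
  ring

theorem lsCurve_eq_line (G : LoopGraph n) (hd : ∀ u, 0 < G.deg u) {q p : Fin n → ℝ}
    (h : G.Compatible q p) {j : ℕ} {u : Fin n} (hu : G.rank q u = j) {x : ℝ}
    (h0 : (G.vol (G.sweep q j) : ℝ) ≤ x) (h1 : x ≤ G.vol (G.sweep q (j + 1))) :
    G.lsCurve p x = ∑ y ∈ G.sweep q j, p y + p u / G.deg u * (x - G.vol (G.sweep q j)) := by
  classical
  have hV : (G.vol (G.sweep q (j + 1)) : ℝ) ≤ G.vol Finset.univ := by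
    exact_mod_cast G.vol_mono (Finset.subset_univ _)
  refine le_antisymm (G.lsCurve_le_line hd h hu ((Nat.cast_nonneg _).trans h0) (h1.trans hV)) ?_
  have hdu : (0 : ℝ) < G.deg u := by exact_mod_cast hd u
  rw [vol_sweep_succ hu, Nat.cast_add] at h1
  set l : ℝ := (G.vol (G.sweep q j) : ℝ) with hl
  have hn := notMem_sweep_rank hu
  have key : ∀ f : Fin n → ℝ, ∑ y, ((if y ∈ G.sweep q j then 1 else 0) +
      if y = u then (x - l) / G.deg u else 0) * f y =
      ∑ y ∈ G.sweep q j, f y + (x - l) / G.deg u * f u := by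
    intro f
    simp only [add_mul, ite_mul, one_mul, zero_mul, Finset.sum_add_distrib, Finset.sum_ite_mem,
      Finset.univ_inter, Finset.sum_ite_eq', Finset.mem_univ, if_true]
  have hf : G.Fractional x (fun y => (if y ∈ G.sweep q j then 1 else 0) +
      if y = u then (x - l) / G.deg u else 0) := by
    have e0 : 0 ≤ (x - l) / G.deg u := div_nonneg (by linarith) hdu.le
    have e1 : (x - l) / G.deg u ≤ 1 := div_le_one_of_le₀ (by linarith) hdu.le
    refine ⟨fun y => ?_, ?_⟩
    · dsimp only
      by_cases hy : y = u
      · subst hy; simp [hn, e0, e1]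
      · simp only [hy, if_false, add_zero]
        split_ifs <;> simp
    · rw [key, div_mul_cancel₀ _ hdu.ne', ← Nat.cast_sum]
      change l + (x - l) = x
      ring
  refine le_of_eq_of_le ?_ (G.le_lsCurve p hf)
  rw [key]
  ring

theorem exists_sweep_between (G : LoopGraph n) (q : Fin n → ℝ) {x : ℝ} (h0 : 0 < x)
    (h1 : x ≤ G.vol Finset.univ) : ∃ j < n, (G.vol (G.sweep q j) : ℝ) < x ∧
      x ≤ G.vol (G.sweep q (j + 1)) := by
  classical
  have hex : ∃ j, x ≤ G.vol (G.sweep q j) := ⟨n, by rwa [G.sweep_of_le q le_rfl]⟩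
  have hs := Nat.find_spec hex
  have hle : Nat.find hex ≤ n := Nat.find_min' hex (by rwa [G.sweep_of_le q le_rfl])
  obtain ⟨j, hj⟩ : ∃ j, Nat.find hex = j + 1 := Nat.exists_eq_succ_of_ne_zero fun h => by
    rw [h, sweep_zero] at hs
    simp [vol] at hs
    linarith
  rw [hj] at hs hle
  exact ⟨j, by omega, not_le.1 (Nat.find_min hex (by omega)), hs⟩

theorem lsCurve_zero (G : LoopGraph n) (hd : ∀ u, 0 < G.deg u) (p : Fin n → ℝ) :
    G.lsCurve p 0 = 0 := by
  refine le_antisymm (G.lsCurve_le p le_rfl (Nat.cast_nonneg _) fun w hw => ?_) ?_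
  · have h1 := (Finset.sum_eq_zero_iff_of_nonneg (fun u _ =>
      mul_nonneg (hw.1 u).1 (Nat.cast_nonneg (G.deg u)))).1 hw.2
    refine (Finset.sum_eq_zero fun u hu => ?_).le
    have : (G.deg u : ℝ) ≠ 0 := by exact_mod_cast (hd u).ne'
    rw [(mul_eq_zero.1 (h1 u hu)).resolve_right this, zero_mul]
  · have : G.Fractional 0 (fun _ => 0) := ⟨fun u => by simp, by simp⟩
    simpa using G.le_lsCurve p this

theorem lsCurve_vol_sweep (G : LoopGraph n) (hd : ∀ u, 0 < G.deg u) {q p : Fin n → ℝ}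
    (h : G.Compatible q p) (j : ℕ) : G.lsCurve p (G.vol (G.sweep q j)) = ∑ y ∈ G.sweep q j, p y := by
  cases j with
  | zero => simp [sweep_zero, vol, G.lsCurve_zero hd]
  | succ j =>
    rcases lt_or_ge j n with hj | hj
    · obtain ⟨u, hu⟩ := G.exists_rank_eq q hj
      have hdu : (G.deg u : ℝ) ≠ 0 := by exact_mod_cast (hd u).ne'
      rw [G.lsCurve_eq_line hd h hu (by exact_mod_cast G.vol_sweep_mono q (Nat.le_succ j)) le_rfl,
        vol_sweep_succ hu, sweep_succ hu, Finset.sum_insert (notMem_sweep_rank hu)]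
      push_cast
      rw [add_sub_cancel_left, div_mul_cancel₀ _ hdu, add_comm]
    · rw [G.sweep_of_le q (by omega)]
      refine le_antisymm (G.lsCurve_le p (Nat.cast_nonneg _) le_rfl fun w hw => ?_) ?_
      · have hall : ∀ u, w u = 1 := by
          have h0 : ∑ u, (1 - w u) * (G.deg u : ℝ) = 0 := by
            simp only [sub_mul, one_mul]
            rw [Finset.sum_sub_distrib, hw.2, vol, Nat.cast_sum, sub_self]
          have h1 := (Finset.sum_eq_zero_iff_of_nonneg (fun u _ =>
            mul_nonneg (sub_nonneg.2 (hw.1 u).2) (Nat.cast_nonneg (G.deg u)))).1 h0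
          intro u
          have : (G.deg u : ℝ) ≠ 0 := by exact_mod_cast (hd u).ne'
          linarith [(mul_eq_zero.1 (h1 u (Finset.mem_univ u))).resolve_right this]
        simp [hall]
      · have : G.Fractional (G.vol Finset.univ) (fun _ => 1) :=
          ⟨fun u => by simp, by simp [vol]⟩
        simpa using G.le_lsCurve p this

/-- A concave function that dominates the curve at the volumes of the sweep sets dominates it. -/
theorem lsCurve_le_of_sweep (G : LoopGraph n) (hd : ∀ u, 0 < G.deg u) {q p : Fin n → ℝ}
    (h : G.Compatible q p) {F : ℝ → ℝ} (hF : ConcaveOn ℝ (Set.Icc 0 (G.vol Finset.univ : ℝ)) F)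
    (hj : ∀ j, ∑ y ∈ G.sweep q j, p y ≤ F (G.vol (G.sweep q j))) {x : ℝ} (h0 : 0 ≤ x)
    (h1 : x ≤ G.vol Finset.univ) : G.lsCurve p x ≤ F x := by
  rcases eq_or_lt_of_le h0 with rfl | h0'
  · have := hj 0
    simpa [sweep_zero, vol, G.lsCurve_zero hd] using this
  obtain ⟨j, hjn, hj0, hj1⟩ := G.exists_sweep_between q h0' h1
  obtain ⟨u, hu⟩ := G.exists_rank_eq q hjn
  have hdu : (0 : ℝ) < G.deg u := by exact_mod_cast hd u
  have hsum : ∑ y ∈ G.sweep q (j + 1), p y = ∑ y ∈ G.sweep q j, p y + p u := by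
    rw [sweep_succ hu, Finset.sum_insert (notMem_sweep_rank hu), add_comm]
  have e1 := hj j
  have e2 := hj (j + 1)
  have hm : ∀ i, (G.vol (G.sweep q i) : ℝ) ∈ Set.Icc 0 (G.vol Finset.univ : ℝ) := fun i =>
    ⟨Nat.cast_nonneg _, by exact_mod_cast G.vol_mono (Finset.subset_univ _)⟩
  have hc := hF.2 (hm j) (hm (j + 1))
  rw [G.lsCurve_eq_line hd h hu hj0.le hj1]
  rw [hsum] at e2
  have hv : (G.vol (G.sweep q (j + 1)) : ℝ) = G.vol (G.sweep q j) + G.deg u := by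
    exact_mod_cast vol_sweep_succ hu
  rw [hv] at e2 hc hj1
  set l : ℝ := (G.vol (G.sweep q j) : ℝ)
  set θ : ℝ := (x - l) / G.deg u with hθ
  have hθ0 : 0 ≤ θ := div_nonneg (by linarith) hdu.le
  have hθ1 : θ ≤ 1 := div_le_one_of_le₀ (by linarith) hdu.le
  have hx : x = l + θ * G.deg u := by rw [hθ, div_mul_cancel₀ _ hdu.ne']; ring
  have hc' := hc (sub_nonneg.2 hθ1) hθ0 (by ring)
  simp only [smul_eq_mul] at hc'
  have hx' : (1 - θ) * l + θ * (l + G.deg u) = x := by rw [hx]; ring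
  rw [hx'] at hc'
  refine le_trans ?_ hc'
  have : p u / G.deg u * (x - l) = θ * p u := by rw [hθ]; ring
  rw [this]
  nlinarith [mul_le_mul_of_nonneg_left e1 (sub_nonneg.2 hθ1), mul_le_mul_of_nonneg_left e2 hθ0]

/-- Just to the left of `x` the curve follows the segment of `u`, also when `x` is its right end.
This is why the lower bound is strict and the upper one is not. -/
theorem lsSlope_eq (G : LoopGraph n) (hd : ∀ u, 0 < G.deg u) (p : Fin n → ℝ) {j : ℕ} {u : Fin n}
    (hu : G.rank p u = j) {x : ℝ} (h0 : (G.vol (G.sweep p j) : ℝ) < x)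
    (h1 : x ≤ G.vol (G.sweep p (j + 1))) : G.lsSlope p x = p u / G.deg u := by
  have key : HasDerivWithinAt (fun y => ∑ z ∈ G.sweep p j, p z +
      p u / G.deg u * (y - G.vol (G.sweep p j))) (p u / G.deg u) (Set.Iic x) x := by
    have := (((hasDerivAt_id x).sub_const (G.vol (G.sweep p j) : ℝ)).const_mul
      (p u / G.deg u)).const_add (∑ z ∈ G.sweep p j, p z)
    simpa using this.hasDerivWithinAt
  refine (key.congr_of_eventuallyEq ?_ ?_).derivWithin (uniqueDiffWithinAt_Iic x)
  · filter_upwards [self_mem_nhdsWithin, mem_nhdsWithin_of_mem_nhds (Ioi_mem_nhds h0)] with y hy hy'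
    exact G.lsCurve_eq_line hd (G.compatible_self p) hu (le_of_lt hy') (le_trans hy h1)
  · exact G.lsCurve_eq_line hd (G.compatible_self p) hu h0.le h1

/-- The left slope of the curve gives a supporting line. -/
theorem lsCurve_le_lsSlope (G : LoopGraph n) (hd : ∀ u, 0 < G.deg u) (p : Fin n → ℝ) {x y : ℝ}
    (hx : 0 < x) (hx1 : x ≤ G.vol Finset.univ) (hy : 0 ≤ y) (hy1 : y ≤ G.vol Finset.univ) :
    G.lsCurve p y ≤ G.lsCurve p x + G.lsSlope p x * (y - x) := by
  obtain ⟨j, hjn, hj0, hj1⟩ := G.exists_sweep_between p hx hx1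
  obtain ⟨u, hu⟩ := G.exists_rank_eq p hjn
  rw [G.lsSlope_eq hd p hu hj0 hj1,
    G.lsCurve_eq_line hd (G.compatible_self p) hu hj0.le hj1]
  have := G.lsCurve_le_line hd (G.compatible_self p) hu hy hy1
  linarith

end LoopGraph

/-! ### The comparison functions -/

/-- The concave functions that dominate the curve of the truncated walk. -/
noncomputable def envelope (V A c x : ℝ) : ℝ :=
  A + 6 / 5 * (x / V) + c * min (√x) (√(V - x))

theorem envelope_concave (V A : ℝ) {c : ℝ} (hc : 0 ≤ c) :
    ConcaveOn ℝ (Set.Icc 0 V) (envelope V A c) := by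
  have h1 : ConcaveOn ℝ (Set.Icc 0 V) fun x : ℝ => √x :=
    Real.strictConcaveOn_sqrt.concaveOn.subset (fun x hx => hx.1) (convex_Icc _ _)
  have h2 : ConcaveOn ℝ (Set.Icc 0 V) fun x : ℝ => √(V - x) := by
    refine ⟨convex_Icc _ _, fun x hx y hy a b ha hb hab => ?_⟩
    have := Real.strictConcaveOn_sqrt.concaveOn.2 (x := V - x) (y := V - y)
      (sub_nonneg.2 hx.2) (sub_nonneg.2 hy.2) ha hb hab
    simp only [smul_eq_mul] at this ⊢
    convert this using 2
    linear_combination -V * hab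
  have h3 : ConcaveOn ℝ (Set.Icc 0 V) fun x : ℝ => A + 6 / 5 * (x / V) := by
    refine ⟨convex_Icc _ _, fun x hx y hy a b ha hb hab => le_of_eq ?_⟩
    simp only [smul_eq_mul]
    linear_combination A * hab
  exact h3.add ((h1.inf h2).smul hc)

theorem le_envelope {V A c x : ℝ} (hV : 0 < V) (hc : 0 ≤ c) (hx : 0 ≤ x) : A ≤ envelope V A c x := by
  unfold envelope
  have : 0 ≤ c * min (√x) (√(V - x)) := by positivity
  have : 0 ≤ 6 / 5 * (x / V) := by positivity
  linarith

/-- The coefficient `6/5` is the inverse of the `5/6` in the volume condition: beyond that volume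
the linear term alone exceeds the total mass, and nothing need be known about conductance. -/
theorem one_le_envelope {V A c x : ℝ} (hV : 0 < V) (hA : 0 ≤ A) (hc : 0 ≤ c)
    (hx : 5 / 6 * V ≤ x) : 1 ≤ envelope V A c x := by
  unfold envelope
  have : 0 ≤ c * min (√x) (√(V - x)) := by positivity
  have : 5 / 6 ≤ x / V := by rwa [le_div_iff₀ hV]
  linarith

/-- Squaring the left side gives `2 + 2 √(1 - φ²) ≤ 4 - φ²`, and this is at most `4 (1 - φ² / 8)²`.
-/
theorem sqrt_one_sub_add_sqrt_one_add {φ : ℝ} (h0 : 0 < φ) (h1 : φ < 1) :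
    √(1 - φ) + √(1 + φ) ≤ 2 * (1 - φ ^ 2 / 8) := by
  have e1 : √(1 - φ) ^ 2 = 1 - φ := Real.sq_sqrt (by linarith)
  have e2 : √(1 + φ) ^ 2 = 1 + φ := Real.sq_sqrt (by linarith)
  have e3 : √(1 - φ) * √(1 + φ) ≤ 1 - φ ^ 2 / 2 := by
    rw [← Real.sqrt_mul (by linarith)]
    refine Real.sqrt_le_iff.2 ⟨by nlinarith, by nlinarith [sq_nonneg (φ ^ 2)]⟩
  refine abs_le_of_sq_le_sq' (a := √(1 - φ) + √(1 + φ)) ?_ (by nlinarith) |>.2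
  nlinarith [sq_nonneg (φ ^ 2)]

/-- Both minima are bounded by the branch that is the smaller one at `x`. On this branch the step is
a relative change by `± φ`. -/
theorem min_sqrt_step {V φ x : ℝ} (h0 : 0 < φ) (h1 : φ < 1) :
    min (√(x - φ * min x (V - x))) (√(V - (x - φ * min x (V - x)))) +
      min (√(x + φ * min x (V - x))) (√(V - (x + φ * min x (V - x)))) ≤
      2 * (1 - φ ^ 2 / 8) * min (√x) (√(V - x)) := by
  have key := sqrt_one_sub_add_sqrt_one_add h0 h1
  rcases le_total x (V - x) with h | h
  · rw [min_eq_left h, min_eq_left (Real.sqrt_le_sqrt h)]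
    have e1 : x - φ * x = (1 - φ) * x := by ring
    have e2 : x + φ * x = (1 + φ) * x := by ring
    refine (add_le_add (min_le_left _ _) (min_le_left _ _)).trans ?_
    rw [e1, e2, Real.sqrt_mul (by linarith), Real.sqrt_mul (by linarith), ← add_mul]
    exact mul_le_mul_of_nonneg_right key (Real.sqrt_nonneg _)
  · rw [min_eq_right h, min_eq_right (Real.sqrt_le_sqrt h)]
    have e1 : V - (x - φ * (V - x)) = (1 + φ) * (V - x) := by ring
    have e2 : V - (x + φ * (V - x)) = (1 - φ) * (V - x) := by ring
    refine (add_le_add (min_le_right _ _) (min_le_right _ _)).trans ?_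
    rw [e1, e2, Real.sqrt_mul (by linarith), Real.sqrt_mul (by linarith), ← add_mul,
      add_comm (√(1 + φ))]
    exact mul_le_mul_of_nonneg_right key (Real.sqrt_nonneg _)

theorem envelope_step {V A c φ x : ℝ} (hc : 0 ≤ c) (h0 : 0 < φ) (h1 : φ < 1) :
    (envelope V A c (x - φ * min x (V - x)) + envelope V A c (x + φ * min x (V - x))) / 2 ≤
      envelope V A (c * (1 - φ ^ 2 / 8)) x := by
  have := mul_le_mul_of_nonneg_left (min_sqrt_step (V := V) (x := x) h0 h1) hc
  unfold envelope
  have e : (x - φ * min x (V - x)) / V + (x + φ * min x (V - x)) / V = 2 * (x / V) := by ring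
  linarith

/-- The symmetric second difference of a concave function. -/
theorem ConcaveOn.add_symm_le {V x c e : ℝ} {F : ℝ → ℝ} (hF : ConcaveOn ℝ (Set.Icc 0 V) F)
    (he : 0 ≤ e) (hec : e ≤ c) (h0 : 0 ≤ x - c) (h1 : x + c ≤ V) :
    F (x - c) + F (x + c) ≤ F (x - e) + F (x + e) := by
  rcases eq_or_lt_of_le (he.trans hec) with h | h
  · have : e = c := by linarith
    rw [this]
  -- With weights `α` and `β` the points `x - e` and `x + e` are convex combinations of `x - c` and
  -- `x + c`.
  set α := (1 + e / c) / 2 with hα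
  set β := (1 - e / c) / 2 with hβ
  have hec0 : 0 ≤ e / c := by positivity
  have hec' : e / c ≤ 1 := div_le_one_of_le₀ hec h.le
  have hα0 : 0 ≤ α := by rw [hα]; linarith
  have hβ0 : 0 ≤ β := by rw [hβ]; linarith
  have hs : α + β = 1 := by rw [hα, hβ]; ring
  have m1 : x - c ∈ Set.Icc 0 V := ⟨h0, by linarith⟩
  have m2 : x + c ∈ Set.Icc 0 V := ⟨by linarith, h1⟩
  have k1 := hF.2 m1 m2 hα0 hβ0 hs
  have k2 := hF.2 m1 m2 hβ0 hα0 (by linarith)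
  have r1 : α • (x - c) + β • (x + c) = x - e := by
    simp only [smul_eq_mul, hα, hβ]; field_simp; ring
  have r2 : β • (x - c) + α • (x + c) = x + e := by
    simp only [smul_eq_mul, hα, hβ]; field_simp; ring
  rw [r1] at k1
  rw [r2] at k2
  simp only [smul_eq_mul] at k1 k2
  have : F (x - c) + F (x + c) = (α + β) * (F (x - c) + F (x + c)) := by rw [hs, one_mul]
  linarith

namespace LoopGraph

variable {n : ℕ}

/-! ### The truncated walk -/

theorem trunc_le (G : LoopGraph n) (ε : ℝ) {p : Fin n → ℝ} (hp : ∀ u, 0 ≤ p u) (u : Fin n) :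
    G.trunc ε p u ≤ p u := by
  unfold trunc
  split_ifs
  · exact le_rfl
  · exact hp u

theorem trunc_nonneg (G : LoopGraph n) (ε : ℝ) {p : Fin n → ℝ} (hp : ∀ u, 0 ≤ p u) (u : Fin n) :
    0 ≤ G.trunc ε p u := by
  unfold trunc
  split_ifs
  · exact hp u
  · exact le_rfl

theorem le_trunc_add (G : LoopGraph n) {ε : ℝ} (hε : 0 ≤ ε) (p : Fin n → ℝ) (u : Fin n) :
    p u ≤ G.trunc ε p u + ε * G.deg u := by
  unfold trunc
  split_ifs with h
  · have : 0 ≤ ε * G.deg u := by positivity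
    linarith
  · linarith

theorem trunc_ne_zero (G : LoopGraph n) (hd : ∀ u, 0 < G.deg u) {ε : ℝ} (hε : 0 < ε)
    (p : Fin n → ℝ) (u : Fin n) : G.trunc ε p u ≠ 0 ↔ (G.deg u : ℝ) * ε ≤ p u := by
  unfold trunc
  have : (0 : ℝ) < G.deg u := by exact_mod_cast hd u
  have h2 : 0 < (G.deg u : ℝ) * ε := by positivity
  split_ifs with h
  · simp only [h, iff_true]; linarith
  · simp [h]

/-- Truncation is a threshold on the density, so it creates ties but no inversions. The sweep sets
of `q`, with which the algorithm works, therefore still give breakpoints for the curve of the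
truncated vector. -/
theorem compatible_trunc (G : LoopGraph n) (hd : ∀ u, 0 < G.deg u) {ε : ℝ} (hε : 0 < ε)
    (p : Fin n → ℝ) : G.Compatible p (G.trunc ε p) := by
  intro u w h
  have hu : (0 : ℝ) < G.deg u := by exact_mod_cast hd u
  have hw : (0 : ℝ) < G.deg w := by exact_mod_cast hd w
  have hr := h.ratio_le
  by_cases h1 : (G.deg w : ℝ) * ε ≤ p w
  · have h2 : ε ≤ p u / G.deg u := le_trans (by rwa [le_div_iff₀ hw, mul_comm]) hr
    rw [le_div_iff₀ hu, mul_comm] at h2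
    simpa [trunc, h1, h2] using hr
  · have : G.trunc ε p w = 0 := if_neg h1
    rw [this, zero_div]
    unfold trunc
    split_ifs with h2
    · exact div_nonneg (le_trans (by positivity) h2) hu.le
    · simp

open Classical in
theorem filter_trunc_ne_zero_eq_sweep (G : LoopGraph n) (hd : ∀ u, 0 < G.deg u) {ε : ℝ}
    (hε : 0 < ε) (p : Fin n → ℝ) : (Finset.univ.filter fun u => G.trunc ε p u ≠ 0) =
      G.sweep p (Finset.univ.filter fun u => G.trunc ε p u ≠ 0).card := by
  refine eq_sweep_card fun u hu w hw => Or.inl ?_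
  simp only [Finset.mem_filter, Finset.mem_univ, true_and, G.trunc_ne_zero hd hε] at hu hw
  have hu' : (0 : ℝ) < G.deg u := by exact_mod_cast hd u
  have hw' : (0 : ℝ) < G.deg w := by exact_mod_cast hd w
  calc p w / G.deg w < ε := by rw [div_lt_iff₀ hw']; linarith
    _ ≤ p u / G.deg u := by rw [le_div_iff₀ hu']; linarith

open Classical in
/-- One step of the truncated walk, when all sweep sets in a range of volumes expand. -/
theorem lsCurve_trunc_walk_le (G : LoopGraph n) (hd : ∀ u, 0 < G.deg u) {ε φ A c X : ℝ}
    (hε : 0 < ε) (h0 : 0 < φ) (h1 : φ < 1) (hA : 0 ≤ A) (hc : 0 ≤ c) {r : Fin n → ℝ}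
    (hr : ∀ u, 0 ≤ r u) (hsum : ∑ u, r u ≤ 1) (hV : 0 < G.vol Finset.univ)
    (hF : ∀ x : ℝ, 0 ≤ x → x ≤ G.vol Finset.univ →
      G.lsCurve r x ≤ envelope (G.vol Finset.univ) A c x)
    (hsmall : ∀ j, (G.vol (G.sweep (G.walkMatrix.mulVec r) j) : ℝ) < X →
      ∑ u ∈ G.sweep (G.walkMatrix.mulVec r) j, G.trunc ε (G.walkMatrix.mulVec r) u ≤ A)
    (hΦ : ∀ j, 1 ≤ j → j ≤ (Finset.univ.filter fun u =>
        G.trunc ε (G.walkMatrix.mulVec r) u ≠ 0).card →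
      X ≤ G.vol (G.sweep (G.walkMatrix.mulVec r) j) →
      (G.vol (G.sweep (G.walkMatrix.mulVec r) j) : ℝ) ≤ 5 / 6 * G.vol Finset.univ →
      φ < G.conductance (G.sweep (G.walkMatrix.mulVec r) j))
    {x : ℝ} (hx0 : 0 ≤ x) (hx1 : x ≤ G.vol Finset.univ) :
    G.lsCurve (G.trunc ε (G.walkMatrix.mulVec r)) x ≤
      envelope (G.vol Finset.univ) A (c * (1 - φ ^ 2 / 8)) x := by
  set q := G.walkMatrix.mulVec r with hq
  set V : ℝ := (G.vol Finset.univ : ℝ) with hVdef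
  have hV' : 0 < V := Nat.cast_pos.2 hV
  set s := (Finset.univ.filter fun u => G.trunc ε q u ≠ 0).card with hs
  have hc' : 0 ≤ c * (1 - φ ^ 2 / 8) := mul_nonneg hc (by nlinarith)
  have hq0 : ∀ u, 0 ≤ q u := G.walk_nonneg hr
  have hone : ∀ S : Finset (Fin n), ∑ u ∈ S, G.trunc ε q u ≤ 1 := fun S =>
    calc ∑ u ∈ S, G.trunc ε q u ≤ ∑ u, G.trunc ε q u :=
          Finset.sum_le_sum_of_subset_of_nonneg (Finset.subset_univ _)
            fun u _ _ => G.trunc_nonneg ε hq0 u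
      _ ≤ ∑ u, q u := Finset.sum_le_sum fun u _ => G.trunc_le ε hq0 u
      _ = ∑ u, r u := G.sum_walk hd r
      _ ≤ 1 := hsum
  have hsurv := G.filter_trunc_ne_zero_eq_sweep hd hε q
  rw [← hs] at hsurv
  have hm : ∀ j, (G.vol (G.sweep q j) : ℝ) ≤ V := fun j =>
    Nat.cast_le.2 (G.vol_mono (Finset.subset_univ _))
  have hconc := envelope_concave V A hc'
  have hle : ∀ j ≤ s, ∑ u ∈ G.sweep q j, G.trunc ε q u ≤
      envelope V A (c * (1 - φ ^ 2 / 8)) (G.vol (G.sweep q j)) := by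
    intro j hjs
    have hl0 : (0 : ℝ) ≤ G.vol (G.sweep q j) := Nat.cast_nonneg _
    rcases Nat.eq_zero_or_pos j with rfl | hj
    · rw [sweep_zero, Finset.sum_empty]
      exact hA.trans (le_envelope hV' hc' (Nat.cast_nonneg _))
    rcases lt_or_ge (G.vol (G.sweep q j) : ℝ) X with h | h
    · exact (hsmall j h).trans (le_envelope hV' hc' hl0)
    rcases lt_or_ge (5 / 6 * V) (G.vol (G.sweep q j)) with h' | h'
    · exact (hone _).trans (one_le_envelope hV' hA hc' h'.le)
    have hcond := hΦ j hj hjs h h'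
    have hcpl : (G.vol (G.sweep q j)ᶜ : ℝ) = V - G.vol (G.sweep q j) := by
      rw [eq_sub_iff_add_eq', hVdef]; exact_mod_cast G.vol_add_vol_compl _
    have hcut1 : (G.cut (G.sweep q j) : ℝ) ≤ G.vol (G.sweep q j) := by
      exact_mod_cast G.cut_le_vol _
    have hcut2 : (G.cut (G.sweep q j) : ℝ) ≤ V - G.vol (G.sweep q j) := by
      rw [← hcpl]; exact_mod_cast G.cut_le_vol_compl _
    have hjn : (G.sweep q j).Nonempty := by
      rw [Finset.nonempty_iff_ne_empty]
      intro he
      have := hsurv ▸ G.sweep_mono q hjs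
      have h2 : (G.sweep q s).card = s := by rw [← hsurv]
      have h3 : (G.sweep q j).card = j := by
        refine G.card_sweep q (hjs.trans ?_)
        rw [hs]; simpa using Finset.card_le_univ (Finset.univ.filter fun u => G.trunc ε q u ≠ 0)
      rw [he] at h3; simp at h3; omega
    have hlpos : (0 : ℝ) < G.vol (G.sweep q j) := by exact_mod_cast G.vol_pos hd hjn
    set l : ℝ := (G.vol (G.sweep q j) : ℝ) with hl
    have hmin : 0 < min l (V - l) := lt_min hlpos (by linarith)
    rw [conductance, if_neg hjn.ne_empty, hcpl, ← hl, lt_div_iff₀ hmin] at hcond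
    have hq' : ∑ u ∈ G.sweep q j, G.trunc ε q u ≤ ∑ u ∈ G.sweep q j, q u :=
      Finset.sum_le_sum fun u _ => G.trunc_le ε hq0 u
    have hLS := G.sum_walk_le hd r (G.sweep q j)
    rw [← hq, ← hl] at hLS
    have f1 := hF (l - G.cut (G.sweep q j)) (by linarith)
      (by linarith [(Nat.cast_nonneg (G.cut (G.sweep q j)) : (0 : ℝ) ≤ _)])
    have f2 := hF (l + G.cut (G.sweep q j))
      (by linarith [(Nat.cast_nonneg (G.cut (G.sweep q j)) : (0 : ℝ) ≤ _)]) (by linarith)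
    -- The cut exceeds `φ min(l, V - l)`; concavity allows the symmetric pair to be moved inwards to
    -- exactly that distance, where `envelope_step` applies.
    have f3 := (envelope_concave V A hc).add_symm_le (x := l) (by positivity) hcond.le
      (by linarith) (by linarith)
    have f4 := envelope_step (V := V) (A := A) (x := l) hc h0 h1
    linarith
  refine G.lsCurve_le_of_sweep hd (G.compatible_trunc hd hε q) hconc (fun j => ?_) hx0 hx1
  rcases le_total j s with hjs | hjs
  · exact hle j hjs
  -- Beyond the survivors the truncated vector vanishes, so the sums stop growing. A concave
  -- function between two points is at least its smaller end value, and at both ends, the survivors'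
  -- volume and `5/6 V`, the bound is known. Hence the sweep sets past the survivors need not be
  -- examined.
  have hsum_eq : ∑ u ∈ G.sweep q j, G.trunc ε q u = ∑ u ∈ G.sweep q s, G.trunc ε q u := by
    refine (Finset.sum_subset (G.sweep_mono q hjs) fun u _ hu => ?_).symm
    rw [← hsurv] at hu
    simpa using hu
  rw [hsum_eq]
  rcases le_total (5 / 6 * V) (G.vol (G.sweep q j)) with h | h
  · exact (hone _).trans (one_le_envelope hV' hA hc' h)
  have hls : (G.vol (G.sweep q s) : ℝ) ≤ G.vol (G.sweep q j) := by
    exact_mod_cast G.vol_sweep_mono q hjs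
  have hs1 : (G.vol (G.sweep q s) : ℝ) ∈ Set.Icc 0 V := ⟨Nat.cast_nonneg _, hm s⟩
  have hs2 : 5 / 6 * V ∈ Set.Icc 0 V := ⟨by positivity, by linarith⟩
  have := hconc.min_le_of_mem_Icc hs1 hs2 ⟨hls, h⟩
  exact (le_min (hle s le_rfl) ((hone _).trans (one_le_envelope hV' hA hc' le_rfl))).trans this

end LoopGraph

namespace LoopGraph

variable {n : ℕ}

/-! ### The untruncated walk -/

/-- The distribution of the lazy walk from `v` after `t` steps. -/
noncomputable def pVec (G : LoopGraph n) (v : Fin n) : ℕ → Fin n → ℝ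
  | 0 => Pi.single v 1
  | t + 1 => G.walkMatrix.mulVec (pVec G v t)

theorem single_nonneg (v u : Fin n) : (0 : ℝ) ≤ Pi.single (M := fun _ => ℝ) v 1 u := by
  rcases eq_or_ne u v with rfl | h
  · simp
  · simp [h]

theorem pVec_nonneg (G : LoopGraph n) (v : Fin n) (t : ℕ) (u : Fin n) : 0 ≤ G.pVec v t u := by
  induction t generalizing u with
  | zero => exact single_nonneg v u
  | succ t ih => exact G.walk_nonneg ih u

theorem sum_pVec (G : LoopGraph n) (hd : ∀ u, 0 < G.deg u) (v : Fin n) (t : ℕ) :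
    ∑ u, G.pVec v t u = 1 := by
  induction t with
  | zero => simp [pVec]
  | succ t ih => rw [pVec, G.sum_walk hd, ih]

theorem rVec_qVec_nonneg (G : LoopGraph n) (φ : ℝ) (b : ℕ) (v : Fin n) (t : ℕ) :
    (∀ u, 0 ≤ G.qVec φ b v t u) ∧ ∀ u, 0 ≤ G.rVec φ b v t u := by
  induction t with
  | zero => exact ⟨single_nonneg v, G.trunc_nonneg _ (single_nonneg v)⟩
  | succ t ih =>
    have := G.walk_nonneg ih.2
    exact ⟨this, G.trunc_nonneg _ this⟩

theorem rVec_eq_trunc (G : LoopGraph n) (φ : ℝ) (b : ℕ) (v : Fin n) (t : ℕ) :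
    G.rVec φ b v t = G.trunc (G.eps φ b) (G.qVec φ b v t) := by
  cases t <;> rfl

theorem rVec_le_qVec (G : LoopGraph n) (φ : ℝ) (b : ℕ) (v : Fin n) (t : ℕ) (u : Fin n) :
    G.rVec φ b v t u ≤ G.qVec φ b v t u := by
  rw [rVec_eq_trunc]
  exact G.trunc_le _ (G.rVec_qVec_nonneg φ b v t).1 u

theorem qVec_le_pVec (G : LoopGraph n) (φ : ℝ) (b : ℕ) (v : Fin n) (t : ℕ) (u : Fin n) :
    G.qVec φ b v t u ≤ G.pVec v t u := by
  induction t generalizing u with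
  | zero => exact le_rfl
  | succ t ih => exact G.walk_mono (fun w => (G.rVec_le_qVec φ b v t w).trans (ih w)) u

/-- Each truncation removes at most `ε d`. Since the walk is monotone and fixes `d`, earlier losses
are carried along unchanged; time `0` is truncated too, hence the factor `t + 1`. -/
theorem pVec_le_rVec_add (G : LoopGraph n) (hd : ∀ u, 0 < G.deg u) {φ : ℝ} {b : ℕ}
    (hε : 0 ≤ G.eps φ b) (v : Fin n) (t : ℕ) (u : Fin n) :
    G.pVec v t u ≤ G.rVec φ b v t u + (t + 1) * G.eps φ b * G.deg u := by
  induction t generalizing u with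
  | zero =>
    have := G.le_trunc_add hε (Pi.single v 1) u
    simpa [pVec, rVec] using this
  | succ t ih =>
    have h1 := G.walk_mono (q := G.rVec φ b v t + ((t + 1) * G.eps φ b) • fun u => (G.deg u : ℝ))
      (fun u => by simpa using ih u) u
    rw [Matrix.mulVec_add, Matrix.mulVec_smul, G.walk_deg hd] at h1
    have h2 := G.le_trunc_add hε (G.walkMatrix.mulVec (G.rVec φ b v t)) u
    simp only [Pi.add_apply, Pi.smul_apply, smul_eq_mul] at h1
    simp only [pVec, rVec]
    push_cast
    linarith

theorem lsCurve_pVec_antitone (G : LoopGraph n) (hd : ∀ u, 0 < G.deg u) (v : Fin n) {s t : ℕ}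
    (hst : s ≤ t) {x : ℝ} (h0 : 0 ≤ x) (h1 : x ≤ G.vol Finset.univ) :
    G.lsCurve (G.pVec v t) x ≤ G.lsCurve (G.pVec v s) x := by
  induction t, hst using Nat.le_induction with
  | base => exact le_rfl
  | succ t _ ih => exact (G.lsCurve_walk_le hd _ h0 h1).trans ih

theorem lsCurve_le_one (G : LoopGraph n) {p : Fin n → ℝ} (hp : ∀ u, 0 ≤ p u)
    (hs : ∑ u, p u ≤ 1) {x : ℝ} (h0 : 0 ≤ x) (h1 : x ≤ G.vol Finset.univ) : G.lsCurve p x ≤ 1 :=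
  G.lsCurve_le p h0 h1 fun _ hw => (Finset.sum_le_sum fun u _ =>
    mul_le_of_le_one_left (hp u) (hw.1 u).2).trans hs

theorem lsCurve_le_self (G : LoopGraph n) (hd : ∀ u, 0 < G.deg u) {p : Fin n → ℝ}
    (hp : ∀ u, 0 ≤ p u) (hs : ∑ u, p u ≤ 1) {x : ℝ} (h0 : 0 ≤ x) (h1 : x ≤ G.vol Finset.univ) :
    G.lsCurve p x ≤ x := by
  refine G.lsCurve_le p h0 h1 fun w hw => ?_
  rw [← hw.2]
  refine Finset.sum_le_sum fun u _ => mul_le_mul_of_nonneg_left ?_ (hw.1 u).1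
  have h2 : p u ≤ 1 := (Finset.single_le_sum (fun u _ => hp u) (Finset.mem_univ u)).trans hs
  exact h2.trans (by exact_mod_cast hd u)

/-- All degrees are at least `1`, so the first segment reaches volume `1` and is linear from the
origin. At scale `b = 0` a small slope alone thus bounds the curve. -/
theorem lsCurve_one (G : LoopGraph n) (hd : ∀ u, 0 < G.deg u) (p : Fin n → ℝ)
    (h1 : (1 : ℝ) ≤ G.vol Finset.univ) : G.lsCurve p 1 = G.lsSlope p 1 := by
  have hn : 0 < n := by
    rcases Nat.eq_zero_or_pos n with rfl | h
    · norm_num [vol] at h1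
    · exact h
  obtain ⟨u, hu⟩ := G.exists_rank_eq p hn
  have e0 : G.vol (G.sweep p 0) = 0 := by simp [sweep_zero, vol]
  have e1 : (1 : ℝ) ≤ G.vol (G.sweep p (0 + 1)) := by
    rw [vol_sweep_succ hu, e0, zero_add]
    exact_mod_cast hd u
  rw [G.lsSlope_eq hd p hu (by rw [e0]; norm_num) e1,
    G.lsCurve_eq_line hd (G.compatible_self p) hu (by rw [e0]; norm_num) e1]
  simp [sweep_zero, vol]

/-! ### The parameters -/

theorem half_vol_le_two_pow_ell (G : LoopGraph n) : (G.vol Finset.univ : ℝ) / 2 ≤ 2 ^ G.ell := by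
  rcases Nat.eq_zero_or_pos (G.vol Finset.univ) with h | h
  · rw [h]; simp
  have h' : (0 : ℝ) < (G.vol Finset.univ : ℝ) / 2 := by
    have : (0 : ℝ) < G.vol Finset.univ := by exact_mod_cast h
    linarith
  have := Nat.le_ceil (Real.logb 2 ((G.vol Finset.univ : ℝ) / 2))
  rw [Real.logb_le_iff_le_rpow (by norm_num) h', Real.rpow_natCast] at this
  exact this

theorem two_pow_lt_half_vol (G : LoopGraph n) {k : ℕ} (hV : 0 < G.vol Finset.univ)
    (hk : k < G.ell) : (2 : ℝ) ^ k < (G.vol Finset.univ : ℝ) / 2 := by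
  have h' : (0 : ℝ) < (G.vol Finset.univ : ℝ) / 2 := by
    have : (0 : ℝ) < G.vol Finset.univ := by exact_mod_cast hV
    linarith
  have := Nat.lt_ceil.1 hk
  rwa [Real.lt_logb_iff_rpow_lt (by norm_num) h', Real.rpow_natCast] at this

/-- The argument of the logarithm in the definition of `t₁`. -/
theorem one_lt_log_arg (G : LoopGraph n) (hm : 1 ≤ G.m) :
    1 < 200 * ((G.ell : ℝ) + 2) * √((G.vol Finset.univ : ℝ) / 2) := by
  have h1 : 1 ≤ √((G.vol Finset.univ : ℝ) / 2) := Real.one_le_sqrt.2 hm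
  have h2 : (0 : ℝ) ≤ G.ell := Nat.cast_nonneg _
  nlinarith

theorem tOne_pos (G : LoopGraph n) (hm : 1 ≤ G.m) {φ : ℝ} (hφ : 0 < φ) : 0 < G.tOne φ :=
  Nat.ceil_pos.2 (mul_pos (by positivity) (Real.log_pos (G.one_lt_log_arg hm)))

theorem tLast_pos (G : LoopGraph n) (hm : 1 ≤ G.m) {φ : ℝ} (hφ : 0 < φ) : 0 < G.tLast φ :=
  Nat.mul_pos (Nat.succ_pos _) (G.tOne_pos hm hφ)

theorem eps_pos (G : LoopGraph n) (hm : 1 ≤ G.m) {φ : ℝ} (hφ : 0 < φ) (b : ℕ) : 0 < G.eps φ b := by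
  have : (0 : ℝ) < G.tLast φ := by exact_mod_cast G.tLast_pos hm hφ
  unfold eps
  positivity

theorem tLast_mul_fOne (G : LoopGraph n) (hm : 1 ≤ G.m) {φ : ℝ} (hφ : 0 < φ) :
    G.tLast φ * G.fOne φ = 1 / (280 * ((G.ell : ℝ) + 2)) := by
  have : (0 : ℝ) < G.tLast φ := by exact_mod_cast G.tLast_pos hm hφ
  have : (0 : ℝ) < (G.ell : ℝ) + 2 := by positivity
  unfold fOne
  field_simp

theorem mul_eps_le (G : LoopGraph n) (hm : 1 ≤ G.m) {φ : ℝ} (hφ : 0 < φ) (b : ℕ) {t : ℕ}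
    (ht : t ≤ G.tLast φ) :
    ((t : ℝ) + 1) * G.eps φ b ≤ 1 / (900 * ((G.ell : ℝ) + 2) * 2 ^ b) := by
  have h1 : (1 : ℝ) ≤ G.tLast φ := by exact_mod_cast G.tLast_pos hm hφ
  have h2 : (t : ℝ) ≤ G.tLast φ := by exact_mod_cast ht
  have h3 : (0 : ℝ) < (G.ell : ℝ) + 2 := by positivity
  have h4 : (0 : ℝ) < 2 ^ b := by positivity
  unfold eps
  rw [mul_one_div, div_le_div_iff₀ (by positivity) (by positivity)]
  have : 0 < ((G.ell : ℝ) + 2) * 2 ^ b := by positivity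
  nlinarith

/-- The contraction over `4 t₁` steps. -/
theorem contraction_le (G : LoopGraph n) (hm : 1 ≤ G.m) {φ : ℝ} (hφ : 0 < φ) (hφ1 : φ < 1) :
    ((1 - φ ^ 2 / 8) ^ G.tOne φ) ^ 4 * (200 * ((G.ell : ℝ) + 2) *
      √((G.vol Finset.univ : ℝ) / 2)) ≤ 1 := by
  set X := 200 * ((G.ell : ℝ) + 2) * √((G.vol Finset.univ : ℝ) / 2) with hX
  have hX1 : 1 < X := G.one_lt_log_arg hm
  have hX0 : 0 < X := by linarith
  have h1 : 2 / φ ^ 2 * Real.log X ≤ G.tOne φ := Nat.le_ceil _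
  have h2 : 1 - φ ^ 2 / 8 ≤ Real.exp (-(φ ^ 2 / 8)) := by
    have := Real.add_one_le_exp (-(φ ^ 2 / 8)); linarith
  have h3 : 0 ≤ 1 - φ ^ 2 / 8 := by nlinarith
  -- The exponent is `4 t₁ φ² / 8`, and the factor `2 / φ²` in `t₁` makes it at least `log X`.
  have h4 : ((1 - φ ^ 2 / 8) ^ G.tOne φ) ^ 4 ≤ Real.exp (-Real.log X) := by
    calc ((1 - φ ^ 2 / 8) ^ G.tOne φ) ^ 4
        ≤ (Real.exp (-(φ ^ 2 / 8)) ^ G.tOne φ) ^ 4 := by gcongr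
      _ = Real.exp (-(φ ^ 2 / 2 * G.tOne φ)) := by
        rw [← pow_mul, ← Real.exp_nat_mul]
        congr 1
        push_cast
        ring
      _ ≤ Real.exp (-Real.log X) := by
        refine Real.exp_le_exp.2 (neg_le_neg ?_)
        have := mul_le_mul_of_nonneg_left h1 (by positivity : 0 ≤ φ ^ 2 / 2)
        refine le_trans (le_of_eq ?_) this
        field_simp
  rw [Real.exp_neg, Real.exp_log hX0] at h4
  calc _ ≤ X⁻¹ * X := by gcongr
    _ = 1 := inv_mul_cancel₀ hX0.ne'

/-! ### One phase of the walk -/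

/-- No sweep set made of surviving vertices is accepted in any round. -/
def Fails (G : LoopGraph n) (φ : ℝ) (b : ℕ) (v : Fin n) : Prop :=
  ∀ t, 1 ≤ t → t ≤ G.tLast φ → ∀ j, 1 ≤ j → j ≤ G.survivors φ b v t → ¬ G.StopCond φ b v t j

/-- The curve is at most `A` up to volume `2 ^ b` and at most `1` everywhere. From `2 ^ b` to `V /
2` the square-root term is at least `1`. From `V / 2` to `5/6 V` it is at least `1/2`, because `V -
x ≥ V / 6 ≥ 2 ^ b / 4`, and the linear term adds `3/5`. At `b = 0` with `A = 0` the bound by `x`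
replaces the bound by `A`. -/
theorem initial_le_envelope (G : LoopGraph n) (hd : ∀ u, 0 < G.deg u) {p : Fin n → ℝ}
    (hp : ∀ u, 0 ≤ p u) (hs : ∑ u, p u ≤ 1) {A : ℝ} (hA0 : 0 ≤ A) {b : ℕ}
    (hA : (b = 0 ∧ A = 0) ∨ G.lsCurve p (2 ^ b) ≤ A)
    (hb : (2 : ℝ) ^ b ≤ 2 / 3 * (G.vol Finset.univ : ℝ)) (hV2 : (2 : ℝ) ≤ G.vol Finset.univ)
    {x : ℝ} (hx0 : 0 ≤ x) (hx1 : x ≤ G.vol Finset.univ) :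
    G.lsCurve p x ≤ envelope (G.vol Finset.univ) A (1 / √(2 ^ b)) x := by
  set V : ℝ := (G.vol Finset.univ : ℝ) with hV
  have hVpos : 0 < V := by linarith
  have hB : (0 : ℝ) < 2 ^ b := by positivity
  have hone := G.lsCurve_le_one hp hs hx0 hx1
  rcases le_total (5 / 6 * V) x with h | h
  · exact hone.trans (one_le_envelope hVpos hA0 (by positivity) h)
  have hx6 : 0 ≤ 6 / 5 * (x / V) := by positivity
  rcases le_total x (2 ^ b) with hxb | hxb
  · rcases hA with ⟨rfl, rfl⟩ | hA
    · refine (G.lsCurve_le_self hd hp hs hx0 hx1).trans ?_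
      simp only [pow_zero] at hxb
      unfold envelope
      have : x ≤ min (√x) (√(V - x)) :=
        le_min (Real.le_sqrt_of_sq_le (by nlinarith)) (Real.le_sqrt_of_sq_le (by nlinarith))
      simp only [pow_zero, Real.sqrt_one, div_one, one_mul]
      linarith
    · exact ((G.lsCurve_monotone hp hx0 hxb (by linarith)).trans hA).trans
        (le_envelope hVpos (by positivity) hx0)
  · refine hone.trans ?_
    unfold envelope
    rcases le_total x (V - x) with h2 | h2
    · have : 1 ≤ 1 / √(2 ^ b) * min (√x) (√(V - x)) := by
        rw [one_div_mul_eq_div, le_div_iff₀ (Real.sqrt_pos.2 hB), one_mul]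
        exact le_min (Real.sqrt_le_sqrt hxb) (Real.sqrt_le_sqrt (by linarith))
      linarith
    · have : 1 / 2 ≤ 1 / √(2 ^ b) * min (√x) (√(V - x)) := by
        rw [one_div_mul_eq_div, le_div_iff₀ (Real.sqrt_pos.2 hB), min_eq_right
          (Real.sqrt_le_sqrt h2)]
        refine Real.le_sqrt_of_sq_le ?_
        rw [mul_pow, Real.sq_sqrt hB.le]
        linarith
      have h3 : 1 / 2 ≤ x / V := by rw [le_div_iff₀ hVpos]; linarith
      linarith

/-- Either the slope of the curve at `2 ^ b` becomes small or the walk mixes above scale `2 ^ b`. -/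
theorem lsCurve_phase_le (G : LoopGraph n) (hd : ∀ u, 0 < G.deg u) (hm : 1 ≤ G.m) {φ : ℝ}
    (hφ : 0 < φ) (hφ1 : φ < 1) {b : ℕ} {v : Fin n} (hf : G.Fails φ b v) {s t : ℕ} (hst : s ≤ t)
    (ht : t ≤ G.tLast φ) {A : ℝ} (hA0 : 0 ≤ A)
    (hA : (b = 0 ∧ A = 0) ∨ G.lsCurve (G.pVec v s) (2 ^ b) ≤ A) {Y : ℝ} (hY : 2 ^ b ≤ Y)
    (hYV : Y ≤ 2 / 3 * (G.vol Finset.univ : ℝ)) :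
    G.lsCurve (G.pVec v t) Y ≤ A + Y / (900 * ((G.ell : ℝ) + 2) * 2 ^ b) +
      max (Y / (140 * ((G.ell : ℝ) + 2) * 2 ^ b)) (6 / 5 * (Y / G.vol Finset.univ) +
        1 / √(2 ^ b) * (1 - φ ^ 2 / 8) ^ (t - s) * min (√Y) (√(G.vol Finset.univ - Y))) := by
  classical
  set V : ℝ := (G.vol Finset.univ : ℝ) with hV
  have hV2 : 2 ≤ V := by have := hm; unfold m at this; linarith
  have hB : (0 : ℝ) < 2 ^ b := by positivity
  have hY0 : 0 < Y := hB.trans_le hY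
  have hYV' : Y ≤ V := by linarith
  have hε := G.eps_pos hm hφ b
  have hloss : ∀ i ≤ G.tLast φ, G.lsCurve (G.pVec v i) Y ≤
      G.lsCurve (G.rVec φ b v i) Y + Y / (900 * ((G.ell : ℝ) + 2) * 2 ^ b) := by
    intro i hi
    refine (G.lsCurve_le_add (G.pVec_le_rVec_add hd hε.le v i) hY0.le hYV').trans ?_
    have := mul_le_mul_of_nonneg_right (G.mul_eps_le hm hφ b hi) hY0.le
    rw [one_div_mul_eq_div] at this
    linarith
  -- The dichotomy: either the slope condition fails in some round of the phase, or it holds in all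
  -- of them and only conductance can prevent acceptance.
  by_cases hC : ∃ i, s < i ∧ i ≤ t ∧
      G.lsSlope (G.qVec φ b v i) (2 ^ b) < 1 / (140 * ((G.ell : ℝ) + 2) * 2 ^ b)
  · obtain ⟨i, hsi, hit, hslope⟩ := hC
    have h1 := G.lsCurve_pVec_antitone hd v hit hY0.le hYV'
    have h2 := hloss i (hit.trans ht)
    have h3 := G.lsCurve_mono (G.rVec_le_qVec φ b v i) hY0.le hYV'
    have h4 := G.lsCurve_le_lsSlope hd (G.qVec φ b v i) hB (hY.trans hYV') hY0.le hYV'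
    have h5 : G.lsCurve (G.qVec φ b v i) (2 ^ b) +
        G.lsSlope (G.qVec φ b v i) (2 ^ b) * (Y - 2 ^ b) ≤
        A + Y / (140 * ((G.ell : ℝ) + 2) * 2 ^ b) := by
      have h6 := mul_le_mul_of_nonneg_right hslope.le hY0.le
      rw [one_div_mul_eq_div] at h6
      -- At scale `0` the value of the curve at `1` is its slope there, so nothing about time `s` is
      -- needed.
      rcases hA with ⟨rfl, rfl⟩ | hA
      · simp only [pow_zero] at h6 ⊢
        rw [G.lsCurve_one hd _ (by linarith)]
        linarith
      · have h7 := G.lsCurve_mono (G.qVec_le_pVec φ b v i) hB.le (hY.trans hYV')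
        have h8 := G.lsCurve_pVec_antitone hd v hsi.le hB.le (hY.trans hYV')
        have h9 := mul_le_mul_of_nonneg_right hslope.le (sub_nonneg.2 hY)
        have h10 : 1 / (140 * ((G.ell : ℝ) + 2) * 2 ^ b) * (Y - 2 ^ b) ≤
            Y / (140 * ((G.ell : ℝ) + 2) * 2 ^ b) := by
          rw [one_div_mul_eq_div]
          gcongr
          linarith
        linarith
    have h6 := le_max_left (Y / (140 * ((G.ell : ℝ) + 2) * 2 ^ b)) (6 / 5 * (Y / V) +
        1 / √(2 ^ b) * (1 - φ ^ 2 / 8) ^ (t - s) * min (√Y) (√(V - Y)))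
    linarith
  · push Not at hC
    have hδ : 0 ≤ 1 - φ ^ 2 / 8 := by nlinarith
    -- Sweep sets too small for the test are controlled by `A`. At scale `0` such a set has volume
    -- `0`, as volumes are integers, so `A = 0` suffices.
    have hsmall : ∀ i, s ≤ i → ∀ j, (G.vol (G.sweep (G.qVec φ b v i) j) : ℝ) < 2 ^ b →
        ∑ u ∈ G.sweep (G.qVec φ b v i) j, G.rVec φ b v i u ≤ A := by
      intro i hi j hj
      have hc : G.Compatible (G.qVec φ b v i) (G.rVec φ b v i) := by
        rw [rVec_eq_trunc]; exact G.compatible_trunc hd hε _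
      rw [← G.lsCurve_vol_sweep hd hc]
      rcases hA with ⟨rfl, rfl⟩ | hA
      · have : G.vol (G.sweep (G.qVec φ 0 v i) j) = 0 := by
          simpa using hj
        rw [this, Nat.cast_zero, G.lsCurve_zero hd]
      · have h0 : (0 : ℝ) ≤ G.vol (G.sweep (G.qVec φ b v i) j) := Nat.cast_nonneg _
        have h1 := G.lsCurve_mono (fun u => (G.rVec_le_qVec φ b v i u).trans
          (G.qVec_le_pVec φ b v i u)) h0 (hj.le.trans (hY.trans hYV'))
        have h2 := G.lsCurve_monotone (G.pVec_nonneg v i) h0 hj.le (hY.trans hYV')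
        have h3 := G.lsCurve_pVec_antitone hd v hi hB.le (hY.trans hYV')
        linarith
    have hrs : ∀ i, ∑ u, G.rVec φ b v i u ≤ 1 := fun i =>
      (Finset.sum_le_sum fun u _ => (G.rVec_le_qVec φ b v i u).trans
          (G.qVec_le_pVec φ b v i u)).trans (G.sum_pVec hd v i).le
    have hind : ∀ k, s + k ≤ t → ∀ x : ℝ, 0 ≤ x → x ≤ V → G.lsCurve (G.rVec φ b v (s + k)) x ≤
        envelope V A (1 / √(2 ^ b) * (1 - φ ^ 2 / 8) ^ k) x := by
      intro k
      induction k with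
      | zero =>
        intro _ x hx0 hx1
        rw [pow_zero, mul_one]
        refine (G.lsCurve_mono (fun u => (G.rVec_le_qVec φ b v s u).trans
          (G.qVec_le_pVec φ b v s u)) hx0 hx1).trans ?_
        exact G.initial_le_envelope hd (G.pVec_nonneg v s) (G.sum_pVec hd v s).le hA0 hA
          (hY.trans hYV) hV2 hx0 hx1
      | succ k ih =>
        intro hk x hx0 hx1
        have := G.lsCurve_trunc_walk_le hd (X := 2 ^ b) hε hφ hφ1 hA0
          (c := 1 / √(2 ^ b) * (1 - φ ^ 2 / 8) ^ k) (by positivity)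
          (G.rVec_qVec_nonneg φ b v (s + k)).2 (hrs (s + k))
          (Nat.cast_pos.1 (by linarith : (0 : ℝ) < V)) (ih (by omega))
          (hsmall (s + (k + 1)) (by omega)) ?_ hx0 hx1
        · rw [pow_succ, ← mul_assoc]; exact this
        · intro j hj1 hjs hl hu
          -- If the conductance were at most `φ`, all four conditions would hold and contradict
          -- `Fails`.
          by_contra hcon
          exact hf (s + (k + 1)) (by omega) (hk.trans ht) j hj1 hjs
            ⟨not_lt.1 hcon, hu, hl, hC (s + (k + 1)) (by omega) hk⟩
    have h1 := hind (t - s) (by omega) Y hY0.le hYV'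
    rw [Nat.add_sub_cancel' hst] at h1
    have h2 := hloss t ht
    have h3 := le_max_right (Y / (140 * ((G.ell : ℝ) + 2) * 2 ^ b)) (6 / 5 * (Y / V) +
        1 / √(2 ^ b) * (1 - φ ^ 2 / 8) ^ (t - s) * min (√Y) (√(V - Y)))
    unfold envelope at h1
    linarith

/-! ### Vertices from which the walk stays inside a set -/

open Classical in
/-- The probability that the walk from `u` stays in `S` for `t` steps. -/
noncomputable def stay (G : LoopGraph n) (S : Finset (Fin n)) : ℕ → Fin n → ℝ
  | 0 => fun u => if u ∈ S then 1 else 0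
  | t + 1 => fun u => if u ∈ S then G.coWalk (stay G S t) u else 0

theorem coWalk_mono (G : LoopGraph n) {f g : Fin n → ℝ} (h : ∀ u, f u ≤ g u) (u : Fin n) :
    G.coWalk f u ≤ G.coWalk g u := by
  unfold coWalk
  have : ∑ x, (G.mult u x : ℝ) * f x ≤ ∑ x, (G.mult u x : ℝ) * g x :=
    Finset.sum_le_sum fun x _ => mul_le_mul_of_nonneg_left (h x) (Nat.cast_nonneg _)
  have := div_le_div_of_nonneg_right this (Nat.cast_nonneg (G.deg u))
  linarith [h u]

theorem stay_mem (G : LoopGraph n) (hd : ∀ u, 0 < G.deg u) (S : Finset (Fin n)) (t : ℕ)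
    (u : Fin n) : 0 ≤ G.stay S t u ∧ G.stay S t u ≤ 1 := by
  induction t generalizing u with
  | zero => unfold stay; split_ifs <;> simp
  | succ t ih =>
    unfold stay
    split_ifs
    · exact G.coWalk_mem hd ih u
    · simp

theorem stay_of_notMem (G : LoopGraph n) {S : Finset (Fin n)} (t : ℕ) {u : Fin n} (hu : u ∉ S) :
    G.stay S t u = 0 := by
  cases t <;> simp [stay, hu]

theorem stay_succ_of_mem (G : LoopGraph n) {S : Finset (Fin n)} (t : ℕ) {u : Fin n} (hu : u ∈ S) :
    G.stay S (t + 1) u = G.coWalk (G.stay S t) u := by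
  simp only [stay]
  rw [if_pos hu]

theorem stay_antitone (G : LoopGraph n) (hd : ∀ u, 0 < G.deg u) (S : Finset (Fin n)) {s t : ℕ}
    (hst : s ≤ t) (u : Fin n) : G.stay S t u ≤ G.stay S s u := by
  have key : ∀ t u, G.stay S (t + 1) u ≤ G.stay S t u := by
    intro t
    induction t with
    | zero =>
      intro u
      by_cases hu : u ∈ S
      · have h := (G.stay_mem hd S 1 u).2
        simpa [stay, hu] using h
      · rw [G.stay_of_notMem _ hu, G.stay_of_notMem _ hu]
    | succ t ih =>
      intro u
      by_cases hu : u ∈ S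
      · have h := G.coWalk_mono ih u
        rwa [G.stay_succ_of_mem _ hu, G.stay_succ_of_mem _ hu]
      · rw [G.stay_of_notMem _ hu, G.stay_of_notMem _ hu]
  induction t, hst using Nat.le_induction with
  | base => exact le_rfl
  | succ t _ ih => exact (key t u).trans ih

/-- Steps are moved one by one from the test function to the vector. The pairing only grows, since
`stay` drops the values outside `S` that `coWalk` retains. -/
theorem stay_le_sum_pVec (G : LoopGraph n) (hd : ∀ u, 0 < G.deg u) (S : Finset (Fin n))
    (v : Fin n) (t : ℕ) : G.stay S t v ≤ ∑ u ∈ S, G.pVec v t u := by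
  classical
  have key : ∀ k s, ∑ u, G.stay S (s + k) u * G.pVec v 0 u ≤ ∑ u, G.stay S s u * G.pVec v k u := by
    intro k
    induction k with
    | zero => intro s; exact le_rfl
    | succ k ih =>
      intro s
      have h1 := ih (s + 1)
      rw [show s + (k + 1) = s + 1 + k by omega]
      refine h1.trans ?_
      rw [pVec, G.sum_mul_walk]
      refine Finset.sum_le_sum fun u _ => mul_le_mul_of_nonneg_right ?_ (G.pVec_nonneg v k u)
      by_cases hu : u ∈ S
      · rw [G.stay_succ_of_mem _ hu]
      · rw [G.stay_of_notMem _ hu]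
        exact (G.coWalk_mem hd (G.stay_mem hd S s) u).1
  have h := key t 0
  rw [zero_add] at h
  simpa [pVec, stay, Pi.single_apply] using h

/-- By duality one step is applied to the degree vector restricted to `S`. The lazy walk takes from
it half of the arcs crossing the boundary, and `stay ≤ 1` limits what this loss is worth, so each
step costs at most `cut S / 2`. -/
theorem vol_sub_le_sum_stay (G : LoopGraph n) (hd : ∀ u, 0 < G.deg u) (S : Finset (Fin n))
    (t : ℕ) : (G.vol S : ℝ) - t * G.cut S / 2 ≤ ∑ u, G.stay S t u * G.deg u := by
  classical
  induction t with
  | zero => simp [stay, vol]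
  | succ t ih =>
    have h1 : ∑ u, G.stay S (t + 1) u * (G.deg u : ℝ) =
        ∑ u, G.stay S t u * G.walkMatrix.mulVec (fun u => if u ∈ S then (G.deg u : ℝ) else 0) u := by
      rw [G.sum_mul_walk]
      refine Finset.sum_congr rfl fun u _ => ?_
      by_cases hu : u ∈ S
      · rw [G.stay_succ_of_mem _ hu, if_pos hu]
      · rw [G.stay_of_notMem _ hu, if_neg hu, zero_mul, mul_zero]
    have h2 : ∀ u, G.stay S t u * (G.deg u : ℝ) - (if u ∈ S then ∑ w ∈ Sᶜ, (G.mult u w : ℝ) else 0) / 2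
        ≤ G.stay S t u *
          G.walkMatrix.mulVec (fun u => if u ∈ S then (G.deg u : ℝ) else 0) u := by
      intro u
      by_cases hu : u ∈ S
      · rw [if_pos hu, walk_apply, if_pos hu]
        have e1 : ∀ w, (G.mult u w : ℝ) * ((if w ∈ S then (G.deg w : ℝ) else 0) / G.deg w) =
            if w ∈ S then (G.mult u w : ℝ) else 0 := by
          intro w
          have : (G.deg w : ℝ) ≠ 0 := by exact_mod_cast (hd w).ne'
          split_ifs
          · rw [div_self this, mul_one]
          · simp
        simp only [e1, Finset.sum_ite_mem, Finset.univ_inter]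
        have e2 : (G.deg u : ℝ) = ∑ w ∈ S, (G.mult u w : ℝ) + ∑ w ∈ Sᶜ, (G.mult u w : ℝ) := by
          rw [Finset.sum_add_sum_compl, deg_eq_sum_mult, Nat.cast_sum]
        have e3 : (0 : ℝ) ≤ ∑ w ∈ Sᶜ, (G.mult u w : ℝ) := by positivity
        have e4 := (G.stay_mem hd S t u)
        rw [e2]
        nlinarith
      · rw [if_neg hu, G.stay_of_notMem t hu]
        simp
    have h3 := Finset.sum_le_sum fun u (_ : u ∈ Finset.univ) => h2 u
    rw [Finset.sum_sub_distrib, ← Finset.sum_div, Finset.sum_ite_mem, Finset.univ_inter] at h3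
    have h4 : ∑ u ∈ S, ∑ w ∈ Sᶜ, (G.mult u w : ℝ) = G.cut S := by
      rw [G.cut_eq_sum_mult]; push_cast; rfl
    rw [h1]
    rw [h4] at h3
    push_cast
    linarith

open Classical in
/-- The set of good start vertices in `S`. -/
noncomputable def goodSet (G : LoopGraph n) (φ : ℝ) (S : Finset (Fin n)) : Finset (Fin n) :=
  S.filter fun v => 1 - G.tLast φ * G.conductance S ≤ G.stay S (G.tLast φ) v

/-- Markov's inequality: by `vol_sub_le_sum_stay` the degree-weighted average of the escape
probability over `S` is at most half of `t_last Φ(S)`, so vertices that exceed `t_last Φ(S)` have at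
most half of the volume. -/
theorem half_vol_le_vol_goodSet (G : LoopGraph n) (hd : ∀ u, 0 < G.deg u) (φ : ℝ)
    {S : Finset (Fin n)} (hS : (G.vol S : ℝ) ≤ 2 / 3 * (G.vol Finset.univ : ℝ)) :
    (G.vol S : ℝ) / 2 ≤ G.vol (G.goodSet φ S) := by
  classical
  rcases S.eq_empty_or_nonempty with rfl | hne
  · simp [vol, Finset.sum_nonneg]
  set T := G.tLast φ
  set c := (T : ℝ) * G.conductance S with hc
  have hvS : (0 : ℝ) < G.vol S := by exact_mod_cast G.vol_pos hd hne
  have hcpl : (G.vol Sᶜ : ℝ) = G.vol Finset.univ - G.vol S := by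
    rw [eq_sub_iff_add_eq']; exact_mod_cast G.vol_add_vol_compl _
  have hmin : 0 < min (G.vol S : ℝ) (G.vol Sᶜ : ℝ) := lt_min hvS (by rw [hcpl]; linarith)
  have hcut : (T : ℝ) * G.cut S ≤ c * G.vol S := by
    have : (G.cut S : ℝ) = G.conductance S * min (G.vol S : ℝ) (G.vol Sᶜ : ℝ) := by
      rw [conductance, if_neg hne.ne_empty, div_mul_cancel₀ _ hmin.ne']
    have h0 : 0 ≤ G.conductance S := by
      rw [conductance, if_neg hne.ne_empty]; positivity
    rw [this, hc, mul_assoc]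
    have := min_le_left (G.vol S : ℝ) (G.vol Sᶜ : ℝ)
    gcongr
  have hstay := G.vol_sub_le_sum_stay hd S T
  have e1 : ∑ u, G.stay S T u * (G.deg u : ℝ) = ∑ u ∈ S, G.stay S T u * (G.deg u : ℝ) := by
    refine (Finset.sum_subset (Finset.subset_univ _) fun u _ hu => ?_).symm
    rw [G.stay_of_notMem T hu, zero_mul]
  have e2 : ∑ u ∈ S, (1 - G.stay S T u) * (G.deg u : ℝ) ≤ c * G.vol S / 2 := by
    simp only [sub_mul, one_mul]
    rw [Finset.sum_sub_distrib, ← e1, ← Nat.cast_sum]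
    change (G.vol S : ℝ) - _ ≤ _
    linarith
  have hsplit : (G.vol (G.goodSet φ S) : ℝ) +
      G.vol (S.filter fun v => ¬ (1 - c ≤ G.stay S T v)) = G.vol S := by
    exact_mod_cast Finset.sum_filter_add_sum_filter_not S _ _
  set B := S.filter fun v => ¬ (1 - c ≤ G.stay S T v) with hB
  have hc0 : 0 ≤ c := by
    have h0 : 0 ≤ G.conductance S := by
      rw [conductance, if_neg hne.ne_empty]; positivity
    positivity
  have e3 : ∑ u ∈ B, (1 - G.stay S T u) * (G.deg u : ℝ) ≤
      ∑ u ∈ S, (1 - G.stay S T u) * (G.deg u : ℝ) :=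
    Finset.sum_le_sum_of_subset_of_nonneg (Finset.filter_subset _ _) fun u _ _ =>
      mul_nonneg (sub_nonneg.2 (G.stay_mem hd S T u).2) (Nat.cast_nonneg _)
  rcases B.eq_empty_or_nonempty with hBe | hBne
  · rw [hBe] at hsplit
    simp only [vol, Finset.sum_empty, Nat.cast_zero, add_zero] at hsplit hvS ⊢
    linarith
  -- Bad vertices exceed `c` strictly, so the inequality stays strict and `c` can be cancelled
  -- although only `0 ≤ c` is known.
  have e4 : c * G.vol B < ∑ u ∈ B, (1 - G.stay S T u) * (G.deg u : ℝ) := by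
    rw [vol, Nat.cast_sum, Finset.mul_sum]
    refine Finset.sum_lt_sum_of_nonempty hBne fun u hu => ?_
    have hu' := not_le.1 (Finset.mem_filter.1 hu).2
    have : (0 : ℝ) < G.deg u := by exact_mod_cast hd u
    exact mul_lt_mul_of_pos_right (by linarith) this
  have e5 : c * G.vol B < c * (G.vol S / 2) := by linarith
  have := lt_of_mul_lt_mul_left e5 hc0
  linarith

theorem le_sum_pVec_of_mem_goodSet (G : LoopGraph n) (hd : ∀ u, 0 < G.deg u) (hm : 1 ≤ G.m)
    {φ : ℝ} (hφ : 0 < φ) {S : Finset (Fin n)} (hS : G.conductance S ≤ G.fOne φ) {v : Fin n}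
    (hv : v ∈ G.goodSet φ S) {t : ℕ} (ht : t ≤ G.tLast φ) :
    1 - 1 / (280 * ((G.ell : ℝ) + 2)) ≤ ∑ u ∈ S, G.pVec v t u := by
  classical
  have h1 := (Finset.mem_filter.1 hv).2
  have h2 := G.stay_antitone hd S ht v
  have h3 := G.stay_le_sum_pVec hd S v t
  have h4 := mul_le_mul_of_nonneg_left hS (Nat.cast_nonneg (α := ℝ) (G.tLast φ))
  rw [G.tLast_mul_fOne hm hφ] at h4
  linarith

/-- The accepted set has a large intersection with `S`. -/
theorem half_le_vol_inter (G : LoopGraph n) (hd : ∀ u, 0 < G.deg u) (hm : 1 ≤ G.m)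
    {φ : ℝ} (hφ : 0 < φ) {S : Finset (Fin n)} (hS : G.conductance S ≤ G.fOne φ) {v : Fin n}
    (hv : v ∈ G.goodSet φ S) {b t j : ℕ} (ht : t ≤ G.tLast φ) (hsc : G.StopCond φ b v t j) :
    (2 : ℝ) ^ b / 2 ≤ G.vol (G.sweep (G.qVec φ b v t) j ∩ S) := by
  classical
  obtain ⟨-, hvol, hlow, hslope⟩ := hsc
  set q := G.qVec φ b v t with hq
  have hB : (0 : ℝ) < 2 ^ b := by positivity
  have hL : (0 : ℝ) < (G.ell : ℝ) + 2 := by positivity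
  have hbV : (2 : ℝ) ^ b ≤ G.vol Finset.univ := by
    have : (0 : ℝ) ≤ G.vol Finset.univ := Nat.cast_nonneg _
    linarith
  -- The sweep set with `i + 1` vertices is the first whose volume reaches `2 ^ b`. Its last vertex
  -- determines the slope, and the accepted set contains it because the accepted volume is at least
  -- `2 ^ b`.
  obtain ⟨i, hin, hi0, hi1⟩ := G.exists_sweep_between q hB hbV
  obtain ⟨u, hu⟩ := G.exists_rank_eq q hin
  rw [G.lsSlope_eq hd q hu hi0 hi1] at hslope
  have hij : i + 1 ≤ j := by
    by_contra hcon
    have : (G.vol (G.sweep q j) : ℝ) ≤ G.vol (G.sweep q i) := by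
      exact_mod_cast G.vol_sweep_mono q (by omega)
    linarith
  set θ : ℝ := 1 / (140 * ((G.ell : ℝ) + 2) * 2 ^ b) with hθ
  have hθ0 : 0 < θ := by positivity
  -- Every vertex of this first set has density at least `θ`, so its part outside `S` is paid for by
  -- the mass that has left `S`.
  have hout : θ * G.vol (G.sweep q (i + 1) \ S) ≤ 1 / (280 * ((G.ell : ℝ) + 2)) := by
    calc θ * G.vol (G.sweep q (i + 1) \ S)
        = ∑ y ∈ G.sweep q (i + 1) \ S, θ * G.deg y := by rw [vol, Nat.cast_sum, Finset.mul_sum]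
      _ ≤ ∑ y ∈ G.sweep q (i + 1) \ S, G.pVec v t y := by
          refine Finset.sum_le_sum fun y hy => ?_
          have hyd : (0 : ℝ) < G.deg y := by exact_mod_cast hd y
          have h1 : θ ≤ q y / G.deg y := by
            have hry := mem_sweep.1 (Finset.mem_sdiff.1 hy).1
            rcases Nat.lt_succ_iff_lt_or_eq.1 hry with h | h
            · exact hslope.trans (before_iff_rank_lt.2 (h.trans_eq hu.symm)).ratio_le
            · rwa [G.rank_injective q (h.trans hu.symm)]
          rw [le_div_iff₀ hyd] at h1
          exact h1.trans (G.qVec_le_pVec φ b v t y)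
      _ ≤ ∑ y ∈ Sᶜ, G.pVec v t y :=
          Finset.sum_le_sum_of_subset_of_nonneg (fun y hy => by
            simpa using (Finset.mem_sdiff.1 hy).2) fun y _ _ => G.pVec_nonneg v t y
      _ ≤ _ := by
          have h1 := G.le_sum_pVec_of_mem_goodSet hd hm hφ hS hv ht
          have h2 := Finset.sum_add_sum_compl S (G.pVec v t)
          rw [G.sum_pVec hd] at h2
          linarith
  have hout' : (G.vol (G.sweep q (i + 1) \ S) : ℝ) ≤ 2 ^ b / 2 := by
    have h1 : θ * (2 ^ b / 2) = 1 / (280 * ((G.ell : ℝ) + 2)) := by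
      rw [hθ]; field_simp; norm_num
    rw [← h1] at hout
    exact le_of_mul_le_mul_left hout hθ0
  have hsplit : (G.vol (G.sweep q (i + 1) ∩ S) : ℝ) + G.vol (G.sweep q (i + 1) \ S) =
      G.vol (G.sweep q (i + 1)) := by
    exact_mod_cast Finset.sum_inter_add_sum_sdiff (G.sweep q (i + 1)) S _
  have hmono : (G.vol (G.sweep q (i + 1) ∩ S) : ℝ) ≤ G.vol (G.sweep q j ∩ S) := by
    exact_mod_cast G.vol_mono (Finset.inter_subset_inter_right (G.sweep_mono q hij))
  linarith

end LoopGraph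

namespace LoopGraph

variable {n : ℕ}

/-! ### Growth of the curve over all phases -/

theorem add_two_sq_le_two_pow {k : ℕ} (hk : 5 ≤ k) : (k + 2) ^ 2 ≤ 2 ^ (k + 1) := by
  induction k, hk using Nat.le_induction with
  | base => norm_num
  | succ k hk ih => rw [pow_succ 2]; nlinarith

/-- In a large graph the number of scales is small compared with the volume. -/
theorem large_graph_bounds (G : LoopGraph n) (hm : 1 ≤ G.m) {k : ℕ}
    (hk : (2 : ℝ) ^ (2 * k) * (60 * ((G.ell : ℝ) + 2)) ≤ G.vol Finset.univ) :
    2 * k + 5 ≤ G.ell ∧ (G.ell : ℝ) + 2 ≤ 2 * √((G.vol Finset.univ : ℝ) / 2) := by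
  have h1 := G.half_vol_le_two_pow_ell
  have hl : (0 : ℝ) ≤ G.ell := Nat.cast_nonneg _
  have hB : (0 : ℝ) < 2 ^ (2 * k) := by positivity
  -- Since `ℓ + 2 ≥ 2` and `vol V ≤ 2 * 2 ^ ℓ`, the hypothesis yields `60 * 2 ^ (2 k) ≤ 2 ^ ℓ`, and
  -- `32 ≤ 60`.
  have h2 : (2 : ℝ) ^ (2 * k + 5) ≤ 2 ^ G.ell := by
    rw [pow_add]; nlinarith
  have h3 : 2 * k + 5 ≤ G.ell := (pow_le_pow_iff_right₀ (by norm_num)).1 h2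
  refine ⟨h3, ?_⟩
  have hVpos : 0 < G.vol Finset.univ := by
    have : (0 : ℝ) < G.vol Finset.univ := by have := hm; unfold m at this; linarith
    exact_mod_cast this
  have h4 := G.two_pow_lt_half_vol (k := G.ell - 1) hVpos (by omega)
  have h5 := add_two_sq_le_two_pow (k := G.ell) (by omega)
  have h6 : ((G.ell : ℝ) + 2) ^ 2 ≤ 2 ^ (G.ell + 1) := by exact_mod_cast h5
  have h7 : (2 : ℝ) ^ (G.ell + 1) = 2 ^ (G.ell - 1) * 4 := by
    rw [show G.ell + 1 = G.ell - 1 + 2 by omega, pow_add]; norm_num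
  have h8 : ((G.ell : ℝ) + 2) / 2 ≤ √((G.vol Finset.univ : ℝ) / 2) :=
    Real.le_sqrt_of_sq_le (by nlinarith)
  linarith

/-- Induction over the scales `4 ^ k`: a phase of `2 t₁` rounds carries the bound from volume `4 ^
k` to `4 ^ (k + 1)` and adds `0.2845 / (ℓ + 2)`. At `k = 0` the curve at `1` has no reason to
vanish, so this case is kept as the separate alternative that `lsCurve_phase_le` accepts. -/
theorem lsCurve_chain_le (G : LoopGraph n) (hd : ∀ u, 0 < G.deg u) (hm : 1 ≤ G.m) {φ : ℝ}
    (hφ : 0 < φ) (hφ1 : φ < 1) {v : Fin n} (hf : ∀ b ≤ G.ell, G.Fails φ b v) (k : ℕ)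
    (hk : k = 0 ∨ (2 : ℝ) ^ (2 * (k - 1)) * (60 * ((G.ell : ℝ) + 2)) ≤ G.vol Finset.univ) :
    (2 * k = 0 ∧ k * (0.2845 / ((G.ell : ℝ) + 2)) = 0) ∨
      G.lsCurve (G.pVec v (2 * k * G.tOne φ)) (2 ^ (2 * k)) ≤
        k * (0.2845 / ((G.ell : ℝ) + 2)) := by
  induction k with
  | zero => left; simp
  | succ k ih =>
    right
    have hk' : (2 : ℝ) ^ (2 * k) * (60 * ((G.ell : ℝ) + 2)) ≤ G.vol Finset.univ := by
      simpa using hk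
    obtain ⟨hkl, hLm⟩ := G.large_graph_bounds hm hk'
    set V : ℝ := (G.vol Finset.univ : ℝ) with hV
    set L : ℝ := (G.ell : ℝ) + 2 with hL
    have hL2 : 2 ≤ L := by have : (0 : ℝ) ≤ G.ell := Nat.cast_nonneg _; linarith
    have hB : (0 : ℝ) < 2 ^ (2 * k) := by positivity
    have hV0 : 0 < V := lt_of_lt_of_le (by positivity) hk'
    have hk'' : k = 0 ∨ (2 : ℝ) ^ (2 * (k - 1)) * (60 * L) ≤ V := by
      right
      refine le_trans ?_ hk'
      have : (2 : ℝ) ^ (2 * (k - 1)) ≤ 2 ^ (2 * k) :=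
        pow_le_pow_right₀ (by norm_num) (by omega)
      gcongr
    have hA := ih hk''
    set B : ℝ := 2 ^ (2 * k) with hBdef
    have hpow : (2 : ℝ) ^ (2 * (k + 1)) = 4 * B := by rw [mul_add, pow_add]; ring
    have hBV : B * 120 ≤ V := by nlinarith
    have hphase := G.lsCurve_phase_le hd hm hφ hφ1 (hf (2 * k) (by omega))
      (s := 2 * k * G.tOne φ) (t := 2 * (k + 1) * G.tOne φ) (Y := 4 * B)
      (Nat.mul_le_mul_right _ (by omega))
      (Nat.mul_le_mul_right _ (by omega)) (by positivity) hA (by linarith) (by linarith)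
    rw [hpow]
    refine hphase.trans ?_
    rw [← hBdef, ← hV, ← hL]
    have hexp : 2 * (k + 1) * G.tOne φ - 2 * k * G.tOne φ = G.tOne φ * 2 := by
      rw [← Nat.sub_mul]; rw [show 2 * (k + 1) - 2 * k = 2 by omega, mul_comm]
    rw [hexp, pow_mul (1 - φ ^ 2 / 8)]
    have hcon := G.contraction_le hm hφ hφ1
    rw [← hV, ← hL] at hcon
    set E := (1 - φ ^ 2 / 8) ^ G.tOne φ with hE
    -- `L ≤ 2 √(V / 2)` turns the contraction over `4 t₁` steps into `E ^ 4 ≤ 1 / (100 L²)`, whose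
    -- square root is the bound for `2 t₁` steps.
    have hE2 : E ^ 2 ≤ 1 / (10 * L) := by
      have h1 : (E ^ 2) ^ 2 * (100 * L ^ 2) ≤ 1 := by
        refine le_trans ?_ hcon
        rw [show (E ^ 2) ^ 2 = E ^ 4 by ring]
        have : 100 * L ^ 2 ≤ 200 * L * √(V / 2) := by nlinarith
        gcongr
      rw [le_div_iff₀ (by positivity)]
      have h2 : (E ^ 2 * (10 * L)) ^ 2 ≤ 1 := by nlinarith
      exact (sq_le_one_iff₀ (by positivity)).1 h2
    -- Truncation costs `4/900`. The mixing alternative costs `0.08 + 0.2`, where `0.08 = 6/5 *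
    -- 4/60` comes from `60 L B ≤ V` and `0.2` from `hE2`; this dominates the slope alternative
    -- `4/140`. Together they stay below `0.2845`.
    have e1 : 4 * B / (900 * L * B) = (4 / 900) / L := by field_simp
    have e2 : 4 * B / (140 * L * B) = (4 / 140) / L := by field_simp
    have e3 : 6 / 5 * (4 * B / V) ≤ 0.08 / L := by
      rw [← mul_div_assoc, div_le_div_iff₀ hV0 (by positivity)]
      nlinarith
    have e4 : 1 / √B * E ^ 2 * min (√(4 * B)) (√(V - 4 * B)) ≤ 0.2 / L := by
      have hs : √(4 * B) = 2 * √B := by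
        rw [Real.sqrt_mul (by norm_num), show (4 : ℝ) = 2 ^ 2 by norm_num,
          Real.sqrt_sq (by norm_num)]
      have hsB : 0 < √B := Real.sqrt_pos.2 hB
      calc 1 / √B * E ^ 2 * min (√(4 * B)) (√(V - 4 * B)) ≤ 1 / √B * E ^ 2 * (2 * √B) := by
            rw [← hs]; gcongr; exact min_le_left _ _
        _ = 2 * E ^ 2 := by field_simp
        _ ≤ 2 * (1 / (10 * L)) := by gcongr
        _ = 0.2 / L := by field_simp; norm_num
    have e5 : max (4 * B / (140 * L * B)) (6 / 5 * (4 * B / V) +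
        1 / √B * E ^ 2 * min (√(4 * B)) (√(V - 4 * B))) ≤ 0.28 / L := by
      refine max_le ?_ ?_
      · rw [e2]; gcongr; norm_num
      · have : (0.28 : ℝ) / L = 0.08 / L + 0.2 / L := by rw [← add_div]; norm_num
        linarith
    rw [e1]
    push_cast
    have e6 : (4 / 900 : ℝ) / L + 0.28 / L ≤ 0.2845 / L := by
      rw [← add_div]; gcongr; norm_num
    linarith

/-- The minimal such `k` ends the chain: all previous scales satisfy the hypothesis of
`lsCurve_chain_le`, while the final scale is large enough that the terms with `V / (L * 4 ^ k)` in
the last phase are small. -/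
theorem exists_last_scale (V L : ℝ) (hL : 0 < L) : ∃ k : ℕ,
    (k = 0 ∨ (2 : ℝ) ^ (2 * (k - 1)) * (60 * L) ≤ V) ∧ V < 2 ^ (2 * k) * (60 * L) := by
  classical
  have hex : ∃ k : ℕ, V < 2 ^ (2 * k) * (60 * L) := by
    obtain ⟨k, hk⟩ := pow_unbounded_of_one_lt (V / (60 * L)) (by norm_num : (1 : ℝ) < 4)
    refine ⟨k, ?_⟩
    rw [div_lt_iff₀ (by positivity)] at hk
    rwa [pow_mul, show (2 : ℝ) ^ 2 = 4 by norm_num]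
  refine ⟨Nat.find hex, ?_, Nat.find_spec hex⟩
  rcases Nat.eq_zero_or_pos (Nat.find hex) with h | h
  · exact Or.inl h
  · exact Or.inr (not_lt.1 (Nat.find_min hex (by omega)))

/-- In a small graph one phase is enough. -/
theorem small_graph_mixing (G : LoopGraph n) (hm : 1 ≤ G.m) {φ : ℝ} (hφ : 0 < φ) (hφ1 : φ < 1) :
    (1 - φ ^ 2 / 8) ^ G.tLast φ * √((G.vol Finset.univ : ℝ) / 3) ≤
      if G.ell = 0 then 0.184 else 0.1 := by
  have hcon := G.contraction_le hm hφ hφ1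
  have hV := G.half_vol_le_two_pow_ell
  rw [tLast, mul_comm (G.ell + 1), pow_mul]
  set V : ℝ := (G.vol Finset.univ : ℝ)
  have hV2 : 1 ≤ V / 2 := hm
  set E := (1 - φ ^ 2 / 8) ^ G.tOne φ with hE
  have hδ0 : 0 ≤ 1 - φ ^ 2 / 8 := by nlinarith
  have hE0 : 0 ≤ E := pow_nonneg hδ0 _
  have hE1 : E ≤ 1 := pow_le_one₀ hδ0 (by nlinarith)
  have hsm : 1 ≤ √(V / 2) := Real.one_le_sqrt.2 hV2
  have hsq : √(V / 2) ^ 2 = V / 2 := Real.sq_sqrt (by linarith)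
  have h3 : √(V / 3) ^ 2 = V / 3 := Real.sq_sqrt (by linarith)
  have hE4 : 0 ≤ E ^ 4 := by positivity
  split_ifs with h
  · rw [h] at hcon hV ⊢
    simp only [Nat.cast_zero, zero_add, pow_zero] at hcon hV
    have hVe : V = 2 := by linarith
    have e1 : E ^ 4 ≤ 1 / 400 := by nlinarith
    have e2 : E ≤ 0.224 := by
      by_contra hc
      have := pow_lt_pow_left₀ (not_le.1 hc) (by norm_num) (n := 4) (by norm_num)
      norm_num at this
      linarith
    have e3 : √(V / 3) ≤ 0.82 := Real.sqrt_le_iff.2 ⟨by norm_num, by rw [hVe]; norm_num⟩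
    rw [zero_add, pow_one]
    calc E * √(V / 3) ≤ 0.224 * 0.82 := by gcongr
      _ ≤ 0.184 := by norm_num
  · have hl1 : (1 : ℝ) ≤ G.ell := by exact_mod_cast Nat.one_le_iff_ne_zero.2 h
    have key : (E ^ (G.ell + 1) * √(V / 3)) ^ 2 ≤ 0.1 ^ 2 := by
      rw [mul_pow, h3, ← pow_mul]
      -- For `ℓ ≤ 2` the volume is at most `8` and one fourth power of `E` suffices. For `ℓ ≥ 3`
      -- there are at least `8` factors `E` in the square, and they absorb `V / 3`.
      rcases le_or_gt G.ell 2 with h2 | h2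
      · have hV8 : V ≤ 8 := by
          have : (2 : ℝ) ^ G.ell ≤ 2 ^ 2 := pow_le_pow_right₀ (by norm_num) h2
          linarith
        have e1 : E ^ ((G.ell + 1) * 2) ≤ E ^ 4 :=
          pow_le_pow_of_le_one hE0 hE1 (by omega)
        have e2 : E ^ 4 * 600 ≤ 1 := by
          refine le_trans ?_ hcon
          gcongr
          nlinarith
        nlinarith
      · have e1 : E ^ ((G.ell + 1) * 2) ≤ E ^ (4 * 2) :=
          pow_le_pow_of_le_one hE0 hE1 (by omega)
        rw [pow_mul E 4 2] at e1
        have e2 : E ^ 4 * (600 * √(V / 2)) ≤ 1 := by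
          refine le_trans ?_ hcon
          gcongr
          linarith
        have e3 : (E ^ 4 * (600 * √(V / 2))) ^ 2 ≤ 1 := pow_le_one₀ (by positivity) e2
        rw [mul_pow, mul_pow, hsq] at e3
        nlinarith
    exact abs_le_of_sq_le_sq' key (by norm_num) |>.2

-- The mass that a good vertex keeps in `S` is a lower bound for the curve at `2/3 V`. If all scales
-- failed, the chain and one further phase up to that volume would bound the curve by a smaller
-- number.
set_option maxHeartbeats 1000000 in
theorem exists_not_fails (G : LoopGraph n) (hd : ∀ u, 0 < G.deg u) (hm : 1 ≤ G.m) {φ : ℝ}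
    (hφ : 0 < φ) (hφ1 : φ < 1) {S : Finset (Fin n)} (hS : G.conductance S ≤ G.fOne φ)
    (hSv : (G.vol S : ℝ) ≤ 2 / 3 * (G.vol Finset.univ : ℝ)) {v : Fin n}
    (hv : v ∈ G.goodSet φ S) : ∃ b ≤ G.ell, ¬ G.Fails φ b v := by
  classical
  by_contra hcon
  push Not at hcon
  have hlow := G.le_sum_pVec_of_mem_goodSet hd hm hφ hS hv le_rfl
  have hVm : 2 ≤ (G.vol Finset.univ : ℝ) := by have := hm; unfold m at this; linarith
  have hlow2 : ∑ u ∈ S, G.pVec v (G.tLast φ) u ≤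
      G.lsCurve (G.pVec v (G.tLast φ)) (2 / 3 * (G.vol Finset.univ : ℝ)) := by
    have h1 : G.Fractional (G.vol S) (fun u => if u ∈ S then 1 else 0) := by
      refine ⟨fun u => by dsimp only; split_ifs <;> simp, ?_⟩
      simp [vol]
    have h2 := G.le_lsCurve (G.pVec v (G.tLast φ)) h1
    simp only [ite_mul, one_mul, zero_mul, Finset.sum_ite_mem, Finset.univ_inter] at h2
    exact h2.trans (G.lsCurve_monotone (G.pVec_nonneg v _) (Nat.cast_nonneg _) hSv (by linarith))
  obtain ⟨k, hk1, hk2⟩ := exists_last_scale (G.vol Finset.univ) ((G.ell : ℝ) + 2) (by positivity)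
  have hchain := G.lsCurve_chain_le hd hm hφ hφ1 hcon k hk1
  have hl0 : (0 : ℝ) ≤ G.ell := Nat.cast_nonneg _
  set V : ℝ := (G.vol Finset.univ : ℝ) with hV
  have hY : V - 2 / 3 * V = V / 3 := by ring
  -- For `k = 0` the volume is below `60 (ℓ + 2)`, and one phase at scale `0` over all rounds is
  -- enough.
  rcases Nat.eq_zero_or_pos k with rfl | hkpos
  · have hphase := G.lsCurve_phase_le hd hm hφ hφ1 (hcon 0 (Nat.zero_le _)) (Nat.zero_le _) le_rfl
      le_rfl (Or.inl ⟨rfl, rfl⟩) (Y := 2 / 3 * V) (by rw [pow_zero]; linarith) le_rfl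
    have hmix := G.small_graph_mixing hm hφ hφ1
    simp only [pow_zero, mul_one, mul_zero, Real.sqrt_one, one_mul, div_one, Nat.sub_zero,
      zero_add, ← hV] at hphase hk2 hmix
    rw [hY] at hphase
    have hδ : 0 ≤ (1 - φ ^ 2 / 8) ^ G.tLast φ := pow_nonneg (by nlinarith) _
    have h1 := mul_le_mul_of_nonneg_left (min_le_right (√(2 / 3 * V)) (√(V / 3))) hδ
    have h2 : 6 / 5 * (2 / 3 * V / V) = 0.8 := by field_simp; norm_num
    rw [h2] at hphase
    set L : ℝ := (G.ell : ℝ) + 2 with hL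
    have hL2 : 2 ≤ L := by linarith
    have h3 : 2 / 3 * V / (140 * L) ≤ 0.3 := by
      rw [div_le_iff₀ (by positivity)]; linarith
    have h4 : 1 / (280 * L) ≤ 1 / 560 := by
      apply one_div_le_one_div_of_le <;> linarith
    split_ifs at hmix with hell
    · have hVe : V ≤ 2 := by
        have := G.half_vol_le_two_pow_ell
        rw [hell] at this
        linarith
      have h5 : 2 / 3 * V / (900 * L) ≤ 0.001 := by
        rw [div_le_iff₀ (by positivity)]; linarith
      have h6 : max (2 / 3 * V / (140 * L)) (0.8 + (1 - φ ^ 2 / 8) ^ G.tLast φ *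
          min (√(2 / 3 * V)) (√(V / 3))) ≤ 0.984 := max_le (by linarith) (by linarith)
      linarith
    · have h5 : 2 / 3 * V / (900 * L) ≤ 0.045 := by
        rw [div_le_iff₀ (by positivity)]; linarith
      have h6 : max (2 / 3 * V / (140 * L)) (0.8 + (1 - φ ^ 2 / 8) ^ G.tLast φ *
          min (√(2 / 3 * V)) (√(V / 3))) ≤ 0.9 := max_le (by linarith) (by linarith)
      linarith
  · have hk1' := hk1.resolve_left (by omega)
    obtain ⟨hkl, hLm⟩ := G.large_graph_bounds hm hk1'
    rw [← hV] at hLm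
    set L : ℝ := (G.ell : ℝ) + 2 with hL
    have hL8 : 7 ≤ L := by
      have : (5 : ℝ) ≤ G.ell := by exact_mod_cast (by omega : 5 ≤ G.ell)
      linarith
    have hBk : (2 : ℝ) ^ (2 * k) = 4 * 2 ^ (2 * (k - 1)) := by
      rw [show 2 * k = 2 * (k - 1) + 2 by omega, pow_add]; norm_num; ring
    have hB : (0 : ℝ) < 2 ^ (2 * k) := by positivity
    have hBV : (2 : ℝ) ^ (2 * k) * (15 * L) ≤ V := by rw [hBk]; linarith
    set B : ℝ := 2 ^ (2 * k) with hBdef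
    -- `large_graph_bounds` at `k - 1` gives `2 k + 3 ≤ ℓ`. So `4 t₁` rounds remain for the last
    -- phase, exactly what `contraction_le` uses.
    have htl : 2 * k * G.tOne φ + 4 * G.tOne φ ≤ G.tLast φ := by
      rw [← add_mul, tLast]
      exact Nat.mul_le_mul_right _ (by omega)
    have hphase := G.lsCurve_phase_le hd hm hφ hφ1 (hcon (2 * k) (by omega))
      (s := 2 * k * G.tOne φ) (by omega) le_rfl (by positivity) hchain (Y := 2 / 3 * V)
      (by rw [← hBdef]; nlinarith) le_rfl
    rw [← hV, hY, ← hL, ← hBdef] at hphase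
    have hδ0 : 0 ≤ 1 - φ ^ 2 / 8 := by nlinarith
    have hexp : (1 - φ ^ 2 / 8) ^ (G.tLast φ - 2 * k * G.tOne φ) ≤
        ((1 - φ ^ 2 / 8) ^ G.tOne φ) ^ 4 := by
      rw [← pow_mul]
      exact pow_le_pow_of_le_one hδ0 (by nlinarith) (by rw [mul_comm]; omega)
    have hcontr := G.contraction_le hm hφ hφ1
    rw [← hV, ← hL] at hcontr
    set E := (1 - φ ^ 2 / 8) ^ G.tOne φ with hE
    have hE4 : E ^ 4 ≤ 1 / (100 * L ^ 2) := by
      rw [le_div_iff₀ (by positivity)]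
      refine le_trans ?_ hcontr
      have : 100 * L ^ 2 ≤ 200 * L * √(V / 2) := by nlinarith
      gcongr
    have h1 : 1 / √B * (1 - φ ^ 2 / 8) ^ (G.tLast φ - 2 * k * G.tOne φ) *
        min (√(2 / 3 * V)) (√(V / 3)) ≤ 0.0072 := by
      have hs : √(V / 3) ≤ 5 * L * √B := by
        refine Real.sqrt_le_iff.2 ⟨by positivity, ?_⟩
        rw [mul_pow, Real.sq_sqrt hB.le]
        nlinarith
      have hsB : 0 < √B := Real.sqrt_pos.2 hB
      calc 1 / √B * (1 - φ ^ 2 / 8) ^ (G.tLast φ - 2 * k * G.tOne φ) *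
            min (√(2 / 3 * V)) (√(V / 3)) ≤ 1 / √B * (1 / (100 * L ^ 2)) * (5 * L * √B) := by
            gcongr
            · exact hexp.trans hE4
            · exact (min_le_right _ _).trans hs
        _ = 1 / (20 * L) := by field_simp; norm_num
        _ ≤ 1 / (20 * 7) := by gcongr
        _ ≤ 0.0072 := by norm_num
    have h2 : 6 / 5 * (2 / 3 * V / V) = 0.8 := by
      rw [mul_div_assoc, div_self (ne_of_gt (by linarith only [hVm] : 0 < V))]; norm_num
    rw [h2] at hphase
    have h3 : 2 / 3 * V / (140 * L * B) ≤ 0.3 := by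
      rw [div_le_iff₀ (by positivity)]; linarith only [hk2, hVm]
    have h5 : 2 / 3 * V / (900 * L * B) ≤ 0.045 := by
      rw [div_le_iff₀ (by positivity)]; linarith only [hk2, hVm]
    have h4 : 1 / (280 * L) ≤ 1 / 1960 := by
      apply one_div_le_one_div_of_le <;> linarith
    have h6 : max (2 / 3 * V / (140 * L * B)) (0.8 + 1 / √B *
        (1 - φ ^ 2 / 8) ^ (G.tLast φ - 2 * k * G.tOne φ) *
          min (√(2 / 3 * V)) (√(V / 3))) ≤ 0.8072 :=
      max_le (by linarith only [h3]) (by linarith only [h1])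
    have h7 : (k : ℝ) * (0.2845 / L) ≤ 0.14225 := by
      have : (k : ℝ) ≤ L / 2 := by
        have : ((2 * k : ℕ) : ℝ) ≤ G.ell := by exact_mod_cast (by omega : 2 * k ≤ G.ell)
        push_cast at this
        linarith
      calc (k : ℝ) * (0.2845 / L) ≤ L / 2 * (0.2845 / L) := by gcongr
        _ = 0.14225 := by field_simp; norm_num
    -- Chain, truncation and last phase add up to `0.14225 + 0.045 + 0.8072 = 0.99445`, which is
    -- less than `1 - 1/1960`.
    linarith only [hlow, hlow2, hphase, h4, h5, h6, h7]

/-! ### The size of the parameters -/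

/-- The volume is an integer, so `m > 1` forces `m ≥ 3/2`. Then `log m` is at least `1/3` and
absorbs all additive constants; the crude bound `log x ≤ x - 1` is good enough elsewhere. -/
theorem param_bounds (G : LoopGraph n) (hm : 1 < G.m) {φ : ℝ} (hφ : 0 < φ) (hφ1 : φ < 1) :
    1 / 3 ≤ Real.log G.m ∧ (G.ell : ℝ) + 2 ≤ 11 * Real.log G.m ∧
      (G.tOne φ : ℝ) ≤ 1300 * Real.log G.m / φ ^ 2 := by
  have hm32 : 3 / 2 ≤ G.m := by
    unfold m at hm ⊢
    have : 2 < G.vol Finset.univ := by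
      have : (2 : ℝ) < G.vol Finset.univ := by linarith
      exact_mod_cast this
    have : (3 : ℝ) ≤ G.vol Finset.univ := by exact_mod_cast this
    linarith
  have hm0 : 0 < G.m := by linarith
  have h1 : 1 / 3 ≤ Real.log G.m := by
    have h := Real.one_sub_inv_le_log_of_pos hm0
    have : (G.m)⁻¹ ≤ 2 / 3 := by
      rw [inv_le_comm₀ hm0 (by norm_num)]; norm_num; linarith
    linarith
  have h2 : (G.ell : ℝ) + 2 ≤ 11 * Real.log G.m := by
    have hl : Real.logb 2 G.m ≤ 1.5 * Real.log G.m := by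
      rw [Real.logb, div_le_iff₀ (Real.log_pos (by norm_num))]
      nlinarith [Real.log_two_gt_d9]
    have hl0 : 0 ≤ Real.logb 2 G.m := Real.logb_nonneg (by norm_num) hm.le
    have := Nat.ceil_lt_add_one hl0
    change (G.ell : ℝ) < _ at this
    linarith
  refine ⟨h1, h2, ?_⟩
  have hL : (0 : ℝ) < (G.ell : ℝ) + 2 := by positivity
  have hX : Real.log (200 * ((G.ell : ℝ) + 2) * √((G.vol Finset.univ : ℝ) / 2)) ≤
      609 * Real.log G.m := by
    have hsm : 0 < √((G.vol Finset.univ : ℝ) / 2) := Real.sqrt_pos.2 hm0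
    rw [Real.log_mul (by positivity) hsm.ne', Real.log_mul (by norm_num) hL.ne',
      Real.log_sqrt (show 0 ≤ (G.vol Finset.univ : ℝ) / 2 from hm0.le)]
    have e1 := Real.log_le_sub_one_of_pos (by norm_num : (0 : ℝ) < 200)
    have e2 := Real.log_le_sub_one_of_pos hL
    change _ + _ + Real.log G.m / 2 ≤ _
    linarith
  have hX0 : 0 ≤ 2 / φ ^ 2 *
      Real.log (200 * ((G.ell : ℝ) + 2) * √((G.vol Finset.univ : ℝ) / 2)) :=
    mul_nonneg (by positivity) (Real.log_pos (G.one_lt_log_arg hm.le)).le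
  have h3 := Nat.ceil_lt_add_one hX0
  change (G.tOne φ : ℝ) < _ at h3
  have h4 : 2 / φ ^ 2 * Real.log (200 * ((G.ell : ℝ) + 2) * √((G.vol Finset.univ : ℝ) / 2)) ≤
      2 / φ ^ 2 * (609 * Real.log G.m) := by gcongr
  have h5 : 1 ≤ 3 * Real.log G.m / φ ^ 2 := by
    rw [le_div_iff₀ (by positivity)]; nlinarith
  calc (G.tOne φ : ℝ) ≤ 2 / φ ^ 2 * (609 * Real.log G.m) + 3 * Real.log G.m / φ ^ 2 := by linarith
    _ = 1221 * Real.log G.m / φ ^ 2 := by ring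
    _ ≤ _ := by gcongr; norm_num

theorem tLast_le (G : LoopGraph n) (hm : 1 < G.m) {φ : ℝ} (hφ : 0 < φ) (hφ1 : φ < 1) :
    (G.tLast φ : ℝ) ≤ 14300 * Real.log G.m ^ 2 / φ ^ 2 := by
  obtain ⟨h1, h2, h3⟩ := G.param_bounds hm hφ hφ1
  have hl : (0 : ℝ) < Real.log G.m := by linarith
  rw [tLast]
  push_cast
  calc ((G.ell : ℝ) + 1) * G.tOne φ ≤ (11 * Real.log G.m) * (1300 * Real.log G.m / φ ^ 2) := by
        gcongr; linarith
    _ = _ := by ring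

theorem le_fOne (G : LoopGraph n) (hm : 1 < G.m) {φ : ℝ} (hφ : 0 < φ) (hφ1 : φ < 1) :
    1 / (280 * 11 * 14300) * (φ ^ 2 / Real.log G.m ^ 3) ≤ G.fOne φ := by
  obtain ⟨h1, h2, -⟩ := G.param_bounds hm hφ hφ1
  have h3 := G.tLast_le hm hφ hφ1
  have hl : (0 : ℝ) < Real.log G.m := by linarith
  have hT : (0 : ℝ) < G.tLast φ := by exact_mod_cast G.tLast_pos hm.le hφ
  have hL : (0 : ℝ) < (G.ell : ℝ) + 2 := by positivity
  unfold fOne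
  calc 1 / (280 * 11 * 14300) * (φ ^ 2 / Real.log G.m ^ 3)
      = 1 / (280 * (11 * Real.log G.m) * (14300 * Real.log G.m ^ 2 / φ ^ 2)) := by field_simp
    _ ≤ _ := by gcongr

/-! ### The guarantees for the output -/

theorem nibble_guarantees (G : LoopGraph n) (hd : ∀ u, 0 < G.deg u) (hm : 1 ≤ G.m) {φ : ℝ}
    (hφ : 0 < φ) (hφ1 : φ < 1) :
    (∀ (v : Fin n) (b : ℕ) (k : ℕ → ℕ) (C : Finset (Fin n)), G.Admissible φ b v k →
      G.NibbleOutput φ b v k C → C.Nonempty →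
      G.conductance C ≤ φ ∧ (G.vol C : ℝ) ≤ 5 / 6 * (G.vol Finset.univ : ℝ)) ∧
    (∀ S : Finset (Fin n), (G.vol S : ℝ) ≤ 2 / 3 * (G.vol Finset.univ : ℝ) →
      G.conductance S ≤ G.fOne φ →
      ∃ Sg : Finset (Fin n), Sg ⊆ S ∧
        (G.vol S : ℝ) / 2 ≤ (G.vol Sg : ℝ) ∧
        (∀ v ∈ Sg, ∀ (b : ℕ) (k : ℕ → ℕ) (C : Finset (Fin n)), G.Admissible φ b v k →
          G.NibbleOutput φ b v k C → C.Nonempty →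
          (2 : ℝ) ^ b / 2 ≤ (G.vol (C ∩ S) : ℝ)) ∧
        ∃ part : Fin (G.ell + 1) → Finset (Fin n),
          (∀ i j, i ≠ j → Disjoint (part i) (part j)) ∧
          Finset.univ.biUnion part = Sg ∧
          ∀ b : Fin (G.ell + 1), ∀ v ∈ part b, ∀ (k : ℕ → ℕ) (C : Finset (Fin n)),
            G.Admissible φ b v k → G.NibbleOutput φ b v k C → C.Nonempty) := by
  classical
  refine ⟨fun v b k C _ hout hC => ?_, fun S hSv hS => ⟨G.goodSet φ S, Finset.filter_subset _ _,
    G.half_vol_le_vol_goodSet hd φ hSv, fun v hv b k C _ hout hC => ?_, ?_⟩⟩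
  · rcases hout with ⟨t, -, -, -, j, -, -, hsc, rfl⟩ | ⟨-, rfl⟩
    · exact ⟨hsc.1, hsc.2.1⟩
    · simp at hC
  · rcases hout with ⟨t, -, ht, -, j, -, -, hsc, rfl⟩ | ⟨-, rfl⟩
    · exact G.half_le_vol_inter hd hm hφ hS hv ht hsc
    · simp at hC
  · have hex : ∀ v ∈ G.goodSet φ S, ∃ b : Fin (G.ell + 1), ¬ G.Fails φ b v := fun v hv => by
      obtain ⟨b, hb, hf⟩ := G.exists_not_fails hd hm hφ hφ1 hS hSv hv
      exact ⟨⟨b, Nat.lt_succ_of_le hb⟩, hf⟩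
    -- Any scale that does not fail may serve as the class of `v`, so the classes are the fibres of
    -- a choice function.
    choose! f hf using hex
    refine ⟨fun b => (G.goodSet φ S).filter fun v => f v = b, fun i j hij => ?_, ?_, ?_⟩
    · refine Finset.disjoint_left.2 fun v hi hj => hij ?_
      exact (Finset.mem_filter.1 hi).2.symm.trans (Finset.mem_filter.1 hj).2
    · ext v
      simp
    · intro b v hv k C hk hout
      obtain ⟨hv', rfl⟩ := Finset.mem_filter.1 hv
      have hnf := hf v hv'
      unfold Fails at hnf
      push Not at hnf
      obtain ⟨t, ht1, ht2, j, hj1, hj2, hsc⟩ := hnf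
      -- A larger search range may accept in another round, but an accepted set has volume at least
      -- `2 ^ b` and is not empty. The empty answer is excluded since every admissible range
      -- contains the survivors.
      rcases hout with ⟨t', -, -, -, j', -, -, hsc', rfl⟩ | ⟨hno, -⟩
      · by_contra hcon
        rw [Finset.not_nonempty_iff_eq_empty] at hcon
        have h1 := hsc'.2.2.1
        rw [hcon] at h1
        have : (0 : ℝ) < 2 ^ (f v : ℕ) := by positivity
        simp [vol] at h1
        linarith
      · exact absurd ⟨j, hj1, hj2.trans (hk t).1, hsc⟩ (hno t ht1 ht2)

end LoopGraph

/-! ### Reasoning about programs -/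

namespace RealRAM

/-- The program `c`, started in `s`, halts with a memory and a running time that satisfy `Q`. -/
def Runs (O : Oracle) (c : Cmd) (s : Store) (Q : Store → ℕ → Prop) : Prop :=
  ∃ s' T, Exec O c s s' T ∧ Q s' T

variable {O : Oracle} {c d : Cmd} {s : Store} {Q R : Store → ℕ → Prop}

theorem Runs.mono (h : Runs O c s Q) (hQR : ∀ s' T, Q s' T → R s' T) : Runs O c s R := by
  obtain ⟨s', T, he, hq⟩ := h
  exact ⟨s', T, he, hQR s' T hq⟩

theorem runs_skip : Runs O .skip s Q ↔ Q s 1 := by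
  refine ⟨?_, fun h => ⟨_, _, .skip s, h⟩⟩
  rintro ⟨_, _, ⟨⟩, h⟩
  exact h

theorem runs_setN {i : ℕ} {e : NExp} : Runs O (.setN i e) s Q ↔
    Q { s with nreg := Function.update s.nreg i (e.eval O s) } (e.cost + 1) := by
  refine ⟨?_, fun h => ⟨_, _, .setN i e s, h⟩⟩
  rintro ⟨_, _, ⟨⟩, h⟩
  exact h

theorem runs_setR {i : ℕ} {e : RExp} : Runs O (.setR i e) s Q ↔
    Q { s with rreg := Function.update s.rreg i (e.eval O s) } (e.cost + 1) := by
  refine ⟨?_, fun h => ⟨_, _, .setR i e s, h⟩⟩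
  rintro ⟨_, _, ⟨⟩, h⟩
  exact h

theorem runs_storeN {a : ℕ} {idx val : NExp} : Runs O (.storeN a idx val) s Q ↔
    Q { s with
      narr := Function.update s.narr a
        (Function.update (s.narr a) (idx.eval O s) (val.eval O s)) } (idx.cost + val.cost + 1) := by
  refine ⟨?_, fun h => ⟨_, _, .storeN a idx val s, h⟩⟩
  rintro ⟨_, _, ⟨⟩, h⟩
  exact h

theorem runs_storeR {a : ℕ} {idx : NExp} {val : RExp} : Runs O (.storeR a idx val) s Q ↔
    Q { s with
      rarr := Function.update s.rarr a
        (Function.update (s.rarr a) (idx.eval O s) (val.eval O s)) } (idx.cost + val.cost + 1) := by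
  refine ⟨?_, fun h => ⟨_, _, .storeR a idx val s, h⟩⟩
  rintro ⟨_, _, ⟨⟩, h⟩
  exact h

theorem runs_seq : Runs O (.seq c d) s Q ↔
    Runs O c s fun s' T => Runs O d s' fun s'' T' => Q s'' (T + T') := by
  constructor
  · rintro ⟨_, _, he, h⟩
    cases he with
    | seq h1 h2 => exact ⟨_, _, h1, _, _, h2, h⟩
  · rintro ⟨_, _, h1, _, _, h2, h⟩
    exact ⟨_, _, .seq h1 h2, h⟩

theorem runs_cond {g : BExp} : Runs O (.cond g c d) s Q ↔
    (g.Holds O s → Runs O c s fun s' T => Q s' (g.cost + T + 1)) ∧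
    (¬ g.Holds O s → Runs O d s fun s' T => Q s' (g.cost + T + 1)) := by
  constructor
  · rintro ⟨_, _, he, h⟩
    cases he with
    | condTrue hg h1 => exact ⟨fun _ => ⟨_, _, h1, h⟩, fun h' => absurd hg h'⟩
    | condFalse hg h1 => exact ⟨fun h' => absurd h' hg, fun _ => ⟨_, _, h1, h⟩⟩
  · rintro ⟨h1, h2⟩
    by_cases hg : g.Holds O s
    · obtain ⟨_, _, h3, h4⟩ := h1 hg
      exact ⟨_, _, .condTrue hg h3, h4⟩
    · obtain ⟨_, _, h3, h4⟩ := h2 hg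
      exact ⟨_, _, .condFalse hg h3, h4⟩

attribute [simp] runs_skip runs_setN runs_setR runs_storeN runs_storeR runs_seq runs_cond NExp.eval
  RExp.eval BExp.Holds NExp.cost RExp.cost BExp.cost

/-- Does the program assign to the natural-number register `i`? -/
def Cmd.modN : Cmd → ℕ → Bool
  | .setN j _, i => i == j
  | .seq c d, i => c.modN i || d.modN i
  | .cond _ c d, i => c.modN i || d.modN i
  | .loop _ c, i => c.modN i
  | _, _ => false

/-- Does the program assign to the real register `i`? -/
def Cmd.modR : Cmd → ℕ → Bool
  | .setR j _, i => i == j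
  | .seq c d, i => c.modR i || d.modR i
  | .cond _ c d, i => c.modR i || d.modR i
  | .loop _ c, i => c.modR i
  | _, _ => false

/-- Does the program write to the natural-number array `i`? -/
def Cmd.modNA : Cmd → ℕ → Bool
  | .storeN j _ _, i => i == j
  | .seq c d, i => c.modNA i || d.modNA i
  | .cond _ c d, i => c.modNA i || d.modNA i
  | .loop _ c, i => c.modNA i
  | _, _ => false

/-- Does the program write to the real array `i`? -/
def Cmd.modRA : Cmd → ℕ → Bool
  | .storeR j _ _, i => i == j
  | .seq c d, i => c.modRA i || d.modRA i
  | .cond _ c d, i => c.modRA i || d.modRA i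
  | .loop _ c, i => c.modRA i
  | _, _ => false

/-- The memories `s` and `s'` agree wherever `c` does not write. -/
structure Frame (c : Cmd) (s s' : Store) : Prop where
  n : ∀ i, c.modN i = false → s'.nreg i = s.nreg i
  r : ∀ i, c.modR i = false → s'.rreg i = s.rreg i
  na : ∀ i, c.modNA i = false → s'.narr i = s.narr i
  ra : ∀ i, c.modRA i = false → s'.rarr i = s.rarr i

theorem Frame.refl (c : Cmd) (s : Store) : Frame c s s :=
  ⟨fun _ _ => rfl, fun _ _ => rfl, fun _ _ => rfl, fun _ _ => rfl⟩

theorem Frame.trans {c : Cmd} {s s' s'' : Store} (h : Frame c s s') (h' : Frame c s' s'') :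
    Frame c s s'' :=
  ⟨fun i hi => (h'.n i hi).trans (h.n i hi), fun i hi => (h'.r i hi).trans (h.r i hi),
    fun i hi => (h'.na i hi).trans (h.na i hi), fun i hi => (h'.ra i hi).trans (h.ra i hi)⟩

theorem Exec.frame {c : Cmd} {s s' : Store} {T : ℕ} (h : Exec O c s s' T) : Frame c s s' := by
  induction h with
  | skip s => exact Frame.refl _ _
  | setN i e s =>
    refine ⟨fun j hj => ?_, fun _ _ => rfl, fun _ _ => rfl, fun _ _ => rfl⟩
    exact Function.update_of_ne (by simpa [Cmd.modN] using hj) _ _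
  | setR i e s =>
    refine ⟨fun _ _ => rfl, fun j hj => ?_, fun _ _ => rfl, fun _ _ => rfl⟩
    exact Function.update_of_ne (by simpa [Cmd.modR] using hj) _ _
  | storeN a idx val s =>
    refine ⟨fun _ _ => rfl, fun _ _ => rfl, fun j hj => ?_, fun _ _ => rfl⟩
    exact Function.update_of_ne (by simpa [Cmd.modNA] using hj) _ _
  | storeR a idx val s =>
    refine ⟨fun _ _ => rfl, fun _ _ => rfl, fun _ _ => rfl, fun j hj => ?_⟩
    exact Function.update_of_ne (by simpa [Cmd.modRA] using hj) _ _
  | seq _ _ ih1 ih2 =>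
    refine ⟨fun i hi => ?_, fun i hi => ?_, fun i hi => ?_, fun i hi => ?_⟩
    · simp only [Cmd.modN, Bool.or_eq_false_iff] at hi
      exact (ih2.n i hi.2).trans (ih1.n i hi.1)
    · simp only [Cmd.modR, Bool.or_eq_false_iff] at hi
      exact (ih2.r i hi.2).trans (ih1.r i hi.1)
    · simp only [Cmd.modNA, Bool.or_eq_false_iff] at hi
      exact (ih2.na i hi.2).trans (ih1.na i hi.1)
    · simp only [Cmd.modRA, Bool.or_eq_false_iff] at hi
      exact (ih2.ra i hi.2).trans (ih1.ra i hi.1)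
  | condTrue _ _ ih =>
    refine ⟨fun i hi => ih.n i ?_, fun i hi => ih.r i ?_, fun i hi => ih.na i ?_,
      fun i hi => ih.ra i ?_⟩
    · simp only [Cmd.modN, Bool.or_eq_false_iff] at hi; exact hi.1
    · simp only [Cmd.modR, Bool.or_eq_false_iff] at hi; exact hi.1
    · simp only [Cmd.modNA, Bool.or_eq_false_iff] at hi; exact hi.1
    · simp only [Cmd.modRA, Bool.or_eq_false_iff] at hi; exact hi.1
  | condFalse _ _ ih =>
    refine ⟨fun i hi => ih.n i ?_, fun i hi => ih.r i ?_, fun i hi => ih.na i ?_,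
      fun i hi => ih.ra i ?_⟩
    · simp only [Cmd.modN, Bool.or_eq_false_iff] at hi; exact hi.2
    · simp only [Cmd.modR, Bool.or_eq_false_iff] at hi; exact hi.2
    · simp only [Cmd.modNA, Bool.or_eq_false_iff] at hi; exact hi.2
    · simp only [Cmd.modRA, Bool.or_eq_false_iff] at hi; exact hi.2
  | loopStop _ => exact Frame.refl _ _
  | loopStep _ _ _ ih1 ih2 =>
    exact Frame.trans ⟨ih1.n, ih1.r, ih1.na, ih1.ra⟩ ih2

theorem Runs.frame (h : Runs O c s Q) : Runs O c s fun s' T => Q s' T ∧ Frame c s s' := by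
  obtain ⟨s', T, he, hq⟩ := h
  exact ⟨s', T, he, hq, he.frame⟩

/-- Loops: `Inv` is an invariant and every pass is paid for by a decrease of the potential `μ`. -/
theorem runs_loop {g : BExp} (Inv : Store → Prop) (μ : Store → ℕ)
    (hbody : ∀ s', Frame c s s' → Inv s' → g.Holds O s' →
      Runs O c s' fun s'' T => Inv s'' ∧ T + g.cost + 1 + μ s'' ≤ μ s')
    (h : Inv s) : Runs O (.loop g c) s fun s' T =>
      (Inv s' ∧ ¬ g.Holds O s' ∧ T ≤ μ s + g.cost + 1) ∧ Frame (.loop g c) s s' := by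
  refine Runs.frame ?_
  -- Each pass costs at least one unit for the guard, so the potential strictly decreases. Induction
  -- on a bound for it yields termination and the time bound together.
  have key : ∀ N s', μ s' ≤ N → Frame c s s' → Inv s' → Runs O (.loop g c) s' fun s'' T =>
      Inv s'' ∧ ¬ g.Holds O s'' ∧ T ≤ μ s' + g.cost + 1 := by
    intro N
    induction N with
    | zero =>
      intro s' hN hf hi
      by_cases hg : g.Holds O s'
      · obtain ⟨s'', T, -, -, hT⟩ := hbody s' hf hi hg
        omega
      · exact ⟨_, _, .loopStop hg, hi, hg, by omega⟩
    | succ N ih =>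
      intro s' hN hf hi
      by_cases hg : g.Holds O s'
      · obtain ⟨s'', T, he, hi', hT⟩ := hbody s' hf hi hg
        obtain ⟨s3, T3, he3, h3, h3', hT3⟩ := ih s'' (by omega) (hf.trans he.frame) hi'
        exact ⟨_, _, .loopStep hg he he3, h3, h3', by omega⟩
      · exact ⟨_, _, .loopStop hg, hi, hg, by omega⟩
  exact key _ s le_rfl (Frame.refl _ _) h

/-! ### Enumerations stored in arrays -/

variable {n : ℕ}

/-- The first `k` entries of `a` list the vertices that satisfy `P`, without repetitions. -/
structure Enum (n : ℕ) (a : ℕ → ℕ) (k : ℕ) (P : Fin n → Prop) : Prop where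
  inj : ∀ i < k, ∀ j < k, a i = a j → i = j
  get : ∀ i < k, ∃ u, P u ∧ a i = (u : ℕ)
  mem : ∀ u, P u → ∃ i < k, a i = (u : ℕ)

theorem Enum.nil (a : ℕ → ℕ) {P : Fin n → Prop} (h : ∀ u, ¬ P u) : Enum n a 0 P :=
  ⟨fun i hi => absurd hi (Nat.not_lt_zero i), fun i hi => absurd hi (Nat.not_lt_zero i),
    fun u hu => absurd hu (h u)⟩

theorem Enum.congr {a a' : ℕ → ℕ} {k : ℕ} {P P' : Fin n → Prop} (h : Enum n a k P)
    (ha : ∀ i < k, a' i = a i) (hP : ∀ u, P' u ↔ P u) : Enum n a' k P' := by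
  refine ⟨fun i hi j hj hij => h.inj i hi j hj ?_, fun i hi => ?_, fun u hu => ?_⟩
  · rwa [← ha i hi, ← ha j hj]
  · obtain ⟨u, hu, e⟩ := h.get i hi
    exact ⟨u, (hP u).2 hu, (ha i hi).trans e⟩
  · obtain ⟨i, hi, e⟩ := h.mem u ((hP u).1 hu)
    exact ⟨i, hi, (ha i hi).trans e⟩

theorem Enum.push {a : ℕ → ℕ} {k : ℕ} {P P' : Fin n → Prop} (h : Enum n a k P) {w : Fin n}
    (hw : ¬ P w) (hP : ∀ u, P' u ↔ P u ∨ u = w) :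
    Enum n (Function.update a k (w : ℕ)) (k + 1) P' := by
  have hlt : ∀ i < k, Function.update a k (w : ℕ) i = a i := fun i hi =>
    Function.update_of_ne hi.ne _ _
  have hk : Function.update a k (w : ℕ) k = w := Function.update_self _ _ _
  have hne : ∀ i < k, a i ≠ w := fun i hi he => by
    obtain ⟨u, hu, e⟩ := h.get i hi
    exact hw (Fin.ext (e.symm.trans he) ▸ hu)
  refine ⟨fun i hi j hj hij => ?_, fun i hi => ?_, fun u hu => ?_⟩
  · rcases Nat.lt_succ_iff_lt_or_eq.1 hi with hi | rfl <;>
      rcases Nat.lt_succ_iff_lt_or_eq.1 hj with hj | rfl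
    · rw [hlt i hi, hlt j hj] at hij
      exact h.inj i hi j hj hij
    · rw [hlt i hi, hk] at hij
      exact absurd hij (hne i hi)
    · rw [hlt j hj, hk] at hij
      exact absurd hij.symm (hne j hj)
    · rfl
  · rcases Nat.lt_succ_iff_lt_or_eq.1 hi with hi | rfl
    · obtain ⟨u, hu, e⟩ := h.get i hi
      exact ⟨u, (hP u).2 (Or.inl hu), (hlt i hi).trans e⟩
    · exact ⟨w, (hP w).2 (Or.inr rfl), hk⟩
  · rcases (hP u).1 hu with hu | rfl
    · obtain ⟨i, hi, e⟩ := h.mem u hu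
      exact ⟨i, by omega, (hlt i hi).trans e⟩
    · exact ⟨k, by omega, hk⟩

/-- Sums over an enumeration. -/
theorem Enum.sum_eq {M : Type*} [AddCommMonoid M] {a : ℕ → ℕ} {k : ℕ} {P : Fin n → Prop}
    [DecidablePred P] (h : Enum n a k P) (f : ℕ → M) :
    ∑ i ∈ Finset.range k, f (a i) = ∑ u with P u, f (u : ℕ) := by
  refine Finset.sum_bij' (i := fun i hi => (h.get i (Finset.mem_range.1 hi)).choose)
    (j := fun u hu => (h.mem u (Finset.mem_filter.1 hu).2).choose) ?_ ?_ ?_ ?_ ?_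
  · intro i hi
    exact Finset.mem_filter.2 ⟨Finset.mem_univ _, (h.get i (Finset.mem_range.1 hi)).choose_spec.1⟩
  · intro u hu
    exact Finset.mem_range.2 (h.mem u (Finset.mem_filter.1 hu).2).choose_spec.1
  · intro i hi
    have h1 := (h.get i (Finset.mem_range.1 hi)).choose_spec
    have h2 := (h.mem _ h1.1).choose_spec
    exact h.inj _ h2.1 _ (Finset.mem_range.1 hi) (h2.2.trans h1.2.symm)
  · intro u hu
    have h1 := (h.mem u (Finset.mem_filter.1 hu).2).choose_spec
    have h2 := (h.get _ h1.1).choose_spec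
    exact Fin.ext (h2.2.symm.trans h1.2)
  · intro i hi
    exact congrArg f (h.get i (Finset.mem_range.1 hi)).choose_spec.2

theorem Enum.card_eq {a : ℕ → ℕ} {k : ℕ} {P : Fin n → Prop} [DecidablePred P]
    (h : Enum n a k P) : k = (Finset.univ.filter P).card := by
  have := h.sum_eq (fun _ => 1)
  simpa using this

end RealRAM

/-! ### Access to the graph -/

namespace LoopGraph

variable {n : ℕ}

theorem sum_range_getD {α M : Type*} [AddCommMonoid M] (l : List α) (d : α) (g : α → M) :
    ∑ i ∈ Finset.range l.length, g (l.getD i d) = (l.map g).sum := by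
  induction l with
  | nil => simp
  | cons a l ih =>
    rw [List.length_cons, Finset.sum_range_succ', List.map_cons, List.sum_cons, ← ih, add_comm]
    simp

/-- The `i`-th neighbour of `u`. -/
def nb (adj : Fin n → List (Fin n)) (u : Fin n) (i : ℕ) : Fin n := (adj u).getD i u

theorem sum_nb {G : LoopGraph n} {adj : Fin n → List (Fin n)} (h : G.IsAdjList adj) {M : Type*}
    [AddCommMonoid M] (u : Fin n) (g : Fin n → M) :
    ∑ i ∈ Finset.range (adj u).length, g (nb adj u i) = ∑ w, G.mult u w • g w := by
  unfold nb
  rw [sum_range_getD, Finset.sum_list_map_count]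
  simp only [← h u]
  refine Finset.sum_subset (Finset.subset_univ _) fun w _ hw => ?_
  rw [List.count_eq_zero_of_not_mem (by simpa using hw), zero_smul]

theorem length_adj {G : LoopGraph n} {adj : Fin n → List (Fin n)} (h : G.IsAdjList adj)
    (u : Fin n) : (adj u).length = G.deg u := by
  have := sum_nb h u (fun _ => 1)
  simpa [G.deg_eq_sum_mult u] using this

theorem oracle_deg {G : LoopGraph n} {adj : Fin n → List (Fin n)} (h : G.IsAdjList adj)
    (u : Fin n) : (oracle adj).deg u = G.deg u := by
  simp [oracle, length_adj h]

theorem oracle_nbr {G : LoopGraph n} {adj : Fin n → List (Fin n)} (h : G.IsAdjList adj)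
    (u : Fin n) {i : ℕ} (hi : i < G.deg u) : (oracle adj).nbr u i = nb adj u i := by
  rw [← length_adj h u] at hi
  simp [oracle, nb, hi]

end LoopGraph

/-! ### Spreading the mass along the edges -/

namespace Nibble

open LoopGraph RealRAM

variable {n : ℕ}

/-- Add real register `5` to entry `w` of the new vector, for the vertex `w` in register `13`. -/
def touch : Cmd :=
  .cond (.and (.leN (.arr 3 (.reg 13)) (.reg 8)) (.leN (.reg 8) (.arr 3 (.reg 13))))
    (.storeR 1 (.reg 13) (.add (.arr 1 (.reg 13)) (.reg 5)))
    (.seq (.storeN 3 (.reg 13) (.reg 8)) <|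
      .seq (.storeR 1 (.reg 13) (.reg 5)) <|
      .seq (.storeN 2 (.reg 14) (.reg 13)) <|
      .setN 14 (.add (.reg 14) (.lit 1)))

/-- The memory holds the vector `f` in real array `1`, on the vertices listed in array `2`, whose
entries of array `3` are equal to the number of the round. -/
structure Holds (n : ℕ) (s : Store) (f : Fin n → ℝ) : Prop where
  enum : Enum n (s.narr 2) (s.nreg 14) fun w => s.narr 3 w = s.nreg 8
  val : ∀ w : Fin n, (if s.narr 3 w = s.nreg 8 then s.rarr 1 w else 0) = f w
  le : ∀ w : Fin n, s.narr 3 w ≤ s.nreg 8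

theorem Holds.congr {s s' : Store} {f : Fin n → ℝ} (h : Holds n s f)
    (h2 : s'.narr 2 = s.narr 2) (h3 : s'.narr 3 = s.narr 3) (h8 : s'.nreg 8 = s.nreg 8)
    (h14 : s'.nreg 14 = s.nreg 14) (h1 : s'.rarr 1 = s.rarr 1) : Holds n s' f := by
  refine ⟨?_, ?_, ?_⟩
  · rw [h2, h3, h8, h14]; exact h.enum
  · rw [h3, h8, h1]; exact h.val
  · rw [h3, h8]; exact h.le

/-- Memory layout of a round: array `1` and real array `0` list the vertices and values of the
truncated vector, with length in register `9`. Real array `1` is indexed by vertices and holds the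
new vector; array `2` lists its touched vertices, with length in register `14`. A cell is valid only
if its stamp in array `3` is the round number in register `8`, so an untouched cell is overwritten
and a touched one increased. -/
theorem touch_spec (O : Oracle) {s : Store} {f : Fin n → ℝ} (h : Holds n s f) {w : Fin n}
    (hw : s.nreg 13 = w) : Runs O touch s fun s' T => (T ≤ 30 ∧
      Holds n s' (fun u => f u + if u = w then s.rreg 5 else 0) ∧
      s'.nreg 14 ≤ s.nreg 14 + 1) ∧ Frame touch s s' := by
  refine Runs.frame ?_
  have hwi : ∀ u : Fin n, (u : ℕ) = (w : ℕ) ↔ u = w := fun u => Fin.ext_iff.symm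
  rw [touch, runs_cond]
  simp only [BExp.Holds, NExp.eval, hw]
  constructor
  · rintro ⟨h1, h2⟩
    have he : s.narr 3 w = s.nreg 8 := le_antisymm h1 h2
    simp only [runs_storeR, BExp.cost, NExp.cost, RExp.cost, NExp.eval, RExp.eval, hw]
    refine ⟨by norm_num, ⟨by simpa using h.enum, fun u => ?_, by simpa using h.le⟩, by simp⟩
    have hv := h.val u
    by_cases huw : u = w
    · subst huw
      simp only [he, if_true] at hv
      simp [he, hv]
    · have : (u : ℕ) ≠ w := fun hc => huw ((hwi u).1 hc)
      simp only [Function.update_self, Function.update_of_ne this, huw, if_false, add_zero]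
      exact hv
  · intro hg
    have hne : s.narr 3 w ≠ s.nreg 8 := by
      intro he
      exact hg ⟨he.le, he.ge⟩
    have hfw : f w = 0 := by rw [← h.val w, if_neg hne]
    simp only [runs_seq, runs_storeR, runs_storeN, runs_setN, BExp.cost, NExp.cost, RExp.cost,
      NExp.eval, RExp.eval, hw]
    refine ⟨by norm_num, ⟨?_, fun u => ?_, fun u => ?_⟩, by simp⟩
    · have := h.enum.push hne (P' := fun u => s.narr 3 u = s.nreg 8 ∨ u = w) fun u => Iff.rfl
      refine (this.congr (fun _ _ => rfl) fun u => ?_ : Enum n _ (s.nreg 14 + 1) _)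
      by_cases huw : u = w
      · subst huw; simp
      · have : (u : ℕ) ≠ w := fun hc => huw ((hwi u).1 hc)
        simp [Function.update_of_ne this, huw]
    · have hv := h.val u
      by_cases huw : u = w
      · subst huw
        simp [hfw]
      · have : (u : ℕ) ≠ w := fun hc => huw ((hwi u).1 hc)
        simpa [Function.update_of_ne this, huw] using hv
    · by_cases huw : u = w
      · subst huw; simp
      · have : (u : ℕ) ≠ w := fun hc => huw ((hwi u).1 hc)
        simpa [Function.update_of_ne this] using h.le u

/-- Give the share in real register `5` to all neighbours of the vertex in register `11`. -/
def spreadEdges : Cmd :=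
  .loop (.not (.leN (.deg (.reg 11)) (.reg 12)))
    (.seq (.setN 13 (.nbr (.reg 11) (.reg 12))) <|
      .seq touch <|
      .setN 12 (.add (.reg 12) (.lit 1)))

theorem spreadEdges_spec {G : LoopGraph n} {adj : Fin n → List (Fin n)} (hadj : G.IsAdjList adj)
    {s : Store} {f : Fin n → ℝ} (h : Holds n s f) {u : Fin n} (hu : s.nreg 11 = u)
    (h12 : s.nreg 12 = 0) : Runs (oracle adj) spreadEdges s fun s' T =>
      (T ≤ 50 * G.deg u + 6 ∧ Holds n s' (fun w => f w + (G.mult u w : ℝ) * s.rreg 5) ∧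
      s'.nreg 14 ≤ s.nreg 14 + G.deg u) ∧ Frame spreadEdges s s' := by
  set O := oracle adj with hO
  have hdeg : O.deg u = G.deg u := oracle_deg hadj u
  refine Runs.mono (runs_loop (O := O) (fun s' => s'.nreg 12 ≤ G.deg u ∧
    s'.nreg 14 ≤ s.nreg 14 + s'.nreg 12 ∧
    Holds n s' (fun w => f w + ∑ i ∈ Finset.range (s'.nreg 12),
      if w = nb adj u i then s.rreg 5 else 0))
    (fun s' => 50 * (G.deg u - s'.nreg 12)) ?_ ?_) ?_
  · rintro s' hfr ⟨hk, hc, hh⟩ hg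
    have h11 : s'.nreg 11 = u := (hfr.n 11 rfl).trans hu
    have h5 : s'.rreg 5 = s.rreg 5 := hfr.r 5 rfl
    simp only [BExp.Holds, NExp.eval, h11, hdeg, not_le] at hg
    rw [runs_seq, runs_setN]
    simp only [NExp.eval, h11, runs_seq]
    rw [hO, oracle_nbr hadj u hg, ← hO]
    refine Runs.mono (touch_spec O (w := nb adj u (s'.nreg 12))
      (f := fun w => f w + ∑ i ∈ Finset.range (s'.nreg 12), if w = nb adj u i then s.rreg 5 else 0)
      ?_ ?_) ?_
    · exact hh.congr rfl rfl (by simp) (by simp) rfl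
    · simp
    rintro s'' T ⟨⟨hT, hh', hc'⟩, hfr'⟩
    have e12 : s''.nreg 12 = s'.nreg 12 := by rw [hfr'.n 12 rfl]; simp
    simp only [runs_setN, NExp.eval, NExp.cost, BExp.cost, e12, Function.update_self,
      Function.update_of_ne (show (14 : ℕ) ≠ 12 by decide)]
    refine ⟨⟨hg, ?_, ?_⟩, ?_⟩
    · simp at hc'; omega
    · refine Holds.congr (s := s'') ?_ rfl rfl (by simp) (by simp) rfl
      convert hh' using 1
      funext w
      simp only
      rw [Finset.sum_range_succ, add_assoc, h5]
    · omega
  · simp only [h12, Finset.range_zero, Finset.sum_empty, add_zero]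
    exact ⟨Nat.zero_le _, le_rfl, h⟩
  · rintro s' T ⟨⟨⟨hk, hc, hh⟩, hg, hT⟩, hfr⟩
    have h11 : s'.nreg 11 = u := (hfr.n 11 rfl).trans hu
    simp only [BExp.Holds, NExp.eval, h11, hdeg, not_not] at hg
    have hkd : s'.nreg 12 = G.deg u := le_antisymm hk hg
    refine ⟨⟨?_, ?_, ?_⟩, hfr⟩
    · have e : (BExp.not (.leN (.deg (.reg 11)) (.reg 12))).cost = 5 := rfl
      simp only [e, h12] at hT; omega
    · convert hh using 1
      funext w
      rw [hkd, ← length_adj hadj u, sum_nb hadj u (fun x => if w = x then s.rreg 5 else 0)]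
      simp
    · omega

/-- Spread the mass of the vertex with index register `10`. -/
def spreadVertex : Cmd :=
  .seq (.setN 11 (.arr 1 (.reg 10))) <|
  .seq (.setN 13 (.reg 11)) <|
  .seq (.setR 5 (.div (.arr 0 (.reg 10)) (.ofNat (.lit 2)))) <|
  .seq touch <|
  .seq (.setR 5 (.div (.reg 5) (.ofNat (.deg (.reg 11))))) <|
  .seq (.setN 12 (.lit 0)) <|
  .seq spreadEdges <|
  .setN 10 (.add (.reg 10) (.lit 1))

theorem spreadVertex_spec {G : LoopGraph n} {adj : Fin n → List (Fin n)} (hadj : G.IsAdjList adj)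
    {s : Store} {f : Fin n → ℝ} (h : Holds n s f) {u : Fin n} (hu : s.narr 1 (s.nreg 10) = u) :
    Runs (oracle adj) spreadVertex s fun s' T =>
      (T ≤ 50 * G.deg u + 80 ∧ Holds n s' (fun w => f w + ((if w = u then
        s.rarr 0 (s.nreg 10) / 2 else 0) +
        (G.mult u w : ℝ) * (s.rarr 0 (s.nreg 10) / 2 / G.deg u))) ∧
      s'.nreg 14 ≤ s.nreg 14 + (1 + G.deg u) ∧ s'.nreg 10 = s.nreg 10 + 1) ∧
      Frame spreadVertex s s' := by
  refine Runs.frame ?_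
  rw [spreadVertex]
  simp only [runs_seq, runs_setN, runs_setR, NExp.eval, RExp.eval, NExp.cost, RExp.cost, hu,
    Function.update_self, Function.update_of_ne (show (10 : ℕ) ≠ 11 by decide),
    Function.update_of_ne (show (10 : ℕ) ≠ 13 by decide)]
  refine Runs.mono (touch_spec _ (f := f) (w := u) ?_ ?_) ?_
  · exact h.congr rfl rfl (by simp) (by simp) rfl
  · simp
  rintro s1 T1 ⟨⟨hT1, hh1, hc1⟩, hf1⟩
  have e11 : s1.nreg 11 = u := by rw [hf1.n 11 rfl]; simp
  have e5 : s1.rreg 5 = s.rarr 0 (s.nreg 10) / 2 := by rw [hf1.r 5 rfl]; simp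
  have e10 : s1.nreg 10 = s.nreg 10 := by rw [hf1.n 10 rfl]; simp
  simp only [Function.update_self] at hh1
  refine Runs.mono (spreadEdges_spec hadj (u := u)
    (f := fun w => f w + if w = u then s.rarr 0 (s.nreg 10) / ((2 : ℕ) : ℝ) else 0) ?_ ?_ ?_) ?_
  · exact hh1.congr rfl rfl (by simp) (by simp) rfl
  · simpa using e11
  · simp
  rintro s2 T2 ⟨⟨hT2, hh2, hc2⟩, hf2⟩
  have e10' : s2.nreg 10 = s.nreg 10 := by rw [hf2.n 10 rfl]; simpa using e10
  simp only [Function.update_self, Nat.cast_ofNat] at hh2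
  refine ⟨by omega, ?_, ?_, by simp [e10']⟩
  · refine Holds.congr (s := s2) ?_ rfl rfl (by simp) (by simp) rfl
    convert hh2 using 1
    funext w
    rw [e11, e5, oracle_deg hadj]
    ring
  · simp at hc1 hc2 ⊢
    omega

/-- Replace the vector by its image under the walk. -/
def spread : Cmd :=
  .seq (.setN 14 (.lit 0)) <|
  .seq (.setN 10 (.lit 0)) <|
  .loop (.not (.leN (.reg 9) (.reg 10))) spreadVertex

/-- The memory holds the vector `r` as a list of its nonzero entries. -/
structure Sparse (n : ℕ) (s : Store) (r : Fin n → ℝ) : Prop where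
  enum : Enum n (s.narr 1) (s.nreg 9) fun u => r u ≠ 0
  val : ∀ i < s.nreg 9, ∀ u : Fin n, s.narr 1 i = u → s.rarr 0 i = r u

open Classical in
/-- The volume of the support of a vector. -/
noncomputable def suppVol (G : LoopGraph n) (r : Fin n → ℝ) : ℕ :=
  G.vol (Finset.univ.filter fun u => r u ≠ 0)

theorem spread_spec {G : LoopGraph n} (hd : ∀ u, 0 < G.deg u) {adj : Fin n → List (Fin n)}
    (hadj : G.IsAdjList adj) {s : Store} {r : Fin n → ℝ} (h : Sparse n s r)
    (hst : ∀ w : Fin n, s.narr 3 w < s.nreg 8) :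
    Runs (oracle adj) spread s fun s' T => (T ≤ 150 * suppVol G r + 20 ∧
      Holds n s' (G.walkMatrix.mulVec r) ∧ s'.nreg 14 ≤ 2 * suppVol G r) ∧ Frame spread s s' := by
  classical
  refine Runs.frame ?_
  set O := oracle adj with hO
  have hdeg : ∀ u : Fin n, O.deg u = G.deg u := oracle_deg hadj
  -- The contribution of one source vertex, extended by `0` to all natural numbers, so that
  -- `Enum.sum_eq` can turn the sum over the list into a sum over vertices.
  set g : ℕ → Fin n → ℝ := fun x w => if hx : x < n then
    ((if w = ⟨x, hx⟩ then r ⟨x, hx⟩ / 2 else 0) +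
      (G.mult ⟨x, hx⟩ w : ℝ) * (r ⟨x, hx⟩ / 2 / G.deg ⟨x, hx⟩)) else 0 with hg
  have hgu : ∀ (u w : Fin n), g u w = (if w = u then r u / 2 else 0) +
      (G.mult u w : ℝ) * (r u / 2 / G.deg u) := fun u w => by simp [hg]
  set D : ℕ → ℕ := fun i => ∑ a ∈ Finset.range i, O.deg (s.narr 1 a) with hD
  have hDk : D (s.nreg 9) = suppVol G r := by
    rw [hD]
    simp only
    rw [h.enum.sum_eq O.deg, suppVol, vol]
    exact Finset.sum_congr rfl fun u _ => hdeg u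
  have hkD : ∀ i ≤ s.nreg 9, i ≤ D i := by
    intro i hi
    calc i = ∑ a ∈ Finset.range i, 1 := by simp
      _ ≤ D i := Finset.sum_le_sum fun a ha => by
          obtain ⟨u, -, hu⟩ := h.enum.get a ((Finset.mem_range.1 ha).trans_le hi)
          rw [hu, hdeg]; exact hd u
  have hDmono : ∀ i ≤ s.nreg 9, D i ≤ D (s.nreg 9) := fun i hi =>
    Finset.sum_le_sum_of_subset (Finset.range_mono hi)
  rw [spread, runs_seq, runs_setN, runs_seq, runs_setN]
  simp only [NExp.eval, NExp.cost]
  refine (runs_loop (O := O) (fun s' => s'.nreg 10 ≤ s.nreg 9 ∧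
    s'.nreg 14 ≤ s'.nreg 10 + D (s'.nreg 10) ∧
    Holds n s' (fun w => ∑ a ∈ Finset.range (s'.nreg 10), g (s.narr 1 a) w))
    (fun s' => (100 * s.nreg 9 + 50 * D (s.nreg 9)) - (100 * s'.nreg 10 + 50 * D (s'.nreg 10)))
    ?_ ?_).mono ?_
  · rintro s' hfr ⟨hi, hc, hh⟩ hgd
    have e9 : s'.nreg 9 = s.nreg 9 := by rw [hfr.n 9 rfl]; simp
    have e1 : s'.narr 1 = s.narr 1 := hfr.na 1 rfl
    have e0 : s'.rarr 0 = s.rarr 0 := hfr.ra 0 rfl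
    simp only [BExp.Holds, NExp.eval, e9, not_le] at hgd
    obtain ⟨u, -, hu⟩ := h.enum.get _ hgd
    have hr := h.val _ hgd u hu
    refine (spreadVertex_spec hadj hh (u := u) (by rw [e1, hu])).mono ?_
    rintro s'' T ⟨⟨hT, hh', hc', h10⟩, -⟩
    have hDs : D (s'.nreg 10 + 1) = D (s'.nreg 10) + G.deg u := by
      rw [hD]; simp only; rw [Finset.sum_range_succ, hu, hdeg]
    rw [e0, hr] at hh'
    have hm := hDmono _ (Nat.succ_le_of_lt hgd)
    rw [Nat.succ_eq_add_one, hDs] at hm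
    refine ⟨⟨by omega, ?_, ?_⟩, ?_⟩
    · rw [h10, hDs]; omega
    · rw [h10]
      convert hh' using 1
      funext w
      rw [Finset.sum_range_succ, hu, hgu]
    · rw [h10, hDs]; simp only [BExp.cost, NExp.cost]; omega
  · have hst' : ∀ w : Fin n, s.narr 3 w ≠ s.nreg 8 := fun w => (hst w).ne
    refine ⟨by simp, by simp, ⟨?_, ?_, ?_⟩⟩
    · exact Enum.nil _ hst'
    · intro w
      simp [hst' w]
    · intro w
      simpa using (hst w).le
  · rintro s' T ⟨⟨⟨hi, hc, hh⟩, hgd, hT⟩, hfr⟩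
    have e9 : s'.nreg 9 = s.nreg 9 := by rw [hfr.n 9 rfl]; simp
    simp only [BExp.Holds, NExp.eval, e9, not_not] at hgd
    have hie : s'.nreg 10 = s.nreg 9 := le_antisymm hi hgd
    have hk := hkD _ le_rfl
    rw [hDk] at hk hT
    refine ⟨?_, ?_, ?_⟩
    · simp only [BExp.cost, NExp.cost] at hT
      have : D 0 = 0 := by simp [hD]
      simp only [Function.update_self, this] at hT
      omega
    · convert hh using 1
      funext w
      rw [hie, h.enum.sum_eq (fun x => g x w), walk_apply]
      simp only [hgu]
      have e1 : ∑ x, (G.mult x w : ℝ) * (r x / 2 / G.deg x) =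
          (∑ x, (G.mult w x : ℝ) * (r x / G.deg x)) / 2 := by
        rw [Finset.sum_div]
        refine Finset.sum_congr rfl fun u _ => ?_
        rw [G.mult_symm u w]
        ring
      have e2 : ∑ x with r x ≠ 0, ((if w = x then r x / 2 else 0) +
          (G.mult x w : ℝ) * (r x / 2 / G.deg x)) = ∑ x, ((if w = x then r x / 2 else 0) +
          (G.mult x w : ℝ) * (r x / 2 / G.deg x)) := by
        refine Finset.sum_filter_of_ne fun u _ hu hr => hu ?_
        simp [hr]
      rw [e2, Finset.sum_add_distrib, e1]
      simp only [Finset.sum_ite_eq, Finset.mem_univ, if_true]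
      ring
    · rw [hie, hDk] at hc; omega

/-! ### Truncation -/

/-- Keep the vertex with index register `10` in the touched list, if its entry is large. -/
def filterVertex : Cmd :=
  .seq (.setN 13 (.arr 2 (.reg 10))) <|
  .seq (.cond (.leR (.mul (.ofNat (.deg (.reg 13))) (.reg 2)) (.arr 1 (.reg 13)))
    (.seq (.storeN 1 (.reg 9) (.reg 13)) <|
      .seq (.storeR 0 (.reg 9) (.arr 1 (.reg 13))) <|
      .setN 9 (.add (.reg 9) (.lit 1))) .skip) <|
  .setN 10 (.add (.reg 10) (.lit 1))

/-- Truncate the vector. -/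
def truncate : Cmd :=
  .seq (.setN 9 (.lit 0)) <|
  .seq (.setN 10 (.lit 0)) <|
  .loop (.not (.leN (.reg 14) (.reg 10))) filterVertex

theorem truncate_spec {G : LoopGraph n} (hd : ∀ u, 0 < G.deg u) {adj : Fin n → List (Fin n)}
    (hadj : G.IsAdjList adj) {s : Store} {q : Fin n → ℝ} (h : Holds n s q) (hε : 0 < s.rreg 2) :
    Runs (oracle adj) truncate s fun s' T => (T ≤ 50 * s.nreg 14 + 20 ∧
      Sparse n s' (G.trunc (s.rreg 2) q)) ∧ Frame truncate s s' := by
  refine Runs.frame ?_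
  set O := oracle adj with hO
  set ε := s.rreg 2 with hεdef
  have hdeg : ∀ u : Fin n, O.deg u = G.deg u := oracle_deg hadj
  have hq : ∀ u : Fin n, s.narr 3 u = s.nreg 8 → s.rarr 1 u = q u := fun u hu => by
    have := h.val u; rwa [if_pos hu] at this
  rw [truncate, runs_seq, runs_setN, runs_seq, runs_setN]
  simp only [NExp.eval, NExp.cost]
  refine Runs.mono (runs_loop (O := O) (fun s' => s'.nreg 10 ≤ s.nreg 14 ∧
    Enum n (s'.narr 1) (s'.nreg 9) (fun u => G.trunc ε q u ≠ 0 ∧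
      ∃ i < s'.nreg 10, s.narr 2 i = u) ∧
    ∀ i < s'.nreg 9, ∀ u : Fin n, s'.narr 1 i = u → s'.rarr 0 i = G.trunc ε q u)
    (fun s' => 50 * (s.nreg 14 - s'.nreg 10)) ?_ ?_) ?_
  · rintro s' hfr ⟨hi, he, hv⟩ hg
    have e14 : s'.nreg 14 = s.nreg 14 := by rw [hfr.n 14 rfl]; simp
    have e2 : s'.narr 2 = s.narr 2 := hfr.na 2 rfl
    have e1 : s'.rarr 1 = s.rarr 1 := hfr.ra 1 rfl
    have er2 : s'.rreg 2 = ε := hfr.r 2 rfl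
    simp only [BExp.Holds, NExp.eval, e14, not_le] at hg
    obtain ⟨w, hw3, hw⟩ := h.enum.get _ hg
    have hqw := hq w hw3
    have hnew : ¬ ∃ i < s'.nreg 10, s.narr 2 i = w := by
      rintro ⟨i, hi', e⟩
      exact hi'.ne (h.enum.inj i (hi'.trans hg) _ hg (e.trans hw.symm))
    have hex : ∀ u : Fin n, (∃ i < s'.nreg 10 + 1, s.narr 2 i = u) ↔
        (∃ i < s'.nreg 10, s.narr 2 i = u) ∨ u = w := by
      intro u
      constructor
      · rintro ⟨i, hi', e⟩
        rcases Nat.lt_succ_iff_lt_or_eq.1 hi' with hi' | rfl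
        · exact Or.inl ⟨i, hi', e⟩
        · exact Or.inr (Fin.ext (e.symm.trans hw))
      · rintro (⟨i, hi', e⟩ | rfl)
        · exact ⟨i, by omega, e⟩
        · exact ⟨_, Nat.lt_succ_self _, hw⟩
    rw [filterVertex, runs_seq, runs_setN, runs_seq, runs_cond]
    simp only [NExp.eval, e2, hw, BExp.Holds, RExp.eval, Function.update_self, hdeg, er2, e1, hqw]
    rw [← G.trunc_ne_zero hd hε]
    constructor
    · intro hne
      have htr : G.trunc ε q w = q w := by
        rw [G.trunc_ne_zero hd hε] at hne; simp [trunc, hne]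
      simp only [runs_seq, runs_storeN, runs_storeR, runs_setN, NExp.eval, RExp.eval, NExp.cost,
        RExp.cost, BExp.cost, Function.update_self,
        Function.update_of_ne (show (9 : ℕ) ≠ 13 by decide), e1, hqw,
        Function.update_of_ne (show (10 : ℕ) ≠ 13 by decide),
        Function.update_of_ne (show (10 : ℕ) ≠ 9 by decide),
        Function.update_of_ne (show (9 : ℕ) ≠ 10 by decide)]
      refine ⟨⟨hg, ?_, ?_⟩, ?_⟩
      · refine he.push (w := w) (fun hc => hnew hc.2) fun u => ?_
        rw [hex]
        constructor
        · rintro ⟨h1, h2 | h2⟩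
          · exact Or.inl ⟨h1, h2⟩
          · exact Or.inr h2
        · rintro (h1 | rfl)
          · exact ⟨h1.1, Or.inl h1.2⟩
          · exact ⟨hne, Or.inr rfl⟩
      · intro i hi' u
        rcases Nat.lt_succ_iff_lt_or_eq.1 hi' with hi' | rfl
        · rw [Function.update_of_ne hi'.ne, Function.update_of_ne hi'.ne]
          exact hv i hi' u
        · rw [Function.update_self, Function.update_self]
          intro e
          rw [← Fin.ext e, htr]
      · omega
    · intro hne
      simp only [runs_skip, runs_setN, NExp.eval, NExp.cost, RExp.cost, BExp.cost,
        Function.update_self, Function.update_of_ne (show (9 : ℕ) ≠ 13 by decide),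
        Function.update_of_ne (show (10 : ℕ) ≠ 13 by decide),
        Function.update_of_ne (show (9 : ℕ) ≠ 10 by decide)]
      refine ⟨⟨hg, ?_, hv⟩, ?_⟩
      · refine he.congr (fun _ _ => rfl) fun u => ?_
        rw [hex]
        constructor
        · rintro ⟨h1, h2 | rfl⟩
          · exact ⟨h1, h2⟩
          · exact absurd h1 hne
        · exact fun h1 => ⟨h1.1, Or.inl h1.2⟩
      · omega
  · simp only [Function.update_self, Function.update_of_ne (show (9 : ℕ) ≠ 10 by decide)]
    exact ⟨Nat.zero_le _, Enum.nil _ (by simp), by simp⟩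
  · rintro s' T ⟨⟨⟨hi, he, hv⟩, hg, hT⟩, hfr⟩
    have e14 : s'.nreg 14 = s.nreg 14 := by rw [hfr.n 14 rfl]; simp
    simp only [BExp.Holds, NExp.eval, e14, not_not] at hg
    refine ⟨?_, ⟨he.congr (fun _ _ => rfl) fun u => ?_, hv⟩⟩
    · simp only [BExp.cost, NExp.cost, Function.update_self] at hT; omega
    · refine ⟨fun hu => ⟨hu, ?_⟩, fun hu => hu.1⟩
      -- An untouched vertex has value `0`, which is below the positive threshold, so scanning the
      -- touched list misses no survivor.
      have hmem : s.narr 3 u = s.nreg 8 := by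
        by_contra hc
        have := h.val u
        rw [if_neg hc] at this
        rw [G.trunc_ne_zero hd hε, ← this] at hu
        have : (0 : ℝ) < G.deg u := by exact_mod_cast hd u
        have : 0 < (G.deg u : ℝ) * ε := by positivity
        linarith
      obtain ⟨i, hi', e⟩ := h.enum.mem u hmem
      exact ⟨i, by omega, e⟩

/-! ### A tournament tree -/

/-- The winner of two players; `0` stands for no player. -/
noncomputable def best (lt : ℕ → ℕ → Prop) (x y : ℕ) : ℕ :=
  open Classical in if x = 0 then y else if y = 0 then x else if lt x y then x else y

/-- `tr` is a tournament tree with `k` leaves `k, …, 2 k - 1`, except possibly at node `f`. -/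
def IsTree (lt : ℕ → ℕ → Prop) (tr : ℕ → ℕ) (k f : ℕ) : Prop :=
  ∀ i, 1 ≤ i → i < k → i ≠ f → tr i = best lt (tr (2 * i)) (tr (2 * i + 1))

theorem best_eq_or (lt : ℕ → ℕ → Prop) (x y : ℕ) : best lt x y = x ∨ best lt x y = y := by
  unfold best
  split_ifs <;> simp

/-- The relation "`x` wins against `y`, or they are equal, or `y` is no player". -/
def Dominates (lt : ℕ → ℕ → Prop) (x y : ℕ) : Prop := y = 0 ∨ (x ≠ 0 ∧ (x = y ∨ lt x y))

theorem Dominates.trans {lt : ℕ → ℕ → Prop} {k x y z : ℕ}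
    (htrans : ∀ x y z, x ≤ k → y ≤ k → z ≤ k → x ≠ 0 → y ≠ 0 → z ≠ 0 → lt x y → lt y z → lt x z)
    (hx : x ≤ k) (hy : y ≤ k) (hz : z ≤ k) (h1 : Dominates lt x y) (h2 : Dominates lt y z) :
    Dominates lt x z := by
  rcases h2 with h2 | ⟨hy0, h2⟩
  · exact Or.inl h2
  rcases h1 with h1 | ⟨hx0, h1⟩
  · exact absurd h1 hy0
  by_cases hz0 : z = 0
  · exact Or.inl hz0
  rcases h1 with rfl | h1
  · exact Or.inr ⟨hx0, h2⟩
  rcases h2 with rfl | h2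
  · exact Or.inr ⟨hx0, Or.inr h1⟩
  · exact Or.inr ⟨hx0, Or.inr (htrans x y z hx hy hz hx0 hy0 hz0 h1 h2)⟩

theorem best_dominates {lt : ℕ → ℕ → Prop} {k x y : ℕ}
    (htotal : ∀ x y, x ≤ k → y ≤ k → x ≠ 0 → y ≠ 0 → x ≠ y → lt x y ∨ lt y x)
    (hx : x ≤ k) (hy : y ≤ k) :
    Dominates lt (best lt x y) x ∧ Dominates lt (best lt x y) y := by
  unfold best Dominates
  by_cases hx0 : x = 0
  · subst hx0; simp
    tauto
  by_cases hy0 : y = 0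
  · subst hy0; simp [hx0]
  by_cases hl : lt x y
  · simp [hx0, hl]
  · simp only [hx0, hy0, hl, if_false]
    refine ⟨Or.inr ⟨hy0, ?_⟩, Or.inr ⟨hy0, Or.inl trivial⟩⟩
    by_cases he : y = x
    · exact Or.inl he
    · exact Or.inr ((htotal x y hx hy hx0 hy0 (Ne.symm he)).resolve_left hl)

theorem IsTree.value {lt : ℕ → ℕ → Prop} {tr : ℕ → ℕ} {k : ℕ} (h : IsTree lt tr k 0) :
    ∀ i, 1 ≤ i → i < 2 * k → ∃ a < k, tr i = tr (k + a) := by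
  have key : ∀ N i, 2 * k - i ≤ N → 1 ≤ i → i < 2 * k → ∃ a < k, tr i = tr (k + a) := by
    intro N
    induction N with
    | zero => intro i h1 h2 h3; omega
    | succ N ih =>
      intro i h1 h2 h3
      rcases lt_or_ge i k with hik | hik
      · rw [h i h2 hik (by omega)]
        rcases best_eq_or lt (tr (2 * i)) (tr (2 * i + 1)) with e | e
        · rw [e]; exact ih (2 * i) (by omega) (by omega) (by omega)
        · rw [e]; exact ih (2 * i + 1) (by omega) (by omega) (by omega)
      · exact ⟨i - k, by omega, by rw [Nat.add_sub_cancel' hik]⟩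
  exact fun i => key _ i le_rfl

/-- Domination descends from each parent `i / 2` to its two children and is transitive, and every
vacant position counts as dominated. The induction does not need `k` to be a power of two. -/
theorem IsTree.root_dominates {lt : ℕ → ℕ → Prop} {tr : ℕ → ℕ} {k : ℕ} (h : IsTree lt tr k 0)
    (hle : ∀ a < k, tr (k + a) ≤ k)
    (htrans : ∀ x y z, x ≤ k → y ≤ k → z ≤ k → x ≠ 0 → y ≠ 0 → z ≠ 0 → lt x y → lt y z → lt x z)
    (htotal : ∀ x y, x ≤ k → y ≤ k → x ≠ 0 → y ≠ 0 → x ≠ y → lt x y ∨ lt y x) (i : ℕ)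
    (h1 : 1 ≤ i) (h2 : i < 2 * k) : Dominates lt (tr 1) (tr i) := by
  have hval : ∀ i, 1 ≤ i → i < 2 * k → tr i ≤ k := fun i h1 h2 => by
    obtain ⟨a, ha, e⟩ := h.value i h1 h2
    rw [e]; exact hle a ha
  induction i using Nat.strong_induction_on with
  | _ i ih =>
    rcases Nat.lt_or_ge i 2 with hi | hi
    · have : i = 1 := by omega
      subst this
      by_cases h0 : tr 1 = 0
      · exact Or.inl h0
      · exact Or.inr ⟨h0, Or.inl rfl⟩
    · have hp := ih (i / 2) (by omega) (by omega) (by omega)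
      have hb := best_dominates htotal (hval (2 * (i / 2)) (by omega) (by omega))
        (hval (2 * (i / 2) + 1) (by omega) (by omega))
      rw [← h (i / 2) (by omega) (by omega) (by omega)] at hb
      refine hp.trans htrans (hval 1 le_rfl (by omega)) (hval _ (by omega) (by omega))
        (hval i h1 h2) ?_
      rcases Nat.mod_two_eq_zero_or_one i with hm | hm
      · have e : 2 * (i / 2) = i := by omega
        rw [e] at hb; exact hb.1
      · have e : 2 * (i / 2) + 1 = i := by omega
        rw [e] at hb; exact hb.2

/-- The order in which two vertices are put by the program. -/
def Lead (O : Oracle) (q : ℕ → ℝ) (a b : ℕ) : Prop :=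
  q b / O.deg b ≤ q a / O.deg a ∧ ¬ (q a / O.deg a ≤ q b / O.deg b ∧ b ≤ a)

theorem lead_iff_before {G : LoopGraph n} {adj : Fin n → List (Fin n)} (hadj : G.IsAdjList adj)
    {x : ℕ → ℝ} {q : Fin n → ℝ} {u w : Fin n} (hu : x u = q u) (hw : x w = q w) :
    Lead (oracle adj) x u w ↔ G.Before q u w := by
  unfold Lead Before
  rw [hu, hw, oracle_deg hadj, oracle_deg hadj, not_and, not_le, Fin.lt_def]
  constructor
  · rintro ⟨h1, h2⟩
    rcases h1.lt_or_eq with h | h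
    · exact Or.inl h
    · exact Or.inr ⟨h.symm, h2 h.ge⟩
  · rintro (h | ⟨h, h'⟩)
    · exact ⟨h.le, fun h2 => absurd h (not_lt.2 h2)⟩
    · exact ⟨h.ge, fun _ => h'⟩

/-- The players are the positions of the vertices in array `1`, counted from `1`. -/
def Wins (O : Oracle) (s : Store) (x y : ℕ) : Prop :=
  Lead O (s.rarr 1) (s.narr 1 (x - 1)) (s.narr 1 (y - 1))

/-- Recompute the tree at the node in register `10`. -/
def play : Cmd :=
  .seq (.setN 15 (.arr 4 (.add (.reg 10) (.reg 10)))) <|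
  .seq (.setN 19 (.arr 4 (.add (.add (.reg 10) (.reg 10)) (.lit 1)))) <|
  .cond (.leN (.reg 15) (.lit 0)) (.storeN 4 (.reg 10) (.reg 19)) <|
  .cond (.leN (.reg 19) (.lit 0)) (.storeN 4 (.reg 10) (.reg 15)) <|
  .seq (.setN 11 (.arr 1 (.sub (.reg 15) (.lit 1)))) <|
  .seq (.setN 13 (.arr 1 (.sub (.reg 19) (.lit 1)))) <|
  .cond (.and (.leR (.div (.arr 1 (.reg 13)) (.ofNat (.deg (.reg 13))))
      (.div (.arr 1 (.reg 11)) (.ofNat (.deg (.reg 11)))))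
    (.not (.and (.leR (.div (.arr 1 (.reg 11)) (.ofNat (.deg (.reg 11))))
      (.div (.arr 1 (.reg 13)) (.ofNat (.deg (.reg 13))))) (.leN (.reg 13) (.reg 11)))))
    (.storeN 4 (.reg 10) (.reg 15)) (.storeN 4 (.reg 10) (.reg 19))

theorem play_spec (O : Oracle) (s : Store) : Runs O play s fun s' T => (T ≤ 100 ∧
    s'.narr 4 = Function.update (s.narr 4) (s.nreg 10) (best (Wins O s)
      (s.narr 4 (2 * s.nreg 10)) (s.narr 4 (2 * s.nreg 10 + 1)))) ∧ Frame play s s' := by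
  refine Runs.frame ?_
  have e2 : s.nreg 10 + s.nreg 10 = 2 * s.nreg 10 := by ring
  set x := s.narr 4 (2 * s.nreg 10) with hx
  set y := s.narr 4 (2 * s.nreg 10 + 1) with hy
  simp only [play, runs_seq, runs_setN, runs_cond, runs_storeN, NExp.eval, NExp.cost, BExp.cost,
    RExp.cost, BExp.Holds, RExp.eval, Function.update_self, e2,
    Function.update_of_ne (show (10 : ℕ) ≠ 15 by decide),
    Function.update_of_ne (show (15 : ℕ) ≠ 19 by decide),
    Function.update_of_ne (show (10 : ℕ) ≠ 19 by decide),
    Function.update_of_ne (show (19 : ℕ) ≠ 11 by decide),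
    Function.update_of_ne (show (15 : ℕ) ≠ 11 by decide),
    Function.update_of_ne (show (19 : ℕ) ≠ 13 by decide),
    Function.update_of_ne (show (15 : ℕ) ≠ 13 by decide),
    Function.update_of_ne (show (10 : ℕ) ≠ 11 by decide),
    Function.update_of_ne (show (10 : ℕ) ≠ 13 by decide),
    Function.update_of_ne (show (11 : ℕ) ≠ 13 by decide), ← hx, ← hy]
  have hw : (s.rarr 1 (s.narr 1 (y - 1)) / O.deg (s.narr 1 (y - 1)) ≤
      s.rarr 1 (s.narr 1 (x - 1)) / O.deg (s.narr 1 (x - 1)) ∧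
      ¬ (s.rarr 1 (s.narr 1 (x - 1)) / O.deg (s.narr 1 (x - 1)) ≤
      s.rarr 1 (s.narr 1 (y - 1)) / O.deg (s.narr 1 (y - 1)) ∧
      s.narr 1 (y - 1) ≤ s.narr 1 (x - 1))) ↔ Wins O s x y := Iff.rfl
  rw [hw]
  unfold best
  refine ⟨fun h0 => ⟨by norm_num, ?_⟩, fun h0 => ⟨fun h1 => ⟨by norm_num, ?_⟩,
    fun h1 => ⟨fun h2 => ⟨by norm_num, ?_⟩, fun h2 => ⟨by norm_num, ?_⟩⟩⟩⟩
  · rw [if_pos (by omega)]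
  · rw [if_neg (by omega), if_pos (by omega)]
  · rw [if_neg (by omega), if_neg (by omega), if_pos h2]
  · rw [if_neg (by omega), if_neg (by omega), if_neg h2]

/-- Recompute the tree on the way from the node in register `10` to the root. -/
def climb : Cmd :=
  .loop (.leN (.lit 1) (.reg 10)) (.seq play (.setN 10 (.half (.reg 10))))

theorem Wins.congr {O : Oracle} {s s' : Store} (h1 : s'.narr 1 = s.narr 1)
    (h2 : s'.rarr 1 = s.rarr 1) : Wins O s' = Wins O s := by
  funext x y
  unfold Wins
  rw [h1, h2]

/-- Recomputing the only possibly wrong node moves the defect to its parent. At index `0` there is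
no defect left. Halving removes one binary digit, so the cost is measured by `Nat.size`. -/
theorem climb_spec (O : Oracle) {s : Store} {k : ℕ}
    (h : IsTree (Wins O s) (s.narr 4) k (s.nreg 10)) (hk : s.nreg 10 < k) :
    Runs O climb s fun s' T => (T ≤ 120 * Nat.size (s.nreg 10) + 10 ∧
      IsTree (Wins O s) (s'.narr 4) k 0 ∧ ∀ j, k ≤ j → s'.narr 4 j = s.narr 4 j) ∧
      Frame climb s s' := by
  refine Runs.mono (runs_loop (O := O) (fun s' => s'.nreg 10 < k ∧
    IsTree (Wins O s) (s'.narr 4) k (s'.nreg 10) ∧ ∀ j, k ≤ j → s'.narr 4 j = s.narr 4 j)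
    (fun s' => 120 * Nat.size (s'.nreg 10)) ?_ ⟨hk, h, fun _ _ => rfl⟩) ?_
  · rintro s' hfr ⟨hk', ht, hl⟩ hg
    simp only [BExp.Holds, NExp.eval] at hg
    have hwin : Wins O s' = Wins O s := Wins.congr (hfr.na 1 rfl) (hfr.ra 1 rfl)
    rw [runs_seq]
    refine Runs.mono (play_spec O s') ?_
    rintro s'' T ⟨⟨hT, ha⟩, hfr'⟩
    rw [hwin] at ha
    have e10 : s''.nreg 10 = s'.nreg 10 := hfr'.n 10 rfl
    simp only [runs_setN, NExp.eval, NExp.cost, BExp.cost, Function.update_self, e10]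
    set i := s'.nreg 10 with hi
    refine ⟨⟨by omega, ?_, fun j hj => ?_⟩, ?_⟩
    · intro m hm1 hmk hmi
      rw [ha]
      by_cases hmi' : m = i
      · subst hmi'
        rw [Function.update_self, Function.update_of_ne (by omega),
          Function.update_of_ne (by omega)]
      · rw [Function.update_of_ne hmi', Function.update_of_ne (by omega),
          Function.update_of_ne (by omega)]
        exact ht m hm1 hmk hmi'
    · rw [ha, Function.update_of_ne (by omega), hl j hj]
    · have : Nat.size (i / 2) + 1 ≤ Nat.size i := by
        have h0 : i / 2 < 2 ^ (Nat.size i - 1) := by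
          have h1 := Nat.lt_size_self i
          have h2 : 0 < Nat.size i := Nat.size_pos.2 (by omega)
          have h3 : 2 ^ Nat.size i = 2 * 2 ^ (Nat.size i - 1) := by
            rw [← pow_succ']; congr 1; omega
          omega
        have h1 := Nat.size_le.2 h0
        have h2 : 0 < Nat.size i := Nat.size_pos.2 (by omega)
        omega
      omega
  · rintro s' T ⟨⟨⟨-, ht, hl⟩, hg, hT⟩, hfr⟩
    simp only [BExp.Holds, NExp.eval, not_le] at hg
    have h0 : s'.nreg 10 = 0 := by omega
    rw [h0] at ht
    refine ⟨⟨?_, ht, hl⟩, hfr⟩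
    simp only [BExp.cost, NExp.cost] at hT
    omega

/-- Build the tree over the vertices in array `1`. -/
def build : Cmd :=
  .seq (.setN 10 (.lit 0)) <|
  .seq (.loop (.not (.leN (.reg 9) (.reg 10)))
    (.seq (.storeN 4 (.add (.reg 9) (.reg 10)) (.add (.reg 10) (.lit 1)))
      (.setN 10 (.add (.reg 10) (.lit 1))))) <|
  .loop (.leN (.lit 2) (.reg 10)) (.seq (.setN 10 (.sub (.reg 10) (.lit 1))) play)

/-- Internal nodes are recomputed in decreasing order, so both children are already correct. This
costs constant time per node, hence linear time in all. -/
theorem build_spec (O : Oracle) (s : Store) : Runs O build s fun s' T =>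
    (T ≤ 160 * s.nreg 9 + 20 ∧ IsTree (Wins O s) (s'.narr 4) (s.nreg 9) 0 ∧
      ∀ a < s.nreg 9, s'.narr 4 (s.nreg 9 + a) = a + 1) ∧ Frame build s s' := by
  refine Runs.frame ?_
  set k := s.nreg 9 with hk
  rw [build, runs_seq, runs_setN, runs_seq]
  simp only [NExp.eval, NExp.cost]
  refine Runs.mono (runs_loop (O := O) (fun s' => s'.nreg 10 ≤ k ∧
    ∀ a < s'.nreg 10, s'.narr 4 (k + a) = a + 1) (fun s' => 20 * (k - s'.nreg 10)) ?_ ?_) ?_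
  · rintro s' hfr ⟨hi, ha⟩ hg
    have e9 : s'.nreg 9 = k := by rw [hfr.n 9 rfl]; simp [hk]
    simp only [BExp.Holds, NExp.eval, e9, not_le] at hg
    simp only [runs_seq, runs_storeN, runs_setN, NExp.eval, NExp.cost, BExp.cost,
      Function.update_self, e9]
    refine ⟨⟨hg, fun a ha' => ?_⟩, by omega⟩
    rcases Nat.lt_succ_iff_lt_or_eq.1 ha' with ha' | rfl
    · rw [Function.update_of_ne (by omega)]; exact ha a ha'
    · rw [Function.update_self]
  · simp
  · rintro s1 T1 ⟨⟨⟨hi, ha⟩, hg, hT⟩, hfr⟩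
    have e9 : s1.nreg 9 = k := by rw [hfr.n 9 rfl]; simp [hk]
    simp only [BExp.Holds, NExp.eval, e9, not_not] at hg
    have hik : s1.nreg 10 = k := le_antisymm hi hg
    simp only [BExp.cost, NExp.cost, Function.update_self] at hT
    have e1 : s1.narr 1 = s.narr 1 := hfr.na 1 rfl
    have er1 : s1.rarr 1 = s.rarr 1 := hfr.ra 1 rfl
    rw [hik] at ha
    refine Runs.mono (runs_loop (O := O) (fun s' => s'.nreg 10 ≤ k ∧
      (∀ i, s'.nreg 10 ≤ i → 1 ≤ i → i < k →
        s'.narr 4 i = best (Wins O s) (s'.narr 4 (2 * i)) (s'.narr 4 (2 * i + 1))) ∧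
      ∀ a < k, s'.narr 4 (k + a) = a + 1) (fun s' => 120 * s'.nreg 10) ?_ ?_) ?_
    · rintro s' hfr' ⟨hi', ht, hl⟩ hg'
      simp only [BExp.Holds, NExp.eval] at hg'
      rw [runs_seq, runs_setN]
      refine Runs.mono (play_spec O _) ?_
      rintro s'' T ⟨⟨hT', ha'⟩, hfr2⟩
      have hwin : Wins O { s' with
          nreg := Function.update s'.nreg 10 ((NExp.sub (.reg 10) (.lit 1)).eval O s') } =
          Wins O s :=
        Wins.congr ((hfr'.na 1 rfl).trans e1) ((hfr'.ra 1 rfl).trans er1)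
      rw [hwin] at ha'
      simp only [NExp.eval, Function.update_self] at ha'
      have e10 : s''.nreg 10 = s'.nreg 10 - 1 := by rw [hfr2.n 10 rfl]; simp
      rw [e10]
      set i := s'.nreg 10 - 1 with hidef
      refine ⟨⟨by omega, fun m hm hm1 hmk => ?_, fun a hak => ?_⟩, ?_⟩
      · rw [ha']
        by_cases hmi : m = i
        · subst hmi
          rw [Function.update_self, Function.update_of_ne (by omega),
            Function.update_of_ne (by omega)]
        · rw [Function.update_of_ne hmi, Function.update_of_ne (by omega),
            Function.update_of_ne (by omega)]
          exact ht m (by omega) hm1 hmk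
      · rw [ha', Function.update_of_ne (by omega), hl a hak]
      · simp only [NExp.cost, BExp.cost]; omega
    · exact ⟨hik.le, fun i h1 _ h2 => by omega, ha⟩
    · rintro s2 T2 ⟨⟨⟨-, ht, hl⟩, hg', hT'⟩, -⟩
      simp only [BExp.Holds, NExp.eval, not_le] at hg'
      simp only [BExp.cost, NExp.cost, hik] at hT'
      exact ⟨by omega, fun i h1 h2 _ => ht i (by omega) h1 h2, hl⟩

/-! ### The sweep -/

/-- Take the best remaining vertex out of the tree and put it into register `22`. -/
def pick : Cmd :=
  .seq (.setN 10 (.sub (.arr 4 (.lit 1)) (.lit 1))) <|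
  .seq (.setN 22 (.arr 1 (.reg 10))) <|
  .seq (.setN 10 (.add (.reg 9) (.reg 10))) <|
  .seq (.storeN 4 (.reg 10) (.lit 0)) <|
  .seq (.setN 10 (.half (.reg 10)))
  climb

/-- Array `1` lists the first `k` vertices in the order given by `q`, and real array `1` holds the
values of `q` there. -/
structure Ranked (G : LoopGraph n) (q : Fin n → ℝ) (k : ℕ) (s : Store) : Prop where
  le : k ≤ n
  enum : Enum n (s.narr 1) k (· ∈ G.sweep q k)
  val : ∀ u ∈ G.sweep q k, s.rarr 1 u = q u

/-- The leaves of the tree hold the vertices that are not among the first `j` ones. -/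
def Leaves (G : LoopGraph n) (q : Fin n → ℝ) (k j : ℕ) (s : Store) : Prop :=
  open Classical in
  ∀ a < k, ∀ u : Fin n, s.narr 1 a = u →
    s.narr 4 (k + a) = if u ∈ G.sweep q j then 0 else a + 1

theorem Ranked.congr {G : LoopGraph n} {q : Fin n → ℝ} {k : ℕ} {s s' : Store}
    (h : Ranked G q k s) (h1 : s'.narr 1 = s.narr 1) (h2 : s'.rarr 1 = s.rarr 1) :
    Ranked G q k s' := by
  refine ⟨h.le, ?_, ?_⟩
  · rw [h1]; exact h.enum
  · rw [h2]; exact h.val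

theorem Ranked.wins {G : LoopGraph n} {q : Fin n → ℝ} {k : ℕ} {s : Store} (h : Ranked G q k s)
    {adj : Fin n → List (Fin n)} (hadj : G.IsAdjList adj) {x y : ℕ} (hx : x ≤ k) (hy : y ≤ k)
    (hx0 : 1 ≤ x) (hy0 : 1 ≤ y) : ∃ u ∈ G.sweep q k, ∃ w ∈ G.sweep q k,
      s.narr 1 (x - 1) = u ∧ s.narr 1 (y - 1) = w ∧ (Wins (oracle adj) s x y ↔ G.Before q u w) := by
  obtain ⟨u, hu, eu⟩ := h.enum.get (x - 1) (by omega)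
  obtain ⟨w, hw, ew⟩ := h.enum.get (y - 1) (by omega)
  refine ⟨u, hu, w, hw, eu, ew, ?_⟩
  unfold Wins
  rw [eu, ew, lead_iff_before hadj (h.val u hu) (h.val w hw)]

theorem Ranked.wins_trans {G : LoopGraph n} {q : Fin n → ℝ} {k : ℕ} {s : Store}
    (h : Ranked G q k s) {adj : Fin n → List (Fin n)} (hadj : G.IsAdjList adj) (x y z : ℕ)
    (hx : x ≤ k) (hy : y ≤ k) (hz : z ≤ k) (hx0 : x ≠ 0) (hy0 : y ≠ 0) (hz0 : z ≠ 0)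
    (h1 : Wins (oracle adj) s x y) (h2 : Wins (oracle adj) s y z) : Wins (oracle adj) s x z := by
  obtain ⟨u, -, w, -, eu, ew, e1⟩ := h.wins hadj hx hy (by omega) (by omega)
  obtain ⟨w', -, z', -, ew', ez', e2⟩ := h.wins hadj hy hz (by omega) (by omega)
  obtain ⟨u', -, z'', -, eu', ez'', e3⟩ := h.wins hadj hx hz (by omega) (by omega)
  obtain rfl : w = w' := Fin.ext (ew.symm.trans ew')
  obtain rfl : u = u' := Fin.ext (eu.symm.trans eu')
  obtain rfl : z' = z'' := Fin.ext (ez'.symm.trans ez'')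
  exact e3.2 ((e1.1 h1).trans (e2.1 h2))

theorem Ranked.wins_total {G : LoopGraph n} {q : Fin n → ℝ} {k : ℕ} {s : Store}
    (h : Ranked G q k s) {adj : Fin n → List (Fin n)} (hadj : G.IsAdjList adj) (x y : ℕ)
    (hx : x ≤ k) (hy : y ≤ k) (hx0 : x ≠ 0) (hy0 : y ≠ 0) (hxy : x ≠ y) :
    Wins (oracle adj) s x y ∨ Wins (oracle adj) s y x := by
  obtain ⟨u, -, w, -, eu, ew, e1⟩ := h.wins hadj hx hy (by omega) (by omega)
  obtain ⟨w', -, u', -, ew', eu', e2⟩ := h.wins hadj hy hx (by omega) (by omega)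
  obtain rfl : w = w' := Fin.ext (ew.symm.trans ew')
  obtain rfl : u = u' := Fin.ext (eu.symm.trans eu')
  rw [e1, e2]
  refine G.before_total q fun hc => hxy ?_
  subst hc
  have := h.enum.inj (x - 1) (by omega) (y - 1) (by omega) (eu.trans ew.symm)
  omega

/-- The root of the tree holds the next vertex of the order. -/
theorem Ranked.root {G : LoopGraph n} {q : Fin n → ℝ} {k j : ℕ} {s : Store} (h : Ranked G q k s)
    {adj : Fin n → List (Fin n)} (hadj : G.IsAdjList adj) (hj : j < k)
    (ht : IsTree (Wins (oracle adj) s) (s.narr 4) k 0) (hl : Leaves G q k j s) :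
    ∃ a < k, s.narr 4 1 = a + 1 ∧ ∃ u : Fin n, s.narr 1 a = u ∧ G.rank q u = j := by
  have hle : ∀ a < k, s.narr 4 (k + a) ≤ k := by
    intro a ha
    obtain ⟨u, -, eu⟩ := h.enum.get a ha
    rw [hl a ha u eu]
    split_ifs <;> omega
  obtain ⟨u, hu⟩ := G.exists_rank_eq q (hj.trans_le h.le)
  have huk : u ∈ G.sweep q k := mem_sweep.2 (by omega)
  have huj : u ∉ G.sweep q j := notMem_sweep_rank hu
  obtain ⟨a, ha, ea⟩ := h.enum.mem u huk
  have hla : s.narr 4 (k + a) = a + 1 := by rw [hl a ha u ea, if_neg huj]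
  have hdom := ht.root_dominates hle (h.wins_trans hadj) (h.wins_total hadj) (k + a) (by omega)
    (by omega)
  rw [hla] at hdom
  refine ⟨a, ha, ?_, u, ea, hu⟩
  rcases hdom with h0 | ⟨hne, he | hw⟩
  · omega
  · exact he
  · exfalso
    obtain ⟨c, hc, ec⟩ := ht.value 1 le_rfl (by omega)
    obtain ⟨w, hw', ew⟩ := h.enum.get c hc
    have hlc := hl c hc w ew
    rw [← ec] at hlc
    split_ifs at hlc with hwj
    · exact hne hlc
    · rw [hlc] at hw
      obtain ⟨w1, -, u1, -, ew1, eu1, e1⟩ := h.wins hadj (x := c + 1) (y := a + 1) (by omega)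
        (by omega) (by omega) (by omega)
      simp only [Nat.add_sub_cancel] at ew1 eu1
      obtain rfl : w = w1 := Fin.ext (ew.symm.trans ew1)
      obtain rfl : u = u1 := Fin.ext (ea.symm.trans eu1)
      have := before_iff_rank_lt.1 (e1.1 hw)
      exact hwj (mem_sweep.2 (by omega))

/-- Vacating the winner's leaf disturbs only the path from its parent to the root, which `climb`
repairs. For `k = 1` the leaf is the root, its index halves to `0`, and nothing has to be repaired.
-/
theorem pick_spec {G : LoopGraph n} {adj : Fin n → List (Fin n)} (hadj : G.IsAdjList adj)
    {s : Store} {q : Fin n → ℝ} {k j : ℕ} (h : Ranked G q k s) (h9 : s.nreg 9 = k) (hj : j < k)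
    (ht : IsTree (Wins (oracle adj) s) (s.narr 4) k 0) (hl : Leaves G q k j s) :
    Runs (oracle adj) pick s fun s' T => (T ≤ 120 * Nat.size k + 60 ∧
      IsTree (Wins (oracle adj) s') (s'.narr 4) k 0 ∧ Leaves G q k (j + 1) s' ∧
      ∃ u : Fin n, s'.nreg 22 = u ∧ G.rank q u = j) ∧ Frame pick s s' := by
  refine Runs.frame ?_
  obtain ⟨a, ha, ea, u, eu, hu⟩ := h.root hadj hj ht hl
  rw [pick]
  simp only [runs_seq, runs_setN, runs_storeN, NExp.eval, NExp.cost, Function.update_self, ea,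
    Nat.add_sub_cancel, eu, h9, Function.update_of_ne (show (10 : ℕ) ≠ 22 by decide),
    Function.update_of_ne (show (9 : ℕ) ≠ 22 by decide),
    Function.update_of_ne (show (9 : ℕ) ≠ 10 by decide)]
  have hwin : ∀ f, Wins (oracle adj) { s with
      nreg := f
      narr := Function.update s.narr 4 (Function.update (s.narr 4) (k + a) 0) } =
      Wins (oracle adj) s := fun f => Wins.congr (by simp) rfl
  refine Runs.mono (climb_spec (oracle adj) (k := k) ?_ ?_) ?_
  · rw [hwin]
    intro i h1 h2 h3
    simp only [Function.update_self] at h3 ⊢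
    rw [Function.update_of_ne (by omega), Function.update_of_ne (by omega),
      Function.update_of_ne (by omega)]
    exact ht i h1 h2 (by omega)
  · simp only [Function.update_self]
    omega
  rintro s' T ⟨⟨hT, ht', hl'⟩, hfr⟩
  have e1 : s'.narr 1 = s.narr 1 := by rw [hfr.na 1 rfl]; simp
  have e2 : s'.rarr 1 = s.rarr 1 := hfr.ra 1 rfl
  rw [hwin] at ht'
  simp only [Function.update_self] at hT hl'
  refine ⟨?_, ?_, ?_, u, ?_, hu⟩
  · have := Nat.size_le_size (show (k + a) / 2 ≤ k by omega)
    omega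
  · rw [Wins.congr e1 e2]
    exact ht'
  · intro c hc w hw
    rw [e1] at hw
    rw [hl' _ (by omega), sweep_succ hu]
    by_cases hca : c = a
    · subst hca
      obtain rfl : u = w := Fin.ext (eu.symm.trans hw)
      simp
    · rw [Function.update_of_ne (by omega), hl c hc w hw]
      have hwu : w ≠ u := by
        rintro rfl
        exact hca (h.enum.inj c hc a ha (hw.trans eu.symm))
      simp [hwu]
  · rw [hfr.n 22 rfl]
    simp

/-- Count the arcs between the vertex in register `22` and itself and the stamped vertices. -/
def tally : Cmd :=
  .loop (.not (.leN (.deg (.reg 22)) (.reg 12))) <|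
    .seq (.setN 13 (.nbr (.reg 22) (.reg 12))) <|
    .seq (.cond (.and (.leN (.reg 13) (.reg 22)) (.leN (.reg 22) (.reg 13)))
      (.setN 18 (.add (.reg 18) (.lit 1)))
      (.cond (.and (.leN (.arr 5 (.reg 13)) (.reg 8)) (.leN (.reg 8) (.arr 5 (.reg 13))))
        (.setN 18 (.add (.reg 18) (.lit 2))) .skip)) <|
    .setN 12 (.add (.reg 12) (.lit 1))

/-- Register `18` counts ordered arcs inside the sweep set. An edge from the new vertex to an
earlier one adds two arcs, a self-loop adds one; `inner_insert` shows that these weights are right.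
-/
theorem tally_spec {G : LoopGraph n} {adj : Fin n → List (Fin n)} (hadj : G.IsAdjList adj)
    {s : Store} {u : Fin n} (hu : s.nreg 22 = u) (h12 : s.nreg 12 = 0) :
    Runs (oracle adj) tally s fun s' T => (T ≤ 50 * G.deg u + 6 ∧ s'.nreg 18 = s.nreg 18 +
      ∑ w, G.mult u w * (if w = u then 1 else if s.narr 5 w = s.nreg 8 then 2 else 0)) ∧
      Frame tally s s' := by
  set O := oracle adj with hO
  have hdeg : O.deg u = G.deg u := oracle_deg hadj u
  set g : Fin n → ℕ := fun w => if w = u then 1 else if s.narr 5 w = s.nreg 8 then 2 else 0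
    with hg
  refine Runs.mono (runs_loop (O := O) (fun s' => s'.nreg 12 ≤ G.deg u ∧
    s'.nreg 18 = s.nreg 18 + ∑ i ∈ Finset.range (s'.nreg 12), g (nb adj u i))
    (fun s' => 50 * (G.deg u - s'.nreg 12)) ?_ ?_) ?_
  · rintro s' hfr ⟨hk, hc⟩ hgd
    have h22 : s'.nreg 22 = u := (hfr.n 22 rfl).trans hu
    have h8 : s'.nreg 8 = s.nreg 8 := hfr.n 8 rfl
    have h5 : s'.narr 5 = s.narr 5 := hfr.na 5 rfl
    simp only [BExp.Holds, NExp.eval, h22, hdeg, not_le] at hgd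
    have hnb : O.nbr u (s'.nreg 12) = nb adj u (s'.nreg 12) := oracle_nbr hadj u hgd
    set w := nb adj u (s'.nreg 12) with hw
    have hsum : ∑ i ∈ Finset.range (s'.nreg 12 + 1), g (nb adj u i) =
        ∑ i ∈ Finset.range (s'.nreg 12), g (nb adj u i) + g w := Finset.sum_range_succ _ _
    have hwu : (w : ℕ) ≤ u ∧ (u : ℕ) ≤ w ↔ w = u :=
      ⟨fun h => Fin.ext (le_antisymm h.1 h.2), fun h => by simp [h]⟩
    simp only [runs_seq, runs_setN, runs_cond, runs_skip, NExp.eval, BExp.Holds, h22, hnb,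
      Function.update_self, Function.update_of_ne (show (22 : ℕ) ≠ 13 by decide),
      Function.update_of_ne (show (18 : ℕ) ≠ 13 by decide), hwu,
      Function.update_of_ne (show (12 : ℕ) ≠ 13 by decide),
      Function.update_of_ne (show (8 : ℕ) ≠ 13 by decide),
      Function.update_of_ne (show (12 : ℕ) ≠ 18 by decide),
      Function.update_of_ne (show (18 : ℕ) ≠ 12 by decide), h8, h5, hsum, NExp.cost, BExp.cost]
    refine ⟨fun h1 => ⟨⟨hgd, ?_⟩, by omega⟩, fun h1 =>
      ⟨fun h2 => ⟨⟨hgd, ?_⟩, by omega⟩, fun h2 => ⟨⟨hgd, ?_⟩, by omega⟩⟩⟩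
    · rw [hc, hg]; simp only; rw [if_pos h1]; ring
    · rw [hc, hg]; simp only; rw [if_neg h1, if_pos (le_antisymm h2.1 h2.2)]; ring
    · rw [hc, hg]; simp only; rw [if_neg h1, if_neg fun h => h2 ⟨h.le, h.ge⟩]; ring
  · simp [h12]
  · rintro s' T ⟨⟨⟨hk, hc⟩, hgd, hT⟩, hfr⟩
    have h22 : s'.nreg 22 = u := (hfr.n 22 rfl).trans hu
    simp only [BExp.Holds, NExp.eval, h22, hdeg, not_not] at hgd
    have hkd : s'.nreg 12 = G.deg u := le_antisymm hk hgd
    refine ⟨⟨?_, ?_⟩, hfr⟩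
    · simp only [BExp.cost, NExp.cost, h12] at hT; omega
    · rw [hc, hkd, ← length_adj hadj u, sum_nb hadj u g]
      simp [hg]

/-- Append the vertex in register `22` to the list of the sweep. -/
def append : Cmd :=
  .seq (.storeN 0 (.reg 16) (.reg 22)) <|
  .seq (.storeN 5 (.reg 22) (.reg 8)) <|
  .seq (.setN 21 (.reg 17)) <|
  .seq (.setN 17 (.add (.reg 17) (.deg (.reg 22)))) <|
  .seq (.setN 16 (.add (.reg 16) (.lit 1))) <|
  .cond (.and (.not (.leN (.reg 5) (.reg 21))) (.leN (.reg 5) (.reg 17)))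
    (.setR 4 (.div (.arr 1 (.reg 22)) (.ofNat (.deg (.reg 22))))) .skip

/-- The registers describe the sweep set with `j` vertices. -/
structure Swept (G : LoopGraph n) (q : Fin n → ℝ) (j : ℕ) (s : Store) : Prop where
  out : Enum n (s.narr 0) j (· ∈ G.sweep q j)
  stamp : ∀ u : Fin n, s.narr 5 u = s.nreg 8 ↔ u ∈ G.sweep q j
  le : ∀ u : Fin n, s.narr 5 u ≤ s.nreg 8
  vol : s.nreg 17 = G.vol (G.sweep q j)
  slope : s.nreg 5 ≤ G.vol (G.sweep q j) → s.rreg 4 = G.lsSlope q (s.nreg 5)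
  count : s.nreg 16 = j

/-- The slope at `2 ^ b` is the density of the vertex that takes the volume from below `2 ^ b` to at
least `2 ^ b`. It is stored when this vertex is appended and then kept. -/
theorem append_spec {G : LoopGraph n} (hd : ∀ u, 0 < G.deg u) {adj : Fin n → List (Fin n)}
    (hadj : G.IsAdjList adj) {s : Store} {q : Fin n → ℝ} {j : ℕ} (h : Swept G q j s) {u : Fin n}
    (hu : s.nreg 22 = u) (hr : G.rank q u = j) (hq : s.rarr 1 u = q u) :
    Runs (oracle adj) append s fun s' T => (T ≤ 50 ∧ Swept G q (j + 1) s') ∧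
      Frame append s s' := by
  refine Runs.frame ?_
  have hdeg : (oracle adj).deg u = G.deg u := oracle_deg hadj u
  have hv := G.vol_sweep_succ hr
  have hnot := notMem_sweep_rank hr
  have hmem : ∀ w, w ∈ G.sweep q (j + 1) ↔ w ∈ G.sweep q j ∨ w = u := fun w => by
    rw [sweep_succ hr, Finset.mem_insert, or_comm]
  rw [append]
  simp only [runs_seq, runs_setN, runs_storeN, runs_cond, runs_skip, runs_setR, NExp.eval,
    RExp.eval, BExp.Holds, NExp.cost, RExp.cost, BExp.cost, hu, Function.update_self, h.count,
    Function.update_of_ne (show (17 : ℕ) ≠ 21 by decide),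
    Function.update_of_ne (show (17 : ℕ) ≠ 16 by decide),
    Function.update_of_ne (show (16 : ℕ) ≠ 17 by decide),
    Function.update_of_ne (show (16 : ℕ) ≠ 21 by decide),
    Function.update_of_ne (show (21 : ℕ) ≠ 16 by decide),
    Function.update_of_ne (show (21 : ℕ) ≠ 17 by decide),
    Function.update_of_ne (show (5 : ℕ) ≠ 16 by decide),
    Function.update_of_ne (show (5 : ℕ) ≠ 17 by decide),
    Function.update_of_ne (show (5 : ℕ) ≠ 21 by decide),
    Function.update_of_ne (show (22 : ℕ) ≠ 16 by decide),
    Function.update_of_ne (show (22 : ℕ) ≠ 17 by decide),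
    Function.update_of_ne (show (22 : ℕ) ≠ 21 by decide), hdeg, h.vol, hq, not_le]
  have key : ∀ f : ℕ → ℝ, (s.nreg 5 ≤ G.vol (G.sweep q (j + 1)) →
      f 4 = G.lsSlope q (s.nreg 5)) → Swept G q (j + 1) { s with
        nreg := Function.update (Function.update (Function.update s.nreg 21
          (G.vol (G.sweep q j))) 17 (G.vol (G.sweep q j) + G.deg u)) 16 (j + 1)
        rreg := f
        narr := Function.update (Function.update s.narr 0 (Function.update (s.narr 0) j u)) 5
          (Function.update (Function.update s.narr 0 (Function.update (s.narr 0) j u) 5) u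
            (s.nreg 8)) } := by
    intro f hf
    refine ⟨?_, fun w => ?_, fun w => ?_, by simp [hv], by simpa using hf, by simp⟩
    · simpa using h.out.push hnot hmem
    · by_cases hw : w = u
      · subst hw; simp [hmem]
      · have : (w : ℕ) ≠ u := fun hc => hw (Fin.ext hc)
        simpa [hmem, hw, Function.update_of_ne this] using h.stamp w
    · by_cases hw : w = u
      · subst hw; simp
      · have : (w : ℕ) ≠ u := fun hc => hw (Fin.ext hc)
        simpa [Function.update_of_ne this] using h.le w
  constructor
  · rintro ⟨h1, h2⟩
    refine ⟨by norm_num, key _ fun _ => ?_⟩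
    rw [Function.update_self, G.lsSlope_eq hd q hr (by exact_mod_cast h1)
      (by rw [hv]; exact_mod_cast h2)]
  · intro h1
    refine ⟨by norm_num, key _ fun h2 => h.slope ?_⟩
    by_contra h3
    exact h1 ⟨not_le.1 h3, hv ▸ h2⟩

/-- The conditions under which the algorithm stops with the sweep set with `j` vertices. -/
def Passes (G : LoopGraph n) (φ c x : ℝ) (q : Fin n → ℝ) (j : ℕ) : Prop :=
  G.conductance (G.sweep q j) ≤ φ ∧
  (G.vol (G.sweep q j) : ℝ) ≤ 5 / 6 * (G.vol Finset.univ : ℝ) ∧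
  x ≤ (G.vol (G.sweep q j) : ℝ) ∧
  c ≤ G.lsSlope q x

/-- Set register `20` to `1`, if the present sweep set passes the test. -/
def test : Cmd :=
  .seq (.cond (.leN (.reg 17) (.sub (.reg 3) (.reg 17))) (.setN 21 (.reg 17))
    (.setN 21 (.sub (.reg 3) (.reg 17)))) <|
  .cond (.and (.leR (.div (.ofNat (.sub (.reg 17) (.reg 18))) (.ofNat (.reg 21))) (.reg 0))
    (.and (.leR (.ofNat (.reg 17)) (.mul (.div (.ofNat (.lit 5)) (.ofNat (.lit 6)))
      (.ofNat (.reg 3))))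
    (.and (.leN (.reg 5) (.reg 17)) (.leR (.reg 3) (.reg 4)))))
    (.setN 20 (.lit 1)) .skip

theorem test_spec (O : Oracle) {G : LoopGraph n} {s : Store} {q : Fin n → ℝ} {j : ℕ}
    (hne : (G.sweep q j).Nonempty) (h3 : s.nreg 3 = G.vol Finset.univ)
    (h17 : s.nreg 17 = G.vol (G.sweep q j))
    (h18 : s.nreg 18 = ∑ u ∈ G.sweep q j, ∑ w ∈ G.sweep q j, G.mult u w)
    (h4 : s.nreg 5 ≤ G.vol (G.sweep q j) → s.rreg 4 = G.lsSlope q (s.nreg 5)) :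
    Runs O test s fun s' T => (T ≤ 50 ∧
      (Passes G (s.rreg 0) (s.rreg 3) (s.nreg 5) q j → s'.nreg 20 = 1) ∧
      (¬ Passes G (s.rreg 0) (s.rreg 3) (s.nreg 5) q j → s'.nreg 20 = s.nreg 20)) ∧
      Frame test s s' := by
  refine Runs.frame ?_
  -- The truncated subtraction is exact, because the inner arcs are part of the volume.
  have hcut : s.nreg 17 - s.nreg 18 = G.cut (G.sweep q j) := by
    have := G.cut_add_inner (G.sweep q j)
    omega
  have hcompl : s.nreg 3 - G.vol (G.sweep q j) = G.vol (G.sweep q j)ᶜ := by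
    have := G.vol_add_vol_compl (G.sweep q j)
    omega
  rw [test, runs_seq]
  refine Runs.mono (Q := fun s' T => T ≤ 12 ∧ s' = { s with
    nreg := Function.update s.nreg 21
      (min (G.vol (G.sweep q j)) (G.vol (G.sweep q j)ᶜ)) }) ?_ ?_
  · simp only [runs_cond, runs_setN, BExp.Holds, NExp.eval, BExp.cost, NExp.cost, h17, hcompl]
    refine ⟨fun h => ⟨by norm_num, ?_⟩, fun h => ⟨by norm_num, ?_⟩⟩
    · rw [min_eq_left h]
    · rw [min_eq_right (not_le.1 h).le]
  rintro s' T ⟨hT, rfl⟩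
  -- The stored slope is meaningful only once the volume has reached `2 ^ b`; the comparison with it
  -- is needed only under that earlier conjunct. A complement of volume `0` causes no mismatch,
  -- since program and definition perform the same division.
  have hiff : (((G.cut (G.sweep q j) : ℕ) : ℝ) /
      ((min (G.vol (G.sweep q j)) (G.vol (G.sweep q j)ᶜ) : ℕ) : ℝ) ≤ s.rreg 0 ∧
      (s.nreg 17 : ℝ) ≤ ((5 : ℕ) : ℝ) / ((6 : ℕ) : ℝ) * (s.nreg 3 : ℝ) ∧ s.nreg 5 ≤ s.nreg 17 ∧
      s.rreg 3 ≤ s.rreg 4) ↔ Passes G (s.rreg 0) (s.rreg 3) (s.nreg 5) q j := by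
    unfold Passes conductance
    rw [if_neg hne.ne_empty, h17, h3, Nat.cast_min, Nat.cast_le]
    push_cast
    refine and_congr_right fun _ => and_congr_right fun _ => and_congr_right fun h => ?_
    rw [h4 h]
  simp only [runs_cond, runs_setN, runs_skip, BExp.Holds, NExp.eval, RExp.eval, BExp.cost,
    NExp.cost, RExp.cost, Function.update_self, Function.update_of_ne (show (17 : ℕ) ≠ 21 by decide),
    Function.update_of_ne (show (18 : ℕ) ≠ 21 by decide),
    Function.update_of_ne (show (3 : ℕ) ≠ 21 by decide),
    Function.update_of_ne (show (20 : ℕ) ≠ 21 by decide),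
    Function.update_of_ne (show (5 : ℕ) ≠ 21 by decide), hcut, hiff]
  exact ⟨fun h => ⟨by omega, fun _ => trivial, fun h' => absurd h h'⟩,
    fun h => ⟨by omega, fun h' => absurd h' h, fun _ => trivial⟩⟩

theorem inner_insert (G : LoopGraph n) {S : Finset (Fin n)} {u : Fin n} (hu : u ∉ S) :
    ∑ x ∈ insert u S, ∑ w ∈ insert u S, G.mult x w = (∑ x ∈ S, ∑ w ∈ S, G.mult x w) +
      ∑ w, G.mult u w * (if w = u then 1 else if w ∈ S then 2 else 0) := by
  classical
  have e1 : ∀ x, ∑ w ∈ insert u S, G.mult x w = G.mult x u + ∑ w ∈ S, G.mult x w := fun x =>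
    Finset.sum_insert hu
  have e2 : ∑ w, G.mult u w * (if w = u then 1 else if w ∈ S then 2 else 0) =
      G.mult u u + 2 * ∑ w ∈ S, G.mult u w := by
    rw [Finset.mul_sum, ← Finset.sum_subset (Finset.subset_univ (insert u S)), Finset.sum_insert hu]
    · rw [if_pos rfl, mul_one]
      congr 1
      refine Finset.sum_congr rfl fun w hw => ?_
      rw [if_neg (by rintro rfl; exact hu hw), if_pos hw, mul_comm]
    · intro w _ hw
      rw [Finset.mem_insert, not_or] at hw
      rw [if_neg hw.1, if_neg hw.2, mul_zero]
  rw [Finset.sum_insert hu, e2, e1, Finset.sum_congr rfl fun x _ => e1 x, Finset.sum_add_distrib,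
    Finset.sum_congr rfl fun x _ => G.mult_symm x u]
  ring

/-- One step of the sweep. -/
def sweepStep : Cmd :=
  .seq pick <| .seq (.setN 12 (.lit 0)) <| .seq tally <| .seq append test

/-- The state of the sweep after `j` steps. -/
structure Sweeping (O : Oracle) (G : LoopGraph n) (q : Fin n → ℝ) (k j : ℕ) (s : Store) : Prop
    extends Swept G q j s where
  le_k : j ≤ k
  tree : IsTree (Wins O s) (s.narr 4) k 0
  leaves : Leaves G q k j s
  inner : s.nreg 18 = ∑ u ∈ G.sweep q j, ∑ w ∈ G.sweep q j, G.mult u w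

theorem Swept.congr {G : LoopGraph n} {q : Fin n → ℝ} {j : ℕ} {s s' : Store} (h : Swept G q j s)
    (h0 : s'.narr 0 = s.narr 0) (h5 : s'.narr 5 = s.narr 5) (e8 : s'.nreg 8 = s.nreg 8)
    (e17 : s'.nreg 17 = s.nreg 17) (e5 : s'.nreg 5 = s.nreg 5) (e4 : s'.rreg 4 = s.rreg 4)
    (e16 : s'.nreg 16 = s.nreg 16) : Swept G q j s' := by
  refine ⟨?_, ?_, ?_, ?_, ?_, ?_⟩
  · rw [h0]; exact h.out
  · rw [h5, e8]; exact h.stamp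
  · rw [h5, e8]; exact h.le
  · rw [e17]; exact h.vol
  · rw [e5, e4]; exact h.slope
  · rw [e16]; exact h.count

theorem sweepStep_spec {G : LoopGraph n} (hd : ∀ u, 0 < G.deg u) {adj : Fin n → List (Fin n)}
    (hadj : G.IsAdjList adj) {s : Store} {q : Fin n → ℝ} {k j : ℕ} (hk : Ranked G q k s)
    (h9 : s.nreg 9 = k) (h3 : s.nreg 3 = G.vol Finset.univ) (hj : j < k)
    (h : Sweeping (oracle adj) G q k j s) :
    Runs (oracle adj) sweepStep s fun s' T =>
      (T + 60 * G.vol (G.sweep q j) ≤ 60 * G.vol (G.sweep q (j + 1)) + 120 * Nat.size k + 180 ∧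
      Sweeping (oracle adj) G q k (j + 1) s' ∧
      (Passes G (s.rreg 0) (s.rreg 3) (s.nreg 5) q (j + 1) → s'.nreg 20 = 1) ∧
      (¬ Passes G (s.rreg 0) (s.rreg 3) (s.nreg 5) q (j + 1) → s'.nreg 20 = s.nreg 20)) ∧
      Frame sweepStep s s' := by
  refine Runs.frame ?_
  rw [sweepStep, runs_seq]
  refine Runs.mono (pick_spec hadj hk h9 hj h.tree h.leaves) ?_
  rintro s1 T1 ⟨⟨hT1, ht1, hl1, u, hu, hr⟩, hf1⟩
  rw [runs_seq, runs_setN, runs_seq]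
  simp only [NExp.eval, NExp.cost]
  refine Runs.mono (tally_spec hadj (u := u) ?_ ?_) ?_
  · simpa using hu
  · simp
  rintro s2 T2 ⟨⟨hT2, h18⟩, hf2⟩
  have hsw : Swept G q j s2 := h.toSwept.congr
    (by rw [hf2.na 0 rfl]; exact hf1.na 0 rfl) (by rw [hf2.na 5 rfl]; exact hf1.na 5 rfl)
    (by rw [hf2.n 8 rfl]; simpa using hf1.n 8 rfl) (by rw [hf2.n 17 rfl]; simpa using hf1.n 17 rfl)
    (by rw [hf2.n 5 rfl]; simpa using hf1.n 5 rfl) (by rw [hf2.r 4 rfl]; simpa using hf1.r 4 rfl)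
    (by rw [hf2.n 16 rfl]; simpa using hf1.n 16 rfl)
  have e22 : s2.nreg 22 = u := by rw [hf2.n 22 rfl]; simpa using hu
  have er1 : s2.rarr 1 = s.rarr 1 := by rw [hf2.ra 1 rfl]; exact hf1.ra 1 rfl
  rw [runs_seq]
  refine Runs.mono (append_spec hd hadj hsw e22 hr ?_) ?_
  · rw [er1]; exact hk.val u (mem_sweep.2 (by omega))
  rintro s3 T3 ⟨⟨hT3, hsw3⟩, hf3⟩
  have e3 : s3.nreg 3 = s.nreg 3 := by
    rw [hf3.n 3 rfl, hf2.n 3 rfl]; simpa using hf1.n 3 rfl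
  have e5 : s3.nreg 5 = s.nreg 5 := by
    rw [hf3.n 5 rfl, hf2.n 5 rfl]; simpa using hf1.n 5 rfl
  have e20 : s3.nreg 20 = s.nreg 20 := by
    rw [hf3.n 20 rfl, hf2.n 20 rfl]; simpa using hf1.n 20 rfl
  have er0 : s3.rreg 0 = s.rreg 0 := by
    rw [hf3.r 0 rfl, hf2.r 0 rfl]; simpa using hf1.r 0 rfl
  have er3 : s3.rreg 3 = s.rreg 3 := by
    rw [hf3.r 3 rfl, hf2.r 3 rfl]; simpa using hf1.r 3 rfl
  have hins : G.sweep q (j + 1) = insert u (G.sweep q j) := sweep_succ hr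
  have hinner : s3.nreg 18 = ∑ x ∈ G.sweep q (j + 1), ∑ w ∈ G.sweep q (j + 1), G.mult x w := by
    rw [hf3.n 18 rfl, h18, hins, inner_insert G (notMem_sweep_rank hr), ← h.inner]
    have a5 : s1.narr 5 = s.narr 5 := hf1.na 5 rfl
    have a8 : s1.nreg 8 = s.nreg 8 := hf1.n 8 rfl
    have a18 : s1.nreg 18 = s.nreg 18 := hf1.n 18 rfl
    simp only [Function.update_of_ne (show (18 : ℕ) ≠ 12 by decide),
      Function.update_of_ne (show (8 : ℕ) ≠ 12 by decide), a5, a8, a18, h.stamp]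
  refine Runs.mono (test_spec (oracle adj) (G := G) (q := q) (j := j + 1)
    ⟨u, hins ▸ Finset.mem_insert_self _ _⟩ (e3.trans h3) hsw3.vol hinner hsw3.slope) ?_
  rintro s4 T4 ⟨⟨hT4, hp, hnp⟩, hf4⟩
  rw [er0, er3, e5] at hp hnp
  rw [e20] at hnp
  refine ⟨?_, ⟨?_, hj, ?_, ?_, ?_⟩, hp, hnp⟩
  · have := G.vol_sweep_succ hr
    omega
  · exact hsw3.congr (hf4.na 0 rfl) (hf4.na 5 rfl) (hf4.n 8 rfl) (hf4.n 17 rfl) (hf4.n 5 rfl)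
      (hf4.r 4 rfl) (hf4.n 16 rfl)
  · have b1 : s4.narr 1 = s1.narr 1 := by rw [hf4.na 1 rfl, hf3.na 1 rfl, hf2.na 1 rfl]
    have b2 : s4.rarr 1 = s1.rarr 1 := by rw [hf4.ra 1 rfl, hf3.ra 1 rfl, hf2.ra 1 rfl]
    have b4 : s4.narr 4 = s1.narr 4 := by rw [hf4.na 4 rfl, hf3.na 4 rfl, hf2.na 4 rfl]
    rw [Wins.congr b1 b2, b4]
    exact ht1
  · have b1 : s4.narr 1 = s1.narr 1 := by rw [hf4.na 1 rfl, hf3.na 1 rfl, hf2.na 1 rfl]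
    have b4 : s4.narr 4 = s1.narr 4 := by rw [hf4.na 4 rfl, hf3.na 4 rfl, hf2.na 4 rfl]
    intro a ha w
    rw [b1, b4]
    exact hl1 a ha w
  · rw [hf4.n 18 rfl]
    exact hinner

/-- The sweep. -/
def sweepLoop : Cmd :=
  .loop (.and (.not (.leN (.reg 9) (.reg 16))) (.leN (.reg 20) (.lit 0))) sweepStep

theorem sweepLoop_spec {G : LoopGraph n} (hd : ∀ u, 0 < G.deg u) {adj : Fin n → List (Fin n)}
    (hadj : G.IsAdjList adj) {s : Store} {q : Fin n → ℝ} {k : ℕ} (hk : Ranked G q k s)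
    (h9 : s.nreg 9 = k) (h3 : s.nreg 3 = G.vol Finset.univ) (h20 : s.nreg 20 = 0)
    (h : Sweeping (oracle adj) G q k 0 s) :
    Runs (oracle adj) sweepLoop s fun s' T =>
      (T ≤ 60 * G.vol (G.sweep q k) + (120 * Nat.size k + 200) * k + 20 ∧
      ∃ j ≤ k, Swept G q j s' ∧
        ((s'.nreg 20 = 1 ∧ 1 ≤ j ∧ Passes G (s.rreg 0) (s.rreg 3) (s.nreg 5) q j) ∨
        (s'.nreg 20 = 0 ∧ ∀ i, 1 ≤ i → i ≤ k →
          ¬ Passes G (s.rreg 0) (s.rreg 3) (s.nreg 5) q i))) ∧ Frame sweepLoop s s' := by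
  -- The potential has a volume part, which pays for scanning adjacency lists, and a part per
  -- remaining vertex, which pays for the climb in the tree.
  refine Runs.mono (runs_loop (O := oracle adj) (fun s' => ∃ j,
    Sweeping (oracle adj) G q k j s' ∧
      ((s'.nreg 20 = 1 ∧ 1 ≤ j ∧ Passes G (s.rreg 0) (s.rreg 3) (s.nreg 5) q j) ∨
        (s'.nreg 20 = 0 ∧ ∀ i, 1 ≤ i → i ≤ j →
          ¬ Passes G (s.rreg 0) (s.rreg 3) (s.nreg 5) q i)))
    (fun s' => 60 * (G.vol (G.sweep q k) - s'.nreg 17) +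
      (120 * Nat.size k + 200) * (k - s'.nreg 16)) ?_ ?_) ?_
  · rintro s' hfr ⟨j, hs, hcase⟩ hg
    have e9 : s'.nreg 9 = k := (hfr.n 9 rfl).trans h9
    have e3 : s'.nreg 3 = G.vol Finset.univ := (hfr.n 3 rfl).trans h3
    have e5 : s'.nreg 5 = s.nreg 5 := hfr.n 5 rfl
    have er0 : s'.rreg 0 = s.rreg 0 := hfr.r 0 rfl
    have er3 : s'.rreg 3 = s.rreg 3 := hfr.r 3 rfl
    simp only [BExp.Holds, NExp.eval, e9, hs.count, not_le] at hg
    refine Runs.mono (sweepStep_spec hd hadj (hk.congr (hfr.na 1 rfl) (hfr.ra 1 rfl)) e9 e3 hg.1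
      hs) ?_
    rintro s'' T ⟨⟨hT, hs', hp, hnp⟩, -⟩
    rw [er0, er3, e5] at hp hnp
    refine ⟨⟨j + 1, hs', ?_⟩, ?_⟩
    · rcases hcase with h1 | ⟨h1, h2⟩
      · omega
      · by_cases hP : Passes G (s.rreg 0) (s.rreg 3) (s.nreg 5) q (j + 1)
        · exact Or.inl ⟨hp hP, by omega, hP⟩
        · refine Or.inr ⟨(hnp hP).trans h1, fun i hi1 hi2 => ?_⟩
          rcases Nat.lt_succ_iff_lt_or_eq.1 (Nat.lt_succ_of_le hi2) with hi | rfl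
          · exact h2 i hi1 (by omega)
          · exact hP
    · rw [hs'.vol, hs'.count, hs.vol, hs.count]
      have m1 := G.vol_sweep_mono q (show j + 1 ≤ k from hg.1)
      have m2 := G.vol_sweep_mono q (show j ≤ j + 1 by omega)
      obtain ⟨d, hd'⟩ : ∃ d, k = j + 1 + d := ⟨k - (j + 1), by omega⟩
      have e1 : k - (j + 1) = d := by omega
      have e2 : k - j = d + 1 := by omega
      rw [e1, e2, mul_add]
      simp only [BExp.cost, NExp.cost]
      omega
  · exact ⟨0, h, Or.inr ⟨h20, fun i h1 h2 => by omega⟩⟩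
  · rintro s' T ⟨⟨⟨j, hs, hcase⟩, hg, hT⟩, hfr⟩
    have e9 : s'.nreg 9 = k := (hfr.n 9 rfl).trans h9
    simp only [BExp.Holds, NExp.eval, e9, hs.count, not_and, not_le] at hg
    refine ⟨⟨?_, j, hs.le_k, hs.toSwept, ?_⟩, hfr⟩
    · simp only [BExp.cost, NExp.cost, h.vol, h.count, G.sweep_zero, Nat.sub_zero] at hT
      simp only [LoopGraph.vol, Finset.sum_empty, Nat.sub_zero] at hT
      simp only [LoopGraph.vol]
      omega
    · rcases hcase with h1 | ⟨h1, h2⟩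
      · exact Or.inl h1
      · refine Or.inr ⟨h1, fun i hi1 hi2 => h2 i hi1 ?_⟩
        by_contra hc
        have := hg (by omega)
        omega

/-! ### A round -/

/-- One round of the algorithm. -/
def round : Cmd :=
  .seq (.setN 8 (.add (.reg 8) (.lit 1))) <|
  .seq spread <|
  .seq truncate <|
  .seq build <|
  .seq (.setN 16 (.lit 0)) <|
  .seq (.setN 17 (.lit 0)) <|
  .seq (.setN 18 (.lit 0))
  sweepLoop

theorem Sparse.congr {s s' : Store} {r : Fin n → ℝ} (h : Sparse n s r)
    (h1 : s'.narr 1 = s.narr 1) (h9 : s'.nreg 9 = s.nreg 9) (h0 : s'.rarr 0 = s.rarr 0) :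
    Sparse n s' r := by
  refine ⟨?_, ?_⟩
  · rw [h1, h9]; exact h.enum
  · rw [h1, h9, h0]; exact h.val

open Classical in
/-- The size of the support of a vector. -/
noncomputable def suppCard (r : Fin n → ℝ) : ℕ := (Finset.univ.filter fun u => r u ≠ 0).card

theorem suppCard_le_suppVol {G : LoopGraph n} (hd : ∀ u, 0 < G.deg u) (r : Fin n → ℝ) :
    suppCard r ≤ suppVol G r := by
  classical
  rw [suppCard, suppVol, LoopGraph.vol, Finset.card_eq_sum_ones]
  exact Finset.sum_le_sum fun u _ => hd u

theorem Sparse.nreg_eq {s : Store} {r : Fin n → ℝ} (h : Sparse n s r) :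
    s.nreg 9 = suppCard r := by
  classical
  rw [suppCard, h.enum.card_eq]

/-- What the memory tells about the sweep over `q` with `k` sets. -/
def Result (G : LoopGraph n) (φ c x : ℝ) (q : Fin n → ℝ) (k : ℕ) (s : Store) : Prop :=
  (s.nreg 20 = 1 ∧ 1 ≤ s.nreg 16 ∧ s.nreg 16 ≤ k ∧ Passes G φ c x q (s.nreg 16) ∧
    Enum n (s.narr 0) (s.nreg 16) (· ∈ G.sweep q (s.nreg 16))) ∨
  (s.nreg 20 = 0 ∧ ∀ i, 1 ≤ i → i ≤ k → ¬ Passes G φ c x q i)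

/-- Spreading is charged to the volume of the old support, sweeping to that of the new support; `B`
bounds both. Only the tournament contributes the factor `σ`, a bound for the number of binary digits
of the list length. -/
theorem round_spec {G : LoopGraph n} (hd : ∀ u, 0 < G.deg u) {adj : Fin n → List (Fin n)}
    (hadj : G.IsAdjList adj) {s : Store} {r : Fin n → ℝ} {B σ : ℕ} (h : Sparse n s r)
    (hst3 : ∀ w : Fin n, s.narr 3 w ≤ s.nreg 8) (hst5 : ∀ w : Fin n, s.narr 5 w ≤ s.nreg 8)
    (h3 : s.nreg 3 = G.vol Finset.univ) (h5 : 0 < s.nreg 5) (h20 : s.nreg 20 = 0)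
    (hε : 0 < s.rreg 2) (hσ : n < 2 ^ σ) (hB : suppVol G r ≤ B)
    (hB' : suppVol G (G.trunc (s.rreg 2) (G.walkMatrix.mulVec r)) ≤ B) :
    Runs (oracle adj) round s fun s' T => (T ≤ (670 + 120 * σ) * B + 150 ∧
      Sparse n s' (G.trunc (s.rreg 2) (G.walkMatrix.mulVec r)) ∧
      (∀ w : Fin n, s'.narr 3 w ≤ s'.nreg 8) ∧ (∀ w : Fin n, s'.narr 5 w ≤ s'.nreg 8) ∧
      s'.nreg 8 = s.nreg 8 + 1 ∧
      Result G (s.rreg 0) (s.rreg 3) (s.nreg 5) (G.walkMatrix.mulVec r)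
        (suppCard (G.trunc (s.rreg 2) (G.walkMatrix.mulVec r))) s') ∧ Frame round s s' := by
  refine Runs.frame ?_
  set q := G.walkMatrix.mulVec r with hq
  rw [round, runs_seq, runs_setN, runs_seq]
  simp only [NExp.eval, NExp.cost]
  refine Runs.mono (spread_spec hd hadj (r := r) ?_ ?_) ?_
  · exact h.congr rfl (by simp) rfl
  · intro w
    simpa using Nat.lt_succ_of_le (hst3 w)
  rintro s1 T1 ⟨⟨hT1, hh1, h14⟩, hf1⟩
  rw [← hq] at hh1
  have c2 : s1.rreg 2 = s.rreg 2 := hf1.r 2 rfl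
  have c8 : s1.nreg 8 = s.nreg 8 + 1 := by rw [hf1.n 8 rfl]; simp
  rw [runs_seq]
  refine Runs.mono (truncate_spec hd hadj hh1 (by rw [c2]; exact hε)) ?_
  rintro s2 T2 ⟨⟨hT2, hs2⟩, hf2⟩
  rw [c2] at hs2
  set r' := G.trunc (s.rreg 2) q with hr'
  have hk2 := hs2.nreg_eq
  set k := suppCard r' with hk
  have hkB : k ≤ B := (suppCard_le_suppVol hd r').trans hB'
  -- The survivors are exactly the first `k` vertices in the order of `q`, so sorting them alone
  -- produces the first `k` sweep sets of `q`.
  have hset : ∀ u, u ∈ G.sweep q k ↔ r' u ≠ 0 := fun u => by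
    classical
    rw [hk, suppCard, hr', ← G.filter_trunc_ne_zero_eq_sweep hd hε q]
    simp
  have hkn : k ≤ n := by
    classical
    rw [hk, suppCard]
    exact (Finset.card_le_univ _).trans (Fintype.card_fin n).le
  have hvolk : G.vol (G.sweep q k) = suppVol G r' := by
    classical
    rw [suppVol]
    congr 1
    ext u
    rw [hset]
    simp
  have hrank : Ranked G q k s2 := by
    refine ⟨hkn, ?_, fun u hu => ?_⟩
    · rw [← hk2]
      exact hs2.enum.congr (fun _ _ => rfl) fun u => by rw [hk2]; exact hset u
    · rw [hf2.ra 1 rfl]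
      have hv := hh1.val u
      rw [hset, hr', G.trunc_ne_zero hd hε] at hu
      split_ifs at hv with hc
      · exact hv
      · have : (0 : ℝ) < G.deg u := by exact_mod_cast hd u
        have : 0 < (G.deg u : ℝ) * s.rreg 2 := by positivity
        linarith
  rw [runs_seq]
  refine Runs.mono (build_spec (oracle adj) s2) ?_
  rintro s3 T3 ⟨⟨hT3, ht3, hl3⟩, hf3⟩
  rw [hk2] at hT3 ht3 hl3
  simp only [runs_seq, runs_setN, NExp.eval, NExp.cost]
  have b3 : s3.nreg 3 = s.nreg 3 := by
    rw [hf3.n 3 rfl, hf2.n 3 rfl, hf1.n 3 rfl]; simp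
  have b5 : s3.nreg 5 = s.nreg 5 := by
    rw [hf3.n 5 rfl, hf2.n 5 rfl, hf1.n 5 rfl]; simp
  have b8 : s3.nreg 8 = s.nreg 8 + 1 := by rw [hf3.n 8 rfl, hf2.n 8 rfl, c8]
  have b9 : s3.nreg 9 = k := by rw [hf3.n 9 rfl, hk2]
  have b20 : s3.nreg 20 = 0 := by
    rw [hf3.n 20 rfl, hf2.n 20 rfl, hf1.n 20 rfl]; simpa using h20
  have d0 : s3.rreg 0 = s.rreg 0 := by rw [hf3.r 0 rfl, hf2.r 0 rfl, hf1.r 0 rfl]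
  have d3 : s3.rreg 3 = s.rreg 3 := by rw [hf3.r 3 rfl, hf2.r 3 rfl, hf1.r 3 rfl]
  have e1 : s3.narr 1 = s2.narr 1 := hf3.na 1 rfl
  have f1 : s3.rarr 1 = s2.rarr 1 := hf3.ra 1 rfl
  have e5 : s3.narr 5 = s.narr 5 := by rw [hf3.na 5 rfl, hf2.na 5 rfl, hf1.na 5 rfl]
  have e3 : s3.narr 3 = s1.narr 3 := by rw [hf3.na 3 rfl, hf2.na 3 rfl]
  have hv0 : G.vol (G.sweep q 0) = 0 := by rw [sweep_zero]; rfl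
  refine Runs.mono (sweepLoop_spec hd hadj (q := q) (k := k) ?_ ?_ ?_ ?_ ?_) ?_
  · exact hrank.congr e1 f1
  · simpa using b9
  · simpa using b3.trans h3
  · simpa using b20
  · refine ⟨⟨?_, ?_, ?_, ?_, ?_, ?_⟩, Nat.zero_le _, ?_, ?_, ?_⟩
    · exact Enum.nil _ fun u => by rw [sweep_zero]; exact Finset.notMem_empty u
    · intro u
      simp only [Function.update_of_ne (show (8 : ℕ) ≠ 18 by decide),
        Function.update_of_ne (show (8 : ℕ) ≠ 17 by decide),
        Function.update_of_ne (show (8 : ℕ) ≠ 16 by decide), e5, b8, sweep_zero]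
      have := hst5 u
      exact ⟨fun hc => by omega, fun hc => absurd hc (Finset.notMem_empty u)⟩
    · intro u
      simp only [Function.update_of_ne (show (8 : ℕ) ≠ 18 by decide),
        Function.update_of_ne (show (8 : ℕ) ≠ 17 by decide),
        Function.update_of_ne (show (8 : ℕ) ≠ 16 by decide), e5, b8]
      exact (hst5 u).trans (Nat.le_succ _)
    · simp [hv0]
    · intro hc
      rw [hv0] at hc
      simp only [Function.update_of_ne (show (5 : ℕ) ≠ 18 by decide),
        Function.update_of_ne (show (5 : ℕ) ≠ 17 by decide),
        Function.update_of_ne (show (5 : ℕ) ≠ 16 by decide), b5] at hc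
      omega
    · simp
    · have : ∀ f, Wins (oracle adj) { s3 with nreg := f } = Wins (oracle adj) s2 := fun f =>
        Wins.congr e1 f1
      rw [this]
      exact ht3
    · intro a ha u _
      rw [sweep_zero, if_neg (Finset.notMem_empty u)]
      exact hl3 a ha
    · simp [sweep_zero]
  rintro s4 T4 ⟨⟨hT4, j, hj, hsw, hres⟩, hf4⟩
  have g8 : s4.nreg 8 = s.nreg 8 + 1 := by rw [hf4.n 8 rfl]; simpa using b8
  simp only [Function.update_of_ne (show (5 : ℕ) ≠ 18 by decide),
    Function.update_of_ne (show (5 : ℕ) ≠ 17 by decide),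
    Function.update_of_ne (show (5 : ℕ) ≠ 16 by decide), b5, d0, d3] at hres
  refine ⟨?_, ?_, ?_, hsw.le, g8, ?_⟩
  · have hsz : Nat.size k ≤ σ := Nat.size_le.2 (hkn.trans_lt hσ)
    have m1 : (120 * Nat.size k + 200) * k ≤ (120 * σ + 200) * B := Nat.mul_le_mul (by omega) hkB
    rw [hvolk] at hT4
    have m2 : (670 + 120 * σ) * B = (120 * σ + 200) * B + 470 * B := by ring
    rw [m2]
    omega
  · refine hs2.congr ?_ ?_ ?_
    · rw [hf4.na 1 rfl, e1]
    · rw [hf4.n 9 rfl, hk2]; simpa using b9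
    · rw [hf4.ra 0 rfl]; exact hf3.ra 0 rfl
  · intro w
    rw [hf4.na 3 rfl, g8, e3, ← c8]
    exact hh1.le w
  · unfold Result
    rw [hsw.count]
    rcases hres with ⟨a1, a2, a3⟩ | a1
    · exact Or.inl ⟨a1, a2, hj, a3, hsw.out⟩
    · exact Or.inr a1

/-- All rounds. -/
def rounds : Cmd :=
  .loop (.and (.not (.leN (.reg 7) (.reg 8))) (.leN (.reg 20) (.lit 0))) round

theorem rounds_spec {G : LoopGraph n} (hd : ∀ u, 0 < G.deg u) {adj : Fin n → List (Fin n)}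
    (hadj : G.IsAdjList adj) {φ : ℝ} {b : ℕ} {v : Fin n} {s : Store} {B σ : ℕ}
    (h : Sparse n s (G.rVec φ b v 0)) (hst3 : ∀ w : Fin n, s.narr 3 w = 0)
    (hst5 : ∀ w : Fin n, s.narr 5 w = 0) (h3 : s.nreg 3 = G.vol Finset.univ)
    (h5 : s.nreg 5 = 2 ^ b) (h7 : s.nreg 7 = G.tLast φ) (h8 : s.nreg 8 = 0) (h20 : s.nreg 20 = 0)
    (hε0 : 0 < G.eps φ b) (hε : s.rreg 2 = G.eps φ b) (hφ : s.rreg 0 = φ)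
    (hc : s.rreg 3 = 1 / (140 * ((G.ell : ℝ) + 2) * 2 ^ b)) (hσ : n < 2 ^ σ)
    (hB : ∀ t, suppVol G (G.rVec φ b v t) ≤ B) :
    Runs (oracle adj) rounds s fun s' T => (T ≤ ((670 + 120 * σ) * B + 170) * G.tLast φ + 20 ∧
      ((s'.nreg 20 = 0 ∧ ∀ t, 1 ≤ t → t ≤ G.tLast φ →
        ¬ ∃ j, 1 ≤ j ∧ j ≤ G.survivors φ b v t ∧ G.StopCond φ b v t j) ∨
      (s'.nreg 20 = 1 ∧ ∃ t, 1 ≤ t ∧ t ≤ G.tLast φ ∧ (∀ i, 1 ≤ i → i < t →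
        ¬ ∃ j, 1 ≤ j ∧ j ≤ G.survivors φ b v i ∧ G.StopCond φ b v i j) ∧
        1 ≤ s'.nreg 16 ∧ s'.nreg 16 ≤ G.survivors φ b v t ∧ G.StopCond φ b v t (s'.nreg 16) ∧
        Enum n (s'.narr 0) (s'.nreg 16) (· ∈ G.sweep (G.qVec φ b v t) (s'.nreg 16))))) ∧
      Frame rounds s s' := by
  refine Runs.mono (runs_loop (O := oracle adj) (fun s' =>
    s'.nreg 8 ≤ G.tLast φ ∧ Sparse n s' (G.rVec φ b v (s'.nreg 8)) ∧
    (∀ w : Fin n, s'.narr 3 w ≤ s'.nreg 8) ∧ (∀ w : Fin n, s'.narr 5 w ≤ s'.nreg 8) ∧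
    ((s'.nreg 20 = 0 ∧ ∀ t, 1 ≤ t → t ≤ s'.nreg 8 →
        ¬ ∃ j, 1 ≤ j ∧ j ≤ G.survivors φ b v t ∧ G.StopCond φ b v t j) ∨
      (s'.nreg 20 = 1 ∧ ∃ t, 1 ≤ t ∧ t ≤ G.tLast φ ∧ (∀ i, 1 ≤ i → i < t →
        ¬ ∃ j, 1 ≤ j ∧ j ≤ G.survivors φ b v i ∧ G.StopCond φ b v i j) ∧
        1 ≤ s'.nreg 16 ∧ s'.nreg 16 ≤ G.survivors φ b v t ∧ G.StopCond φ b v t (s'.nreg 16) ∧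
        Enum n (s'.narr 0) (s'.nreg 16) (· ∈ G.sweep (G.qVec φ b v t) (s'.nreg 16)))))
    (fun s' => ((670 + 120 * σ) * B + 170) * (G.tLast φ - s'.nreg 8)) ?_ ?_) ?_
  · rintro s' hfr ⟨ht, hsp, hs3, hs5, hcase⟩ hg
    have e3 : s'.nreg 3 = G.vol Finset.univ := (hfr.n 3 rfl).trans h3
    have e5 : s'.nreg 5 = 2 ^ b := (hfr.n 5 rfl).trans h5
    have e7 : s'.nreg 7 = G.tLast φ := (hfr.n 7 rfl).trans h7
    have d0 : s'.rreg 0 = φ := (hfr.r 0 rfl).trans hφ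
    have d2 : s'.rreg 2 = G.eps φ b := (hfr.r 2 rfl).trans hε
    have d3 := (hfr.r 3 rfl).trans hc
    simp only [BExp.Holds, NExp.eval, e7, not_le] at hg
    obtain ⟨h20', hno⟩ := hcase.resolve_right fun h => by omega
    refine Runs.mono (round_spec hd hadj (B := B) (σ := σ) hsp hs3 hs5 e3 (by rw [e5]; positivity)
      h20' (by rw [d2]; exact hε0) hσ (hB _) (by rw [d2]; exact hB (s'.nreg 8 + 1))) ?_
    rintro s'' T ⟨⟨hT, hsp', hs3', hs5', h8', hres⟩, -⟩
    rw [d2] at hsp' hres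
    rw [d0, d3, e5] at hres
    have hcast : (((2 ^ b : ℕ) : ℝ)) = 2 ^ b := by push_cast; rfl
    rw [hcast] at hres
    refine ⟨⟨by omega, by rw [h8']; exact hsp', hs3', hs5', ?_⟩, ?_⟩
    · rcases hres with ⟨a1, a2, a3, a4, a5⟩ | ⟨a1, a2⟩
      · refine Or.inr ⟨a1, s'.nreg 8 + 1, by omega, by omega, fun i hi1 hi2 => hno i hi1 (by omega),
          a2, a3, a4, a5⟩
      · refine Or.inl ⟨a1, fun t ht1 ht2 => ?_⟩
        rw [h8'] at ht2
        rcases Nat.lt_succ_iff_lt_or_eq.1 (Nat.lt_succ_of_le ht2) with h' | rfl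
        · exact hno t ht1 (by omega)
        · rintro ⟨j, hj1, hj2, hj3⟩
          exact a2 j hj1 hj2 hj3
    · obtain ⟨d, hd'⟩ : ∃ d, G.tLast φ = s'.nreg 8 + 1 + d :=
        ⟨G.tLast φ - (s'.nreg 8 + 1), by omega⟩
      have e1 : G.tLast φ - s''.nreg 8 = d := by omega
      have e2 : G.tLast φ - s'.nreg 8 = d + 1 := by omega
      rw [e1, e2, mul_add]
      simp only [BExp.cost, NExp.cost]
      omega
  · refine ⟨by omega, by rw [h8]; exact h, fun w => by rw [hst3]; omega,
      fun w => by rw [hst5]; omega, Or.inl ⟨h20, fun t h1 h2 => by omega⟩⟩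
  · rintro s' T ⟨⟨⟨ht, -, -, -, hcase⟩, hg, hT⟩, hfr⟩
    have e7 : s'.nreg 7 = G.tLast φ := (hfr.n 7 rfl).trans h7
    simp only [BExp.Holds, NExp.eval, e7, not_and, not_le] at hg
    refine ⟨⟨?_, ?_⟩, hfr⟩
    · simp only [h8, Nat.sub_zero, BExp.cost, NExp.cost] at hT
      omega
    · rcases hcase with ⟨h1, h2⟩ | h1
      · refine Or.inl ⟨h1, fun t ht1 ht2 => h2 t ht1 ?_⟩
        by_contra hc'
        have := hg (by omega)
        omega
      · exact Or.inr h1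

/-! ### The parameters -/

/-- Register `5` becomes `2 ^ b`. -/
def setPow : Cmd :=
  .seq (.setN 5 (.lit 1)) <|
  .seq (.setN 10 (.lit 0)) <|
  .loop (.not (.leN (.reg 1) (.reg 10)))
    (.seq (.setN 5 (.add (.reg 5) (.reg 5))) (.setN 10 (.add (.reg 10) (.lit 1))))

theorem setPow_spec (O : Oracle) (s : Store) : Runs O setPow s fun s' T =>
    (T ≤ 20 * s.nreg 1 + 20 ∧ s'.nreg 5 = 2 ^ s.nreg 1) ∧ Frame setPow s s' := by
  refine Runs.frame ?_
  rw [setPow, runs_seq, runs_setN, runs_seq, runs_setN]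
  simp only [NExp.eval, NExp.cost]
  refine Runs.mono (runs_loop (O := O) (fun s' => s'.nreg 10 ≤ s.nreg 1 ∧
    s'.nreg 5 = 2 ^ s'.nreg 10) (fun s' => 20 * (s.nreg 1 - s'.nreg 10)) ?_ ?_) ?_
  · rintro s' hfr ⟨hi, hp⟩ hg
    have e1 : s'.nreg 1 = s.nreg 1 := by rw [hfr.n 1 rfl]; simp
    simp only [BExp.Holds, NExp.eval, e1, not_le] at hg
    simp only [runs_seq, runs_setN, NExp.eval, NExp.cost, BExp.cost, Function.update_self,
      Function.update_of_ne (show (10 : ℕ) ≠ 5 by decide),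
      Function.update_of_ne (show (5 : ℕ) ≠ 10 by decide)]
    exact ⟨⟨hg, by rw [hp]; ring⟩, by omega⟩
  · simp
  · rintro s' T ⟨⟨⟨hi, hp⟩, hg, hT⟩, hfr⟩
    have e1 : s'.nreg 1 = s.nreg 1 := by rw [hfr.n 1 rfl]; simp
    simp only [BExp.Holds, NExp.eval, e1, not_not] at hg
    simp only [BExp.cost, NExp.cost, Function.update_self] at hT
    refine ⟨by omega, ?_⟩
    rw [hp, le_antisymm hi hg]

/-- Register `4` becomes `⌈log₂ m⌉`. -/
def setEll : Cmd :=
  .seq (.setN 21 (.lit 2)) <|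
  .seq (.setN 4 (.lit 0)) <|
  .loop (.not (.leN (.reg 3) (.reg 21)))
    (.seq (.setN 21 (.add (.reg 21) (.reg 21))) (.setN 4 (.add (.reg 4) (.lit 1))))

/-- The rounded logarithm is thereby characterised by comparing natural numbers, and repeated
doubling computes it. -/
theorem ell_le_iff (G : LoopGraph n) (hV : 0 < G.vol Finset.univ) (k : ℕ) :
    G.ell ≤ k ↔ G.vol Finset.univ ≤ 2 * 2 ^ k := by
  have h1 := G.half_vol_le_two_pow_ell
  constructor
  · intro h
    have h2 : (2 : ℝ) ^ G.ell ≤ 2 ^ k := pow_le_pow_right₀ (by norm_num) h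
    have : (G.vol Finset.univ : ℝ) ≤ 2 * 2 ^ k := by linarith
    exact_mod_cast this
  · intro h
    by_contra hc
    have h2 := G.two_pow_lt_half_vol hV (not_le.1 hc)
    have : (G.vol Finset.univ : ℝ) ≤ 2 * 2 ^ k := by exact_mod_cast h
    linarith

theorem setEll_spec (O : Oracle) {G : LoopGraph n} {s : Store} (h3 : s.nreg 3 = G.vol Finset.univ)
    (hV : 0 < G.vol Finset.univ) : Runs O setEll s fun s' T =>
    (T ≤ 20 * G.ell + 20 ∧ s'.nreg 4 = G.ell) ∧ Frame setEll s s' := by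
  refine Runs.frame ?_
  rw [setEll, runs_seq, runs_setN, runs_seq, runs_setN]
  simp only [NExp.eval, NExp.cost]
  refine Runs.mono (runs_loop (O := O) (fun s' => s'.nreg 4 ≤ G.ell ∧
    s'.nreg 21 = 2 * 2 ^ s'.nreg 4) (fun s' => 20 * (G.ell - s'.nreg 4)) ?_ ?_) ?_
  · rintro s' hfr ⟨hi, hp⟩ hg
    have e3 : s'.nreg 3 = G.vol Finset.univ := by rw [hfr.n 3 rfl]; simpa using h3
    simp only [BExp.Holds, NExp.eval, e3, hp, ← ell_le_iff G hV, not_le] at hg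
    simp only [runs_seq, runs_setN, NExp.eval, NExp.cost, BExp.cost, Function.update_self,
      Function.update_of_ne (show (4 : ℕ) ≠ 21 by decide),
      Function.update_of_ne (show (21 : ℕ) ≠ 4 by decide)]
    exact ⟨⟨hg, by rw [hp]; ring⟩, by omega⟩
  · simp
  · rintro s' T ⟨⟨⟨hi, hp⟩, hg, hT⟩, hfr⟩
    have e3 : s'.nreg 3 = G.vol Finset.univ := by rw [hfr.n 3 rfl]; simpa using h3
    simp only [BExp.Holds, NExp.eval, e3, hp, ← ell_le_iff G hV, not_not] at hg
    simp only [BExp.cost, NExp.cost, Function.update_self] at hT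
    exact ⟨by omega, le_antisymm hi hg⟩

/-- Register `6` becomes `t₁`. -/
def setTOne : Cmd :=
  .seq (.setR 1 (.mul (.div (.ofNat (.lit 2)) (.mul (.reg 0) (.reg 0)))
    (.add (.log (.mul (.ofNat (.lit 200)) (.add (.ofNat (.reg 4)) (.ofNat (.lit 2)))))
      (.div (.log (.div (.ofNat (.reg 3)) (.ofNat (.lit 2)))) (.ofNat (.lit 2)))))) <|
  .seq (.setN 6 (.lit 0)) <|
  .loop (.not (.leR (.reg 1) (.ofNat (.reg 6)))) (.setN 6 (.add (.reg 6) (.lit 1)))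

/-- Reals cannot be rounded, so `t₁` is found by counting up, at a cost proportional to `t₁`. No
square root is needed, since `log √m` is half of `log m`. -/
theorem setTOne_spec (O : Oracle) {G : LoopGraph n} {s : Store}
    (h3 : s.nreg 3 = G.vol Finset.univ) (h4 : s.nreg 4 = G.ell) (hV : 0 < G.vol Finset.univ) :
    Runs O setTOne s fun s' T =>
    (T ≤ 20 * G.tOne (s.rreg 0) + 50 ∧ s'.nreg 6 = G.tOne (s.rreg 0)) ∧ Frame setTOne s s' := by
  refine Runs.frame ?_
  have hx : ((2 : ℕ) : ℝ) / (s.rreg 0 * s.rreg 0) * (Real.log (((200 : ℕ) : ℝ) *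
      ((s.nreg 4 : ℝ) + ((2 : ℕ) : ℝ))) +
      Real.log ((s.nreg 3 : ℝ) / ((2 : ℕ) : ℝ)) / ((2 : ℕ) : ℝ)) = 2 / s.rreg 0 ^ 2 *
      Real.log (200 * ((G.ell : ℝ) + 2) * Real.sqrt ((G.vol Finset.univ : ℝ) / 2)) := by
    have hV' : (0 : ℝ) < G.vol Finset.univ := by exact_mod_cast hV
    have h200 : (200 : ℝ) * ((G.ell : ℝ) + 2) ≠ 0 := by positivity
    rw [Real.log_mul h200 (by positivity), Real.log_sqrt (by positivity), h3, h4]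
    push_cast
    ring
  rw [setTOne, runs_seq, runs_setR, runs_seq, runs_setN]
  simp only [NExp.eval, NExp.cost, RExp.eval, RExp.cost, hx]
  set x := 2 / s.rreg 0 ^ 2 *
      Real.log (200 * ((G.ell : ℝ) + 2) * Real.sqrt ((G.vol Finset.univ : ℝ) / 2)) with hxdef
  have ht : G.tOne (s.rreg 0) = ⌈x⌉₊ := rfl
  refine Runs.mono (runs_loop (O := O) (fun s' => s'.nreg 6 ≤ ⌈x⌉₊)
    (fun s' => 20 * (⌈x⌉₊ - s'.nreg 6)) ?_ ?_) ?_
  · rintro s' hfr hi hg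
    have e1 : s'.rreg 1 = x := by rw [hfr.r 1 rfl]; simp
    simp only [BExp.Holds, RExp.eval, NExp.eval, e1, ← Nat.ceil_le, not_le] at hg
    simp only [runs_setN, NExp.eval, NExp.cost, BExp.cost, RExp.cost, Function.update_self]
    exact ⟨hg, by omega⟩
  · simp
  · rintro s' T ⟨⟨hi, hg, hT⟩, hfr⟩
    have e1 : s'.rreg 1 = x := by rw [hfr.r 1 rfl]; simp
    simp only [BExp.Holds, RExp.eval, NExp.eval, e1, ← Nat.ceil_le, not_not] at hg
    simp only [BExp.cost, NExp.cost, RExp.cost, Function.update_self] at hT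
    exact ⟨by omega, (le_antisymm hi hg).trans ht.symm⟩

/-- Register `7` becomes `(ℓ + 1) t₁`. -/
def setTLast : Cmd :=
  .seq (.setN 7 (.lit 0)) <|
  .seq (.setN 10 (.lit 0)) <|
  .loop (.not (.leN (.add (.reg 4) (.lit 1)) (.reg 10)))
    (.seq (.setN 7 (.add (.reg 7) (.reg 6))) (.setN 10 (.add (.reg 10) (.lit 1))))

theorem setTLast_spec (O : Oracle) (s : Store) : Runs O setTLast s fun s' T =>
    (T ≤ 20 * s.nreg 4 + 50 ∧ s'.nreg 7 = (s.nreg 4 + 1) * s.nreg 6) ∧ Frame setTLast s s' := by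
  refine Runs.frame ?_
  rw [setTLast, runs_seq, runs_setN, runs_seq, runs_setN]
  simp only [NExp.eval, NExp.cost]
  refine Runs.mono (runs_loop (O := O) (fun s' => s'.nreg 10 ≤ s.nreg 4 + 1 ∧
    s'.nreg 7 = s'.nreg 10 * s.nreg 6) (fun s' => 20 * (s.nreg 4 + 1 - s'.nreg 10)) ?_ ?_) ?_
  · rintro s' hfr ⟨hi, hp⟩ hg
    have e4 : s'.nreg 4 = s.nreg 4 := by rw [hfr.n 4 rfl]; simp
    have e6 : s'.nreg 6 = s.nreg 6 := by rw [hfr.n 6 rfl]; simp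
    simp only [BExp.Holds, NExp.eval, e4, not_le] at hg
    simp only [runs_seq, runs_setN, NExp.eval, NExp.cost, BExp.cost, Function.update_self,
      Function.update_of_ne (show (10 : ℕ) ≠ 7 by decide),
      Function.update_of_ne (show (7 : ℕ) ≠ 10 by decide)]
    exact ⟨⟨hg, by rw [hp, e6]; ring⟩, by omega⟩
  · simp
  · rintro s' T ⟨⟨⟨hi, hp⟩, hg, hT⟩, hfr⟩
    have e4 : s'.nreg 4 = s.nreg 4 := by rw [hfr.n 4 rfl]; simp
    simp only [BExp.Holds, NExp.eval, e4, not_not] at hg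
    simp only [BExp.cost, NExp.cost, Function.update_self] at hT
    exact ⟨by omega, by rw [hp, le_antisymm hi hg]⟩

/-- Compute the thresholds and the truncated initial vector. -/
def setReal : Cmd :=
  .seq (.setR 2 (.div (.ofNat (.lit 1)) (.mul (.mul (.mul (.ofNat (.lit 1800))
    (.add (.ofNat (.reg 4)) (.ofNat (.lit 2)))) (.ofNat (.reg 7))) (.ofNat (.reg 5))))) <|
  .seq (.setR 3 (.div (.ofNat (.lit 1)) (.mul (.mul (.ofNat (.lit 140))
    (.add (.ofNat (.reg 4)) (.ofNat (.lit 2)))) (.ofNat (.reg 5))))) <|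
  .cond (.leR (.mul (.ofNat (.deg (.reg 0))) (.reg 2)) (.ofNat (.lit 1)))
    (.seq (.storeN 1 (.lit 0) (.reg 0)) <| .seq (.storeR 0 (.lit 0) (.ofNat (.lit 1))) <|
      .setN 9 (.lit 1))
    (.setN 9 (.lit 0))

/-- The start vertex itself is removed when `d(v) ε > 1`; the list is then empty from the beginning.
-/
theorem setReal_spec {G : LoopGraph n} (hd : ∀ u, 0 < G.deg u) {adj : Fin n → List (Fin n)}
    (hadj : G.IsAdjList adj) {s : Store} {φ : ℝ} {b : ℕ} {v : Fin n} (h0 : s.nreg 0 = v)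
    (h4 : s.nreg 4 = G.ell) (h5 : s.nreg 5 = 2 ^ b) (h7 : s.nreg 7 = G.tLast φ)
    (hε : 0 < G.eps φ b) :
    Runs (oracle adj) setReal s fun s' T => (T ≤ 60 ∧ s'.rreg 2 = G.eps φ b ∧
      s'.rreg 3 = 1 / (140 * ((G.ell : ℝ) + 2) * 2 ^ b) ∧ Sparse n s' (G.rVec φ b v 0)) ∧
      Frame setReal s s' := by
  refine Runs.frame ?_
  have e2 : ((1 : ℕ) : ℝ) / (((1800 : ℕ) : ℝ) * ((G.ell : ℝ) + ((2 : ℕ) : ℝ)) * (G.tLast φ : ℝ) *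
      ((2 ^ b : ℕ) : ℝ)) = G.eps φ b := by
    rw [eps]; push_cast; rfl
  have e3 : ((1 : ℕ) : ℝ) / (((140 : ℕ) : ℝ) * ((G.ell : ℝ) + ((2 : ℕ) : ℝ)) *
      ((2 ^ b : ℕ) : ℝ)) = 1 / (140 * ((G.ell : ℝ) + 2) * 2 ^ b) := by
    push_cast; rfl
  have hr0 : G.rVec φ b v 0 = G.trunc (G.eps φ b) (Pi.single v 1) := rfl
  have hne : ∀ u, G.rVec φ b v 0 u ≠ 0 ↔ u = v ∧ (G.deg v : ℝ) * G.eps φ b ≤ 1 := by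
    intro u
    rw [hr0, G.trunc_ne_zero hd hε]
    by_cases hu : u = v
    · subst hu; simp
    · rw [Pi.single_eq_of_ne hu]
      have : (0 : ℝ) < G.deg u := by exact_mod_cast hd u
      have : 0 < (G.deg u : ℝ) * G.eps φ b := by positivity
      simp only [hu, false_and, iff_false]
      linarith
  simp only [setReal, runs_seq, runs_setR, runs_cond, runs_storeN, runs_storeR, runs_setN,
    NExp.eval, NExp.cost, RExp.eval, RExp.cost, BExp.Holds, BExp.cost, h0, h4, h5, h7, e2, e3,
    Function.update_self, Function.update_of_ne (show (2 : ℕ) ≠ 3 by decide), oracle_deg hadj]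
  rw [Nat.cast_one]
  constructor
  · intro h1
    refine ⟨by norm_num, trivial, trivial, ?_, ?_⟩
    · have hz : ∀ u : Fin n, ¬ False := fun _ => id
      have := (Enum.nil (n := n) (s.narr 1) (P := fun _ => False) hz).push (w := v)
        (P' := fun u => G.rVec φ b v 0 u ≠ 0) id fun u => by rw [hne]; simp [h1]
      simpa using this
    · intro i hi u hu
      simp only [Function.update_self] at hi hu ⊢
      obtain rfl : i = 0 := by omega
      rw [Function.update_self] at hu ⊢
      obtain rfl : v = u := Fin.ext hu
      rw [hr0, trunc, Pi.single_eq_same, if_pos h1]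
  · intro h1
    refine ⟨by norm_num, trivial, trivial, ?_, ?_⟩
    · simp only [Function.update_self]
      refine Enum.nil _ fun u => ?_
      rw [hne]
      exact fun h => h1 h.2
    · intro i hi
      simp at hi

/-- The implementation of the algorithm. -/
def program : Cmd :=
  .seq setPow <| .seq setEll <| .seq setTOne <| .seq setTLast <| .seq setReal <| .seq rounds <|
  .cond (.leN (.lit 1) (.reg 20)) (.setN 0 (.reg 16)) (.setN 0 (.lit 0))

/-- Each survivor carries mass at least `d(u) ε`, and the total mass is at most that of the
untruncated walk, which is `1`. This keeps the work of a round independent of the size of the graph,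
up to logarithms. -/
theorem suppVol_rVec_le (G : LoopGraph n) (hd : ∀ u, 0 < G.deg u) {φ : ℝ} {b : ℕ}
    (hε : 0 < G.eps φ b) (v : Fin n) (t : ℕ) :
    suppVol G (G.rVec φ b v t) ≤ ⌊1 / G.eps φ b⌋₊ := by
  classical
  refine Nat.le_floor ((le_div_iff₀ hε).2 ?_)
  rw [suppVol, LoopGraph.vol, Nat.cast_sum, Finset.sum_mul, ← G.sum_pVec hd v t]
  have hq := (G.rVec_qVec_nonneg φ b v t).1
  calc ∑ u with G.rVec φ b v t u ≠ 0, (G.deg u : ℝ) * G.eps φ b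
      ≤ ∑ u with G.rVec φ b v t u ≠ 0, G.qVec φ b v t u := by
        refine Finset.sum_le_sum fun u hu => ?_
        rw [Finset.mem_filter, G.rVec_eq_trunc, G.trunc_ne_zero hd hε] at hu
        exact hu.2
    _ ≤ ∑ u, G.qVec φ b v t u := Finset.sum_le_sum_of_subset_of_nonneg (Finset.subset_univ _)
        fun u _ _ => hq u
    _ ≤ ∑ u, G.pVec v t u := Finset.sum_le_sum fun u _ => G.qVec_le_pVec φ b v t u

theorem outputs_of_enum {s : Store} {S : Finset (Fin n)}
    (h : Enum n (s.narr 0) (s.nreg 0) (· ∈ S)) : s.Outputs S :=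
  ⟨h.get, h.mem⟩

theorem program_spec {G : LoopGraph n} (hd : ∀ u, 0 < G.deg u) (hm : 1 ≤ G.m)
    {adj : Fin n → List (Fin n)} (hadj : G.IsAdjList adj) (v : Fin n) {φ : ℝ} (hφ : 0 < φ)
    (b : ℕ) : Runs (oracle adj) program (start v b n (G.vol Finset.univ) φ) fun s T =>
      T ≤ ((670 + 120 * (G.ell + 2)) * ⌊1 / G.eps φ b⌋₊ + 170) * G.tLast φ +
        20 * b + 40 * G.ell + 20 * G.tOne φ + 300 ∧
      ∃ C, s.Outputs C ∧ G.NibbleOutput φ b v (G.survivors φ b v) C := by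
  have hV : 0 < G.vol Finset.univ := by
    have : (0 : ℝ) < G.vol Finset.univ := by
      have := hm
      unfold LoopGraph.m at this
      linarith
    exact_mod_cast this
  have hε := G.eps_pos hm hφ b
  -- Positive degrees give `n ≤ vol V ≤ 2 * 2 ^ ℓ`, so indices have at most `ℓ + 2` binary digits.
  have hnσ : n < 2 ^ (G.ell + 2) := by
    have h1 : n ≤ G.vol Finset.univ := by
      calc n = ∑ _u : Fin n, 1 := by simp
        _ ≤ G.vol Finset.univ := Finset.sum_le_sum fun u _ => hd u
    have h2 := (ell_le_iff G hV G.ell).1 le_rfl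
    have h3 : 2 ^ (G.ell + 2) = 4 * 2 ^ G.ell := by ring
    have h4 : 0 < 2 ^ G.ell := by positivity
    omega
  set s0 := start v b n (G.vol Finset.univ) φ with hs0
  have i0 : s0.nreg 0 = v := rfl
  have i1 : s0.nreg 1 = b := rfl
  have i3 : s0.nreg 3 = G.vol Finset.univ := rfl
  have i8 : s0.nreg 8 = 0 := rfl
  have i20 : s0.nreg 20 = 0 := rfl
  have j0 : s0.rreg 0 = φ := rfl
  rw [program, runs_seq]
  refine Runs.mono (setPow_spec _ s0) ?_
  rintro s1 T1 ⟨⟨hT1, h51⟩, f1⟩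
  rw [i1] at hT1 h51
  rw [runs_seq]
  refine Runs.mono (setEll_spec _ (G := G) ((f1.n 3 rfl).trans i3) hV) ?_
  rintro s2 T2 ⟨⟨hT2, h42⟩, f2⟩
  have g2 : s2.rreg 0 = φ := by rw [f2.r 0 rfl, f1.r 0 rfl, j0]
  rw [runs_seq]
  refine Runs.mono (setTOne_spec _ (G := G) (by rw [f2.n 3 rfl, f1.n 3 rfl, i3]) h42 hV) ?_
  rintro s3 T3 ⟨⟨hT3, h63⟩, f3⟩
  rw [g2] at hT3 h63
  have h43 : s3.nreg 4 = G.ell := by rw [f3.n 4 rfl, h42]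
  rw [runs_seq]
  refine Runs.mono (setTLast_spec _ s3) ?_
  rintro s4 T4 ⟨⟨hT4, h74⟩, f4⟩
  rw [h43] at hT4
  rw [h43, h63] at h74
  rw [runs_seq]
  refine Runs.mono (setReal_spec hd hadj (φ := φ) (b := b) (v := v)
    (by rw [f4.n 0 rfl, f3.n 0 rfl, f2.n 0 rfl, f1.n 0 rfl, i0]) (by rw [f4.n 4 rfl, h43])
    (by rw [f4.n 5 rfl, f3.n 5 rfl, f2.n 5 rfl, h51]) h74 hε) ?_
  rintro s5 T5 ⟨⟨hT5, hr2, hr3, hsp⟩, f5⟩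
  rw [runs_seq]
  refine Runs.mono (rounds_spec hd hadj (φ := φ) (b := b) (v := v) hsp
    (fun w => by rw [f5.na 3 rfl, f4.na 3 rfl, f3.na 3 rfl, f2.na 3 rfl, f1.na 3 rfl]; rfl)
    (fun w => by rw [f5.na 5 rfl, f4.na 5 rfl, f3.na 5 rfl, f2.na 5 rfl, f1.na 5 rfl]; rfl)
    (by rw [f5.n 3 rfl, f4.n 3 rfl, f3.n 3 rfl, f2.n 3 rfl, f1.n 3 rfl, i3])
    (by rw [f5.n 5 rfl, f4.n 5 rfl, f3.n 5 rfl, f2.n 5 rfl, h51])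
    (by rw [f5.n 7 rfl, h74]; rfl)
    (by rw [f5.n 8 rfl, f4.n 8 rfl, f3.n 8 rfl, f2.n 8 rfl, f1.n 8 rfl, i8])
    (by rw [f5.n 20 rfl, f4.n 20 rfl, f3.n 20 rfl, f2.n 20 rfl, f1.n 20 rfl, i20])
    hε hr2 (by rw [f5.r 0 rfl, f4.r 0 rfl, f3.r 0 rfl, g2]) hr3 hnσ
    (suppVol_rVec_le G hd hε v)) ?_
  rintro s6 T6 ⟨⟨hT6, hres⟩, -⟩
  simp only [runs_cond, runs_setN, BExp.Holds, NExp.eval, BExp.cost, NExp.cost]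
  refine ⟨fun hg => ⟨by omega, ?_⟩, fun hg => ⟨by omega, ∅, ?_, ?_⟩⟩
  · rcases hres with ⟨h1, -⟩ | ⟨h1, t, ht1, ht2, hno, hj1, hj2, hst, he⟩
    · omega
    · refine ⟨_, outputs_of_enum (S := G.sweep (G.qVec φ b v t) (s6.nreg 16)) ?_,
        Or.inl ⟨t, ht1, ht2, hno, _, hj1, hj2, hst, rfl⟩⟩
      simpa using he
  · exact outputs_of_enum (by simpa using Enum.nil _ (by simp))
  · rcases hres with ⟨h1, h2⟩ | ⟨h1, -⟩
    · exact Or.inr ⟨h2, rfl⟩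
    · omega

/-- The bound on the running time in terms of the input. -/
theorem time_bound {G : LoopGraph n} (hm : 1 < G.m) {φ : ℝ} (hφ : 0 < φ) (hφ1 : φ < 1) (b : ℕ) :
    ((((670 + 120 * (G.ell + 2)) * ⌊1 / G.eps φ b⌋₊ + 170) * G.tLast φ +
        20 * b + 40 * G.ell + 20 * G.tOne φ + 300 : ℕ) : ℝ) ≤
      1200000 * 121 * 14300 ^ 2 * (2 ^ b * Real.log G.m ^ 6 / φ ^ 4) := by
  obtain ⟨hlog, hL, -⟩ := G.param_bounds hm hφ hφ1
  have hT := G.tLast_le hm hφ hφ1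
  have hT1 : (1 : ℝ) ≤ G.tLast φ := by exact_mod_cast G.tLast_pos hm.le hφ
  have htT : (G.tOne φ : ℝ) ≤ G.tLast φ := by
    have : G.tOne φ ≤ G.tLast φ := Nat.le_mul_of_pos_left _ (Nat.succ_pos _)
    exact_mod_cast this
  have hb : (b : ℝ) ≤ 2 ^ b := by exact_mod_cast Nat.lt_two_pow_self.le
  have hP : (1 : ℝ) ≤ 2 ^ b := one_le_pow₀ (by norm_num)
  have hfl : (⌊1 / G.eps φ b⌋₊ : ℝ) ≤ 1800 * ((G.ell : ℝ) + 2) * G.tLast φ * 2 ^ b := by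
    refine (Nat.floor_le (div_nonneg zero_le_one (G.eps_pos hm.le hφ b).le)).trans ?_
    rw [eps, one_div_one_div]
  push_cast
  set F : ℝ := (⌊1 / G.eps φ b⌋₊ : ℝ) with hF
  set L : ℝ := (G.ell : ℝ) + 2 with hLdef
  set t : ℝ := (G.tLast φ : ℝ) with ht
  set P : ℝ := 2 ^ b with hPdef
  have hL2 : 2 ≤ L := by have : (0 : ℝ) ≤ G.ell := Nat.cast_nonneg _; linarith
  have hell : (G.ell : ℝ) = L - 2 := by rw [hLdef]; ring
  rw [hell]
  have hX : (1 : ℝ) ≤ L * t * P := by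
    have := mul_le_mul (mul_le_mul (by linarith : (1 : ℝ) ≤ L) hT1 (by norm_num) (by linarith)) hP
      (by norm_num) (by positivity)
    simpa using this
  have hY : L * t * P ≤ L ^ 2 * t ^ 2 * P := by
    have : (1 : ℝ) ≤ L * t := by nlinarith
    have h0 : 0 ≤ L * t * P := by linarith
    nlinarith
  have hb' : P ≤ L * t * P := by
    have : (1 : ℝ) ≤ L * t := by nlinarith
    nlinarith
  have hl' : L ≤ L * t * P := by
    have : (1 : ℝ) ≤ t * P := by nlinarith
    nlinarith
  have ht' : t ≤ L * t * P := by
    have : (1 : ℝ) ≤ L * P := by nlinarith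
    nlinarith
  -- Since `L ≥ 2`, `670 + 120 L ≤ 455 L`, and `455 * 1800 + 170` is below `1150000`. The gap up to
  -- `1200000` pays for computing the parameters.
  have h1 : ((670 + 120 * L) * F + 170) * t ≤ 1150000 * (L ^ 2 * t ^ 2 * P) := by
    have a1 : (670 + 120 * L) * F ≤ (455 * L) * (1800 * L * t * P) :=
      mul_le_mul (by linarith) hfl (Nat.cast_nonneg _) (by linarith)
    have a2 : ((670 + 120 * L) * F + 170) * t ≤ ((455 * L) * (1800 * L * t * P) + 170) * t :=
      mul_le_mul_of_nonneg_right (by linarith) (by linarith)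
    nlinarith
  have h2 : L ^ 2 * t ^ 2 * P ≤ (11 * Real.log G.m) ^ 2 *
      (14300 * Real.log G.m ^ 2 / φ ^ 2) ^ 2 * P := by
    gcongr
  have h3 : 1200000 * 121 * 14300 ^ 2 * (P * Real.log G.m ^ 6 / φ ^ 4) =
      1200000 * ((11 * Real.log G.m) ^ 2 * (14300 * Real.log G.m ^ 2 / φ ^ 2) ^ 2 * P) := by
    field_simp
    ring
  rw [h3]
  linarith

end Nibble

/-! ### The implementation, the size of `f₁` and the guarantees combined -/

theorem mainTheorem1 :
    -- an implementation, with its running time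
    (∃ (prog : RealRAM.Cmd) (K : ℝ),
      ∀ (n : ℕ) (G : LoopGraph n), (∀ u, 0 < G.deg u) → 1 ≤ G.m →
      ∀ adj : Fin n → List (Fin n), G.IsAdjList adj →
      ∀ (v : Fin n) (φ : ℝ) (b : ℕ), 0 < φ → φ < 1 →
      ∃ (C : Finset (Fin n)) (s : RealRAM.Store) (T : ℕ),
        RealRAM.Exec (LoopGraph.oracle adj) prog
          (RealRAM.start v b n (G.vol Finset.univ) φ) s T ∧
        s.Outputs C ∧
        G.NibbleOutput φ b v (G.survivors φ b v) C ∧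
        (1 < G.m → (T : ℝ) ≤ K * (2 ^ b * Real.log G.m ^ 6 / φ ^ 4))) ∧
    -- the size of `f₁(φ)`
    (∃ c : ℝ, 0 < c ∧ ∀ (n : ℕ) (G : LoopGraph n), 1 < G.m →
      ∀ φ : ℝ, 0 < φ → φ < 1 → c * (φ ^ 2 / Real.log G.m ^ 3) ≤ G.fOne φ) ∧
    -- (N.1), (N.2) and (N.3)
    (∀ (n : ℕ) (G : LoopGraph n), (∀ u, 0 < G.deg u) → 1 ≤ G.m →
      ∀ φ : ℝ, 0 < φ → φ < 1 →
      (∀ (v : Fin n) (b : ℕ) (k : ℕ → ℕ) (C : Finset (Fin n)), G.Admissible φ b v k →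
        G.NibbleOutput φ b v k C → C.Nonempty →
        G.conductance C ≤ φ ∧ (G.vol C : ℝ) ≤ 5 / 6 * (G.vol Finset.univ : ℝ)) ∧
      (∀ S : Finset (Fin n), (G.vol S : ℝ) ≤ 2 / 3 * (G.vol Finset.univ : ℝ) →
        G.conductance S ≤ G.fOne φ →
        ∃ Sg : Finset (Fin n), Sg ⊆ S ∧
          (G.vol S : ℝ) / 2 ≤ (G.vol Sg : ℝ) ∧
          (∀ v ∈ Sg, ∀ (b : ℕ) (k : ℕ → ℕ) (C : Finset (Fin n)), G.Admissible φ b v k →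
            G.NibbleOutput φ b v k C → C.Nonempty →
            (2 : ℝ) ^ b / 2 ≤ (G.vol (C ∩ S) : ℝ)) ∧
          ∃ part : Fin (G.ell + 1) → Finset (Fin n),
            (∀ i j, i ≠ j → Disjoint (part i) (part j)) ∧
            Finset.univ.biUnion part = Sg ∧
            ∀ b : Fin (G.ell + 1), ∀ v ∈ part b, ∀ (k : ℕ → ℕ) (C : Finset (Fin n)),
              G.Admissible φ b v k → G.NibbleOutput φ b v k C → C.Nonempty)) := by
  refine ⟨⟨Nibble.program, 1200000 * 121 * 14300 ^ 2, ?_⟩,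
    ⟨1 / (280 * 11 * 14300), by norm_num, fun n G hm φ h0 h1 => G.le_fOne hm h0 h1⟩,
    fun n G hd hm φ h0 h1 => G.nibble_guarantees hd hm h0 h1⟩
  intro n G hd hm adj hadj v φ b h0 h1
  obtain ⟨s, T, he, hT, C, hC, ho⟩ := Nibble.program_spec hd hm hadj v h0 b
  exact ⟨C, s, T, he, hC, ho, fun hm1 =>
    le_trans (Nat.cast_le.2 hT) (Nibble.time_bound hm1 h0 h1 b)⟩
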